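/- Let $\Omega\subset\mathbb R^2$ be a bounded domain (nonempty, open, connected) with $C^2$ boundary and inner unit normal $\nu$, and let $0<T<\infty$. Let $$H(\Omega)=\Big\{v\in L^2(\Omega;\mathbb R^2):\int_\Omega v\cdot\nabla p\,dx=0\ \text{ for all } p\in W^{1,2}_{loc}(\Omega)\text{ with }\nabla p\in L^2(\Omega)\Big\},$$ and let $P$ be the orthogonal projection of $L^2(\Omega;\mathbb R^2)$ onto $H(\Omega)$. Let $v_0\in H(\Omega)$ and let $v\in L^\infty(0,T;H(\Omega))$ be an admissible weak solution of the incompressible Euler equations with initial data $v_0$, that is, $$\int_0^T\!\!\int_\Omega\big(\partial_t\phi\cdot v+\nabla\phi:v\otimes v\big)\,dx\,dt+\int_\Omega v_0(x)\cdot\phi(x,0)\,dx=0$$ for every $\phi\in C_c^\infty(\Omega\times[0,T);\mathbb R^2)$ with $\operatorname{div}\phi=0$, and $\int_\Omega|v(x,t)|^2dx\le\int_\Omega|v_0(x)|^2dx$ for almost every $t\in(0,T)$. Suppose that there are $\delta>0$, $\alpha>0$ and a constant $C$ such that for almost every $t\in(0,T)$ the field $v(\cdot,t)$ (has a representative which)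 is Hölder continuous with exponent $\alpha$ and constant $C$ on $$\Gamma_\delta=\{x\in\overline\Omega:\operatorname{dist}(x,\partial\Omega)<\delta\}.$$ Then $v$ is a dissipative solution in the sense of Lions with initial data $v_0$. That is, after modification on a null set of times, $v$ is continuous from $[0,T]$ to $H(\Omega)$ equipped with the weak $L^2$ topology, $v(\cdot,0)=v_0$, and for every divergence-free $w\in C^1(\overline\Omega\times[0,T];\mathbb R^2)$ with $w\cdot\nu=0$ on $\partial\Omega$ and every $t\in[0,T]$, $$\int_\Omega|v(x,t)-w(x,t)|^2dx\le e^{2\int_0^t\|S(w)\|_\infty ds}\int_\Omega|v(x,0)-w(x,0)|^2dx+2\int_0^t\!\!\int_\Omega e^{2\int_s^t\|S(w)\|_\infty d\tau}\,E(w)\cdot(v-w)\,dx\,ds,$$ where $S(w)=\frac12(\nabla w+\nabla w^t)$, $\|S(w)\|_\infty$ is the supremum over $\Omega$ of its operator norm at the given time, and $E(w)=-\partial_tw-P(w\cdot\nabla w)$. -/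

import Mathlib

open MeasureTheory Set
open scoped NNReal ENNReal ContDiff

noncomputable section

namespace EulerPlane

/-- The Euclidean plane. -/
abbrev Plane : Type := EuclideanSpace ℝ (Fin 2)

/-- The Hilbert space `L²(Ω; ℝ²)`. -/
abbrev L2 (Ω : Set Plane) : Type := Lp Plane 2 (volume.restrict Ω)

/-! ### Domains with boundary of class `C^k` -/

/-- `ρ` is a defining function of class `C^k` for `Ω` in the open set `U`:
its gradient does not vanish in `U` and `Ω ∩ U = {x ∈ U : ρ x > 0}`. -/
structure IsLocalDefiningFunction (k : ℕ) (Ω U : Set Plane) (ρ : Plane → ℝ) : Prop where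
  isOpen : IsOpen U
  contDiffOn : ContDiffOn ℝ k ρ U
  gradient_ne_zero : ∀ x ∈ U, gradient ρ x ≠ 0
  inter_eq : Ω ∩ U = {x ∈ U | 0 < ρ x}

/-- The open set `Ω` has boundary of class `C^k`. -/
def HasCkBoundary (k : ℕ) (Ω : Set Plane) : Prop :=
  ∀ x ∈ frontier Ω, ∃ (U : Set Plane) (ρ : Plane → ℝ),
    x ∈ U ∧ IsLocalDefiningFunction k Ω U ρ

/-- `n` is the inner unit normal to `∂Ω` at the boundary point `x`. -/
def IsInnerUnitNormal (Ω : Set Plane) (x n : Plane) : Prop :=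
  ∃ (U : Set Plane) (ρ : Plane → ℝ), x ∈ U ∧ IsLocalDefiningFunction 1 Ω U ρ ∧
    n = ‖gradient ρ x‖⁻¹ • gradient ρ x

/-- The boundary strip `Γ_δ = {x ∈ closure Ω : dist (x, ∂Ω) < δ}`. -/
def boundaryStrip (Ω : Set Plane) (δ : ℝ) : Set Plane :=
  {x ∈ closure Ω | Metric.infDist x (frontier Ω) < δ}

/-! ### Differential operators on vector fields of the plane -/

/-- The divergence `∂₁u₁ + ∂₂u₂`. -/
def divergence (u : Plane → Plane) (x : Plane) : ℝ :=
  ∑ i : Fin 2, (fderiv ℝ u x (EuclideanSpace.single i 1)) i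

/-- The symmetric gradient `S(u) = (∇u + ∇uᵗ) / 2`. -/
def symGrad (u : Plane → Plane) (x : Plane) : Plane →L[ℝ] Plane :=
  (1 / 2 : ℝ) • (fderiv ℝ u x + ContinuousLinearMap.adjoint (fderiv ℝ u x))

/-- `‖S(u)‖_∞`, the supremum over `Ω` of the operator norm of the symmetric gradient. -/
def symGradSup (Ω : Set Plane) (u : Plane → Plane) : ℝ :=
  ⨆ x : Ω, ‖symGrad u x‖

/-- The convective term `u · ∇u = u₁ ∂₁u + u₂ ∂₂u`. -/
def convective (u : Plane → Plane) (x : Plane) : Plane :=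
  fderiv ℝ u x (u x)

/-! ### Solenoidal fields and the Leray-Helmholtz projection -/

/-- `g` is the weak gradient of `p` in `Ω`. -/
def IsWeakGradient (Ω : Set Plane) (p : Plane → ℝ) (g : Plane → Plane) : Prop :=
  ∀ φ : Plane → ℝ, ContDiff ℝ ∞ φ → HasCompactSupport φ → tsupport φ ⊆ Ω →
    ∀ i : Fin 2, ∫ x in Ω, p x * fderiv ℝ φ x (EuclideanSpace.single i 1)
      = - ∫ x in Ω, g x i * φ x

/-- The gradients `∇p ∈ L²(Ω; ℝ²)` of functions `p ∈ W^{1,2}_loc(Ω)`. -/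
def gradientFields (Ω : Set Plane) : Set (L2 Ω) :=
  {g | ∃ p : Plane → ℝ,
    (∀ K ⊆ Ω, IsCompact K → MemLp p 2 (volume.restrict K)) ∧ IsWeakGradient Ω p g}

/-- The space `H(Ω)` of solenoidal fields: the `v ∈ L²(Ω; ℝ²)` which are orthogonal in `L²`
to all gradients in `L²(Ω; ℝ²)` of functions in `W^{1,2}_loc(Ω)`. -/
def H (Ω : Set Plane) : Submodule ℝ (L2 Ω) :=
  (Submodule.span ℝ (gradientFields Ω))ᗮ

theorem mem_H {Ω : Set Plane} {v : L2 Ω} :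
    v ∈ H Ω ↔ ∀ g ∈ gradientFields Ω, ∫ x in Ω, inner ℝ (v x) (g x) = 0 := by
  rw [H, Submodule.mem_orthogonal']
  constructor
  · intro h g hg
    exact (L2.inner_def v g).symm.trans (h g (Submodule.subset_span hg))
  · intro h u hu
    induction hu using Submodule.span_induction with
    | mem g hg => exact (L2.inner_def v g).trans (h g hg)
    | zero => exact inner_zero_right v
    | add a b _ _ ha hb => rw [inner_add_right, ha, hb, add_zero]
    | smul c a _ ha => rw [inner_smul_right, ha, mul_zero]

instance (Ω : Set Plane) : (H Ω).HasOrthogonalProjection := by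
  have : CompleteSpace (H Ω) :=
    (Submodule.isClosed_orthogonal (Submodule.span ℝ (gradientFields Ω))).completeSpace_coe
  exact Submodule.HasOrthogonalProjection.ofCompleteSpace _

open Classical in
/-- The Leray-Helmholtz projection onto `H(Ω)` (the orthogonal projection in `L²`) of a
vector field `f ∈ L²(Ω; ℝ²)`. The value for `f` not in `L²` is irrelevant. -/
def leray (Ω : Set Plane) (f : Plane → Plane) : L2 Ω :=
  if hf : MemLp f 2 (volume.restrict Ω) then (H Ω).starProjection (hf.toLp f) else 0

/-! ### Admissible weak solutions -/

/-- Divergence-free test fields `φ ∈ C_c^∞(Ω × [0,T); ℝ²)`, given as restrictions to times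
`t ≥ 0` of smooth fields on space-time. The first argument of `φ` is time. -/
structure IsTestField (Ω : Set Plane) (T : ℝ) (φ : ℝ → Plane → Plane) : Prop where
  contDiff : ContDiff ℝ ∞ (fun z : ℝ × Plane => φ z.1 z.2)
  hasCompactSupport : HasCompactSupport (fun z : ℝ × Plane => φ z.1 z.2)
  tsupport_subset : tsupport (fun z : ℝ × Plane => φ z.1 z.2) ⊆ Iio T ×ˢ Ω
  divergence_eq_zero : ∀ t ∈ Ico 0 T, ∀ x ∈ Ω, divergence (φ t) x = 0

/-- `v` is an admissible weak solution on `Ω × (0,T)` of the incompressible Euler equations with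
initial data `v₀`. Only the values of `v` at almost every time in `(0,T)` matter. -/
structure IsAdmissibleWeakSolution (Ω : Set Plane) (T : ℝ) (v₀ : H Ω) (v : ℝ → H Ω) :
    Prop where
  /-- `v ∈ L^∞(0,T; H(Ω))` -/
  memLp_top : MemLp v ∞ (volume.restrict (Ioo 0 T))
  /-- the weak form of the equations -/
  weak_form : ∀ φ : ℝ → Plane → Plane, IsTestField Ω T φ →
    (∫ t in (0 : ℝ)..T, ∫ x in Ω,
        (inner ℝ (deriv (fun s => φ s x) t) ((v t : L2 Ω) x)
          + inner ℝ (fderiv ℝ (φ t) x ((v t : L2 Ω) x)) ((v t : L2 Ω) x)))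
      + ∫ x in Ω, inner ℝ ((v₀ : L2 Ω) x) (φ 0 x) = 0
  /-- the energy inequality -/
  energy_le : ∀ᵐ t ∂(volume.restrict (Ioo 0 T)),
    ∫ x in Ω, ‖(v t : L2 Ω) x‖ ^ 2 ≤ ∫ x in Ω, ‖(v₀ : L2 Ω) x‖ ^ 2

/-- `v` is Hölder continuous in space with exponent `α` on the strip `Γ_δ`, uniformly for almost
every time `t ∈ (0,T)`. Since `v(t)` is an `L²` class, this refers to a representative of it. -/
def IsUniformlyHolderNearBoundary (Ω : Set Plane) (T δ : ℝ) (α : ℝ≥0) (v : ℝ → H Ω) : Prop :=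
  ∃ C : ℝ≥0, ∀ᵐ t ∂(volume.restrict (Ioo 0 T)), ∃ f : Plane → Plane,
    f =ᵐ[volume.restrict (Ω ∩ boundaryStrip Ω δ)] (v t : L2 Ω) ∧
      HolderOnWith C α f (boundaryStrip Ω δ)

/-! ### Dissipative solutions in the sense of Lions -/

/-- The comparison fields: divergence-free `w ∈ C¹(closure Ω × [0,T]; ℝ²)` which are tangent to
the boundary of `Ω`. The first argument of `w` is time. -/
structure IsComparisonField (Ω : Set Plane) (T : ℝ) (w : ℝ → Plane → Plane) : Prop where
  contDiffOn : ContDiffOn ℝ 1 (fun z : ℝ × Plane => w z.1 z.2) (Icc 0 T ×ˢ closure Ω)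
  divergence_eq_zero : ∀ t ∈ Icc 0 T, ∀ x ∈ Ω, divergence (w t) x = 0
  tangent : ∀ t ∈ Icc 0 T, ∀ x ∈ frontier Ω, ∀ n : Plane,
    IsInnerUnitNormal Ω x n → inner ℝ (w t x) n = 0

/-- `E(w) = -∂ₜw - P(w · ∇w)` at time `t`, with `P` the Leray-Helmholtz projection. -/
def eulerResidual (Ω : Set Plane) (T : ℝ) (w : ℝ → Plane → Plane) (t : ℝ) (x : Plane) : Plane :=
  -derivWithin (fun s => w s x) (Icc 0 T) t - leray Ω (convective (w t)) x

/-- `v ∈ C([0,T]; H_w(Ω))` is a dissipative solution of the Euler equations on `[0,T]`. -/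
structure IsDissipativeSolution (Ω : Set Plane) (T : ℝ) (v : ℝ → H Ω) : Prop where
  /-- continuity for the weak topology of `L²` -/
  weakly_continuous : ∀ h : L2 Ω, ContinuousOn (fun t => inner ℝ (v t : L2 Ω) h) (Icc 0 T)
  dissipation : ∀ w : ℝ → Plane → Plane, IsComparisonField Ω T w → ∀ t ∈ Icc 0 T,
    ∫ x in Ω, ‖(v t : L2 Ω) x - w t x‖ ^ 2
      ≤ Real.exp (2 * ∫ s in (0 : ℝ)..t, symGradSup Ω (w s))
          * (∫ x in Ω, ‖(v 0 : L2 Ω) x - w 0 x‖ ^ 2)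
        + 2 * ∫ s in (0 : ℝ)..t, ∫ x in Ω,
            Real.exp (2 * ∫ τ in s..t, symGradSup Ω (w τ))
              * inner ℝ (eulerResidual Ω T w s x) ((v s : L2 Ω) x - w s x)

end EulerPlane

end

/-!
The proof is a weak-strong uniqueness argument. Let `u` be the weakly continuous representative of
`v`, and let `w` be a comparison field. By the energy inequality the relative energy `‖u - w‖²` is
bounded by `R = ‖v₀‖² - 2⟨u, w⟩ + ‖w‖²`, with equality at the initial time. If the weak formulation
may be tested with `w`, then `R` is absolutely continuous with
`R' = 2⟨w - u, ∂ₜw⟩ - 2 ∫ (∇w u) · u`. Since `u` is orthogonal to the gradient `∇|w|²/2`, the last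
term is at most `2 ‖S(w)‖_∞ ‖u - w‖² - 2⟨P(w · ∇w), u - w⟩` (`IsTangentField.neg_quadForm_le`), and
Grönwall's inequality `le_exp_mul_add_integral_of_le` gives the claim
(`IsRepresentative.isDissipativeSolution`).

The difficulty is that `w` is only tangent to the boundary, whereas the test fields of the weak
formulation are compactly supported in `Ω`. A smooth field `X` which is transversal to `∂Ω`
provides deformations `Ψ y = y - ε X(y)` which move the complement of `Ω` away from `Ω`. Extend `w`
by zero to the plane; the extension is divergence-free in the sense of distributions because `w` is
tangent to `∂Ω`. Its mollification, transported by the Piola transform `adj(DΨ) (· ∘ Ψ)`, is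
smooth, divergence-free and compactly supported in `Ω` (`divergence_piola`,
`IsDeformationSeq.isSolenoidalTest`). These fields converge to `w`, and it remains to pass to the
limit in the transport term (`IsDeformationSeq.tendsto_quadratic`).

The gradient of the mollified field is the mollified gradient of `w`, which is harmless, plus a
boundary layer caused by the jump across `∂Ω`; the latter is the limit of integrals against the
gradients of cutoff functions `χ_r` of uniformly bounded variation
(`IsCutoffSeq.tendsto_boundary_layer`). In the transport term this layer is multiplied by
`∇χ_r(x) · DΨ(y) v(y)`, with `x` close to `y`. As elements of `H(Ω)` have no flux through the
boundary (`IsCutoffSeq.tendsto_flux_zero`), `DΨ(y) v(y)` may be replaced by `DΨ(y) v(y) - v(x)`,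
which is uniformly small by the Hölder continuity of `v` near `∂Ω`. Schur's test and Fatou's lemma
then show that the boundary layer disappears in the limit
(`IsDeformationSeq.lintegral_boundary_layer_le`).

The same deformed fields show that the solenoidal test fields are dense in `H(Ω)`
(`eq_zero_of_forall_isSolenoidalTest`). This determines the weak limits of `v` at each time, which
are the values of the representative `u` (`IsAdmissibleWeakSolution.exists_isRepresentative`).
Test fields which depend on time are reduced to stationary ones by freezing them
(`inner_eq_add_integral_of_frozen`).
-/

namespace EulerPlane

open Filter Topology Metric

/-! ### Integration by parts -/

section IntegrationByParts

variable {F : Type*} [NormedAddCommGroup F] [NormedSpace ℝ F]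

theorem integral_fderiv_apply_eq_zero {g : Plane → F} (hg : ContDiff ℝ 1 g)
    (hc : HasCompactSupport g) (z : Plane) : ∫ x, fderiv ℝ g x z = 0 := by
  have hd : Differentiable ℝ g := hg.differentiable one_ne_zero
  have hcont : Continuous fun x => fderiv ℝ g x z :=
    (hg.continuous_fderiv one_ne_zero).clm_apply continuous_const
  have h := integral_bilinear_fderiv_right_eq_neg_left_of_integrable
    (f := fun _ : Plane => (1 : ℝ)) (g := g) (v := z) (μ := volume)
    (B := ContinuousLinearMap.lsmul ℝ ℝ) (by simp)
    (by simpa using hcont.integrable_of_hasCompactSupport (hc.fderiv_apply ℝ z))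
    (by simpa using hg.continuous.integrable_of_hasCompactSupport hc)
    (fun x _ => by fun_prop) (fun x _ => hd x)
  simpa using h

theorem contDiff_of_forall_tsupport {n : WithTop ℕ∞} {g : Plane → F}
    (h : ∀ x ∈ tsupport g, ContDiffAt ℝ n g x) : ContDiff ℝ n g := by
  rw [contDiff_iff_contDiffAt]
  intro x
  by_cases hx : x ∈ tsupport g
  · exact h x hx
  · exact contDiffAt_const.congr_of_eventuallyEq (notMem_tsupport_iff_eventuallyEq.1 hx)

variable {Ω : Set Plane} {χ : Plane → ℝ} {g : Plane → F} {n : WithTop ℕ∞}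

theorem contDiff_cutoff_smul (hΩ : IsOpen Ω) (hχ : ContDiff ℝ n χ) (hs : tsupport χ ⊆ Ω)
    (hg : ContDiffOn ℝ n g Ω) : ContDiff ℝ n fun x => χ x • g x := by
  apply contDiff_of_forall_tsupport
  intro x hx
  have hxΩ : x ∈ Ω := hs (tsupport_smul_subset_left χ g hx)
  exact hχ.contDiffAt.smul (hg.contDiffAt (hΩ.mem_nhds hxΩ))

theorem fderiv_eq_zero_of_notMem_tsupport {x : Plane} {g : Plane → F} (hx : x ∉ tsupport g) :
    fderiv ℝ g x = 0 := by
  rw [(notMem_tsupport_iff_eventuallyEq.1 hx).fderiv_eq]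
  simp

/-- The product rule under the integral sign: a cutoff inside `Ω` kills the boundary terms. -/
theorem setIntegral_cutoff_mul_fderiv (hΩ : IsOpen Ω) (hχ : ContDiff ℝ 1 χ)
    (hc : HasCompactSupport χ) (hs : tsupport χ ⊆ Ω) (hg : ContDiffOn ℝ 1 g Ω) (z : Plane) :
    ∫ x in Ω, (χ x • fderiv ℝ g x z + fderiv ℝ χ x z • g x) = 0 := by
  have h1 := contDiff_cutoff_smul hΩ hχ hs hg
  have h2 : HasCompactSupport fun x => χ x • g x := hc.smul_right
  rw [← integral_fderiv_apply_eq_zero h1 h2 z,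
    setIntegral_eq_integral_of_forall_compl_eq_zero]
  · congr 1
    ext x
    by_cases hx : x ∈ tsupport χ
    · have hxΩ := hs hx
      rw [fderiv_fun_smul (hχ.differentiable one_ne_zero x)
        ((hg.differentiableOn one_ne_zero x hxΩ).differentiableAt (hΩ.mem_nhds hxΩ))]
      simp
    · have hx' : x ∉ tsupport fun x => χ x • g x :=
        fun h => hx (tsupport_smul_subset_left χ g h)
      rw [fderiv_eq_zero_of_notMem_tsupport hx', fderiv_eq_zero_of_notMem_tsupport hx,
        image_eq_zero_of_notMem_tsupport hx]
      simp
  · intro x hx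
    have hx : x ∉ tsupport χ := fun h => hx (hs h)
    rw [fderiv_eq_zero_of_notMem_tsupport hx, image_eq_zero_of_notMem_tsupport hx]
    simp

end IntegrationByParts

/-! ### A global defining function -/

theorem fderiv_apply_eq_inner_gradient {ρ : Plane → ℝ} {x : Plane} (e : Plane) :
    fderiv ℝ ρ x e = inner ℝ (gradient ρ x) e := by
  rw [gradient, InnerProductSpace.toDual_symm_apply]

/-- If the function `h` is nonnegative on `Ω`, vanishes at `y` and the ray from `y` in direction
`e` starts inside `Ω`, then the derivative of `h` at `y` in the direction `e` is nonnegative. -/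
theorem fderiv_apply_nonneg_of_ray {Ω : Set Plane} {h : Plane → ℝ} {y e : Plane}
    (hd : DifferentiableAt ℝ h y) (h0 : h y = 0) (hΩ : ∀ x ∈ Ω, 0 ≤ h x)
    (he : ∀ᶠ t : ℝ in 𝓝[>] 0, y + t • e ∈ Ω) : 0 ≤ fderiv ℝ h y e := by
  have h1 : HasDerivAt (fun t : ℝ => h (y + t • e)) (fderiv ℝ h y e) 0 :=
    hd.hasFDerivAt.hasLineDerivAt e
  have h2 := h1.hasDerivWithinAt (s := Ioi 0)
  rw [hasDerivWithinAt_iff_tendsto_slope' (by simp)] at h2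
  refine ge_of_tendsto h2 ?_
  filter_upwards [he, self_mem_nhdsWithin] with t ht htpos
  rw [slope_def_field]
  have : (0 : ℝ) < t := htpos
  simp only [zero_smul, add_zero, h0, sub_zero]
  exact div_nonneg (hΩ _ ht) this.le

/-- A direction in which `ρ` increases points into `{ρ > 0}`. -/
theorem eventually_pos_of_fderiv_pos {ρ : Plane → ℝ} {y e : Plane}
    (hd : DifferentiableAt ℝ ρ y) (h0 : ρ y = 0) (he : 0 < fderiv ℝ ρ y e) :
    ∀ᶠ t : ℝ in 𝓝[>] 0, 0 < ρ (y + t • e) := by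
  have h1 : HasDerivAt (fun t : ℝ => ρ (y + t • e)) (fderiv ℝ ρ y e) 0 :=
    hd.hasFDerivAt.hasLineDerivAt e
  have h2 := h1.hasDerivWithinAt (s := Ioi 0)
  rw [hasDerivWithinAt_iff_tendsto_slope' (by simp)] at h2
  filter_upwards [h2.eventually (lt_mem_nhds he), self_mem_nhdsWithin] with t ht htpos
  rw [slope_def_field] at ht
  have : (0 : ℝ) < t := htpos
  simp only [zero_smul, add_zero, h0, sub_zero] at ht
  exact (div_pos_iff_of_pos_right this).1 ht

/-- `ρ` is a global defining function of the bounded open set `Ω`. Only the class `C¹` is needed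
in the sequel, and `ρ` is compactly supported, so that it and its gradient are bounded and uniformly
continuous. -/
structure IsGlobalDefiningFunction (Ω : Set Plane) (ρ : Plane → ℝ) : Prop where
  contDiff : ContDiff ℝ 1 ρ
  hasCompactSupport : HasCompactSupport ρ
  mem_iff : ∀ x, x ∈ Ω ↔ 0 < ρ x
  fderiv_ne_zero : ∀ x ∈ frontier Ω, fderiv ℝ ρ x ≠ 0

/-- Local defining functions, multiplied by bump functions, are added up; inside `Ω` the constant
`1` serves as a local defining function. Along a direction `e` which points into `Ω`, each summand
has a nonnegative derivative at the boundary, so that the gradients do not cancel. -/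
theorem exists_globalDefiningFunction {Ω : Set Plane} (hΩ : IsOpen Ω)
    (hb : Bornology.IsBounded Ω) (hC : HasCkBoundary 2 Ω) :
    ∃ ρ : Plane → ℝ, IsGlobalDefiningFunction Ω ρ := by
  have hloc : ∀ x ∈ closure Ω, ∃ (U : Set Plane) (r : Plane → ℝ), x ∈ U ∧ IsOpen U ∧
      ContDiffOn ℝ 1 r U ∧ (∀ y ∈ U, y ∈ Ω ↔ 0 < r y) ∧
      ∀ y ∈ U, y ∈ frontier Ω → gradient r y ≠ 0 := by
    intro x hx
    by_cases hxΩ : x ∈ Ω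
    · refine ⟨Ω, fun _ => 1, hxΩ, hΩ, contDiffOn_const, by simp, fun y hy hy' => ?_⟩
      rw [hΩ.frontier_eq] at hy'
      exact absurd hy hy'.2
    · obtain ⟨U, r, hxU, hr⟩ := hC x (by rw [hΩ.frontier_eq]; exact ⟨hx, hxΩ⟩)
      refine ⟨U, r, hxU, hr.isOpen, hr.contDiffOn.of_le (by norm_num), fun y hy => ?_,
        fun y hy _ => hr.gradient_ne_zero y hy⟩
      have := Set.ext_iff.1 hr.inter_eq y
      simp only [mem_inter_iff, mem_ofPred_eq] at this
      tauto
  choose! U r hxU hUo hr hrΩ hgrad using hloc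
  have hball : ∀ x ∈ closure Ω, ∃ b : ContDiffBump x, closedBall x b.rOut ⊆ U x := by
    intro x hx
    obtain ⟨ε, hε, hεU⟩ := Metric.isOpen_iff.1 (hUo x hx) x (hxU x hx)
    refine ⟨⟨ε / 3, ε / 2, by positivity, by linarith⟩, ?_⟩
    exact (closedBall_subset_ball (by simp; linarith)).trans hεU
  choose! b hbU using hball
  have hcpt : IsCompact (closure Ω) := hb.isCompact_closure
  obtain ⟨t, htΩ, htc⟩ := hcpt.elim_nhds_subcover (fun x => ball x (b x).rOut)
    (fun x _ => ball_mem_nhds x (b x).rOut_pos)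
  have hts : ∀ i ∈ t, tsupport (fun x => b i x) ⊆ U i := fun i hi => by
    rw [show (fun x => b i x) = ⇑(b i) from rfl, (b i).tsupport_eq]
    exact hbU i (htΩ i hi)
  have hCi : ∀ i ∈ t, ContDiff ℝ 1 fun x => b i x * r i x := fun i hi =>
    contDiff_cutoff_smul (hUo i (htΩ i hi)) (b i).contDiff (hts i hi) (hr i (htΩ i hi))
  -- off `U i` the `i`-th summand vanishes
  have hz : ∀ i ∈ t, ∀ x, x ∉ U i → b i x = 0 := fun i hi x hx =>
    image_eq_zero_of_notMem_tsupport fun h => hx (hts i hi h)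
  have hnn : ∀ i ∈ t, ∀ x ∈ Ω, 0 ≤ b i x * r i x := by
    intro i hi x hx
    by_cases hxU : x ∈ U i
    · exact mul_nonneg (b i).nonneg ((hrΩ i (htΩ i hi) x hxU).1 hx).le
    · simp [hz i hi x hxU]
  have hnp : ∀ i ∈ t, ∀ x ∉ Ω, b i x * r i x ≤ 0 := by
    intro i hi x hx
    by_cases hxU : x ∈ U i
    · exact mul_nonpos_of_nonneg_of_nonpos (b i).nonneg
        (not_lt.1 fun h => hx ((hrΩ i (htΩ i hi) x hxU).2 h))
    · simp [hz i hi x hxU]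
  have hfr : ∀ i ∈ t, ∀ x ∈ frontier Ω, b i x * r i x = 0 := by
    intro i hi x hx
    rw [hΩ.frontier_eq] at hx
    refine le_antisymm (hnp i hi x hx.2) ?_
    have hcl : IsClosed {x | 0 ≤ b i x * r i x} :=
      isClosed_le continuous_const (hCi i hi).continuous
    exact closure_minimal (hnn i hi) hcl hx.1
  refine ⟨fun x => ∑ i ∈ t, b i x * r i x, ContDiff.sum hCi, ?_, fun x => ⟨fun hx => ?_, ?_⟩, ?_⟩
  · refine HasCompactSupport.of_support_subset_isCompact
      (K := ⋃ i ∈ t, tsupport (b i)) (t.isCompact_biUnion fun i _ => (b i).hasCompactSupport) ?_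
    intro x hx
    obtain ⟨i, hi, hne⟩ := Finset.exists_ne_zero_of_sum_ne_zero hx
    exact mem_biUnion hi (subset_tsupport _ (left_ne_zero_of_mul hne))
  · obtain ⟨i, hi, hxi⟩ := mem_iUnion₂.1 (htc (subset_closure hx))
    refine Finset.sum_pos' (fun i hi => hnn i hi x hx) ⟨i, hi, ?_⟩
    have hxU : x ∈ U i := hbU i (htΩ i hi) (ball_subset_closedBall hxi)
    exact mul_pos ((b i).pos_of_mem_ball hxi) ((hrΩ i (htΩ i hi) x hxU).1 hx)
  · contrapose!
    exact fun hx => Finset.sum_nonpos fun i hi => hnp i hi x hx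
  · intro y hy
    have hyc : y ∈ closure Ω := frontier_subset_closure hy
    obtain ⟨i, hi, hyi⟩ := mem_iUnion₂.1 (htc hyc)
    have hyU : y ∈ U i := hbU i (htΩ i hi) (ball_subset_closedBall hyi)
    have hrd : DifferentiableAt ℝ (r i) y := ((hr i (htΩ i hi)).differentiableOn one_ne_zero y
      hyU).differentiableAt ((hUo i (htΩ i hi)).mem_nhds hyU)
    have hbpos := (b i).pos_of_mem_ball hyi
    have hr0 : r i y = 0 := (mul_eq_zero.1 (hfr i hi y hy)).resolve_left hbpos.ne'
    -- the inward direction, given by one of the local defining functions which are active at `y`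
    set e := gradient (r i) y with he
    have hepos : 0 < fderiv ℝ (r i) y e := by
      rw [fderiv_apply_eq_inner_gradient, ← he, real_inner_self_eq_norm_sq]
      have := hgrad i (htΩ i hi) y hyU hy
      positivity
    have hray : ∀ᶠ s : ℝ in 𝓝[>] 0, y + s • e ∈ Ω := by
      have hcont : Tendsto (fun s : ℝ => y + s • e) (𝓝[>] 0) (𝓝 y) := by
        have : Continuous fun s : ℝ => y + s • e := by fun_prop
        simpa using this.continuousWithinAt.tendsto (x := 0) (s := Ioi 0)
      filter_upwards [eventually_pos_of_fderiv_pos hrd hr0 hepos,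
        hcont.eventually ((hUo i (htΩ i hi)).mem_nhds hyU)] with s hs hsU
      exact (hrΩ i (htΩ i hi) _ hsU).2 hs
    have hdj : ∀ j ∈ t, DifferentiableAt ℝ (fun x => b j x * r j x) y := fun j hj =>
      (hCi j hj).differentiable one_ne_zero y
    have hpos : 0 < fderiv ℝ (fun x => ∑ i ∈ t, b i x * r i x) y e := by
      rw [fderiv_fun_sum hdj, _root_.sum_apply]
      refine Finset.sum_pos' (fun j hj => fderiv_apply_nonneg_of_ray (hdj j hj) (hfr j hj y hy)
        (hnn j hj) hray) ⟨i, hi, ?_⟩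
      rw [fderiv_fun_mul (b i).contDiffAt.differentiableAt_one hrd]
      simp only [hr0, zero_smul, add_zero, _root_.smul_apply, smul_eq_mul]
      exact mul_pos hbpos hepos
    intro h0
    rw [h0] at hpos
    simp at hpos

/-! ### Mollification -/

/-- A mollification kernel of radius `κ`. The bound `le` compares it with the normalized indicator
of the ball of radius `κ`; the constant `4 = 2²` belongs to a bump function which equals its maximum
on the ball of radius `κ / 2`. -/
structure IsMollifier (κ : ℝ) (η : Plane → ℝ) : Prop where
  pos : 0 < κ
  contDiff : ContDiff ℝ ∞ η
  hasCompactSupport : HasCompactSupport η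
  nonneg : ∀ x, 0 ≤ η x
  integral_eq_one : ∫ x, η x = 1
  eq_zero : ∀ x, κ ≤ ‖x‖ → η x = 0
  le : ∀ x, η x ≤ 4 / volume.real (closedBall (0 : Plane) κ)

theorem exists_isMollifier {κ : ℝ} (hκ : 0 < κ) : ∃ η, IsMollifier κ η := by
  let b : ContDiffBump (0 : Plane) := ⟨κ / 2, κ, by positivity, by linarith⟩
  refine ⟨b.normed volume, hκ, b.contDiff_normed, b.hasCompactSupport_normed, b.nonneg_normed,
    b.integral_normed, fun x hx => ?_, fun x => ?_⟩
  · have : x ∉ Function.support (b.normed volume) := by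
      rw [b.support_normed_eq]
      simpa [b] using hx
    simpa using this
  · have h := b.normed_le_div_measure_closedBall_rOut volume 2 (by simp [b]; linarith) x
    have h2 : Module.finrank ℝ Plane = 2 := by simp
    rw [h2] at h
    norm_num at h
    exact h

/-- The convolution of `g` with the kernel `η`, with the variables arranged such that the kernel
`x ↦ η (p - x)` is the test function. -/
noncomputable def mollify (η : Plane → ℝ) {F : Type*} [NormedAddCommGroup F] [NormedSpace ℝ F]
    (g : Plane → F) (p : Plane) : F :=
  ∫ x, η (p - x) • g x

section Mollify

variable {F : Type*} [NormedAddCommGroup F] [NormedSpace ℝ F] {κ : ℝ} {η : Plane → ℝ}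
  {g : Plane → F}

theorem mollify_eq_convolution (η : Plane → ℝ) (g : Plane → F) :
    mollify η g = convolution g η (ContinuousLinearMap.lsmul ℝ ℝ).flip volume := by
  ext p
  simp [mollify, convolution]

theorem IsMollifier.contDiff_mollify [CompleteSpace F] (h : IsMollifier κ η)
    (hg : LocallyIntegrable g) : ContDiff ℝ ∞ (mollify η g) := by
  rw [mollify_eq_convolution]
  exact h.hasCompactSupport.contDiff_convolution_right _ hg h.contDiff

theorem IsMollifier.hasCompactSupport_comp_sub (h : IsMollifier κ η) (p : Plane) :
    HasCompactSupport fun x => η (p - x) :=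
  h.hasCompactSupport.comp_homeomorph (Homeomorph.subLeft p)

theorem IsMollifier.contDiff_comp_sub (h : IsMollifier κ η) (p : Plane) :
    ContDiff ℝ ∞ fun x => η (p - x) :=
  h.contDiff.comp (contDiff_const.sub contDiff_id)

theorem IsMollifier.integrable_smul (h : IsMollifier κ η) (hg : LocallyIntegrable g) (p : Plane) :
    Integrable fun x => η (p - x) • g x :=
  hg.integrable_smul_left_of_hasCompactSupport (h.contDiff_comp_sub p).continuous
    (h.hasCompactSupport_comp_sub p)

theorem IsMollifier.hasCompactSupport_fderiv_comp_sub (h : IsMollifier κ η) (p z : Plane) :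
    HasCompactSupport fun x => fderiv ℝ η (p - x) z :=
  (h.hasCompactSupport.fderiv_apply ℝ z).comp_homeomorph (Homeomorph.subLeft p)

theorem IsMollifier.continuous_fderiv_comp_sub (h : IsMollifier κ η) (p z : Plane) :
    Continuous fun x => fderiv ℝ η (p - x) z :=
  ((h.contDiff.continuous_fderiv (by simp)).comp (continuous_const.sub continuous_id)).clm_apply
    continuous_const

theorem IsMollifier.integrable_fderiv_smul (h : IsMollifier κ η) (hg : LocallyIntegrable g)
    (p z : Plane) : Integrable fun x => fderiv ℝ η (p - x) z • g x :=
  hg.integrable_smul_left_of_hasCompactSupport (h.continuous_fderiv_comp_sub p z)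
    (h.hasCompactSupport_fderiv_comp_sub p z)

theorem IsMollifier.fderiv_mollify_apply [CompleteSpace F] (h : IsMollifier κ η)
    (hg : LocallyIntegrable g) (p z : Plane) :
    fderiv ℝ (mollify η g) p z = ∫ x, fderiv ℝ η (p - x) z • g x := by
  rw [mollify_eq_convolution]
  have hη1 : ContDiff ℝ 1 η := h.contDiff.of_le (by simp)
  rw [(h.hasCompactSupport.hasFDerivAt_convolution_right _ hg hη1 p).fderiv, convolution_def,
    ContinuousLinearMap.integral_apply]
  · rfl
  · exact (h.hasCompactSupport.fderiv ℝ).convolutionExists_right _ hg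
      (hη1.continuous_fderiv one_ne_zero) p

theorem IsMollifier.fderiv_comp_sub (h : IsMollifier κ η) (p x z : Plane) :
    fderiv ℝ (fun x => η (p - x)) x z = -fderiv ℝ η (p - x) z := by
  have hd : DifferentiableAt ℝ η (p - x) := h.contDiff.differentiable (by simp) _
  have h1 : HasFDerivAt (fun x : Plane => p - x) (-ContinuousLinearMap.id ℝ Plane) x := by
    simpa using (hasFDerivAt_id x).const_sub p
  have h2 := hd.hasFDerivAt.comp x h1
  have h3 : fderiv ℝ (fun x => η (p - x)) x
      = (fderiv ℝ η (p - x)).comp (-ContinuousLinearMap.id ℝ Plane) := h2.fderiv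
  rw [h3]
  simp

theorem IsMollifier.integral_comp_sub (h : IsMollifier κ η) (p : Plane) :
    ∫ x, η (p - x) = 1 := by
  rw [integral_sub_left_eq_self (fun x => η x), h.integral_eq_one]

theorem IsMollifier.integrable_comp_sub (h : IsMollifier κ η) (p : Plane) :
    Integrable fun x => η (p - x) :=
  (h.contDiff_comp_sub p).continuous.integrable_of_hasCompactSupport
    (h.hasCompactSupport_comp_sub p)

theorem IsMollifier.norm_mollify_le (h : IsMollifier κ η) {M : ℝ} (p : Plane)
    (hM : ∀ x, dist x p < κ → ‖g x‖ ≤ M) : ‖mollify η g p‖ ≤ M := by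
  calc ‖mollify η g p‖ ≤ ∫ x, η (p - x) * M := by
        refine norm_integral_le_of_norm_le ((h.integrable_comp_sub p).mul_const M)
          (Eventually.of_forall fun x => ?_)
        rw [norm_smul, Real.norm_of_nonneg (h.nonneg _)]
        by_cases hx : dist x p < κ
        · exact mul_le_mul_of_nonneg_left (hM x hx) (h.nonneg _)
        · have : η (p - x) = 0 := h.eq_zero _ (by rw [← dist_eq_norm, dist_comm]; linarith)
          simp [this]
    _ = M := by rw [integral_mul_const, h.integral_comp_sub, one_mul]

theorem IsMollifier.norm_mollify_sub_le [CompleteSpace F] (h : IsMollifier κ η)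
    (hg : LocallyIntegrable g)
    {M : ℝ} (p : Plane) (c : F) (hM : ∀ x, dist x p < κ → ‖g x - c‖ ≤ M) :
    ‖mollify η g p - c‖ ≤ M := by
  have : mollify η g p - c = mollify η (fun x => g x - c) p := by
    have h1 : ∫ x, η (p - x) • c = c := by
      rw [integral_smul_const, h.integral_comp_sub, one_smul]
    simp only [mollify, smul_sub]
    rw [integral_sub (h.integrable_smul hg p) ((h.integrable_comp_sub p).smul_const c), h1]
  rw [this]
  exact h.norm_mollify_le p hM

theorem IsMollifier.mollify_eq_zero (h : IsMollifier κ η) (p : Plane)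
    (hM : ∀ x, dist x p < κ → g x = 0) : mollify η g p = 0 := by
  have := h.norm_mollify_le (g := g) (M := 0) p fun x hx => by simp [hM x hx]
  simpa using this

end Mollify

/-! ### A transversal vector field -/

/-- The field `X` is transversal to `∂Ω`, uniformly in a neighbourhood of the boundary: `ρ`
increases along it at the rate `c`. The derivative of `ρ` is taken at all points `z` close to `y`,
since the points `y - ε X(y)` enter below. -/
structure IsTransversal (Ω : Set Plane) (ρ : Plane → ℝ) (X : Plane → Plane) (c s : ℝ) :
    Prop where
  contDiff : ContDiff ℝ ∞ X
  hasCompactSupport : HasCompactSupport X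
  pos_rate : 0 < c
  pos_radius : 0 < s
  le_fderiv : ∀ y, infDist y (frontier Ω) < s → ∀ z, dist z y < s → c ≤ fderiv ℝ ρ z (X y)

theorem continuous_gradient {ρ : Plane → ℝ} (h : ContDiff ℝ 1 ρ) : Continuous (gradient ρ) :=
  (InnerProductSpace.toDual ℝ Plane).symm.continuous.comp (h.continuous_fderiv one_ne_zero)

theorem frontier_nonempty_of_isBounded {Ω : Set Plane} (hb : Bornology.IsBounded Ω)
    (hne : Ω.Nonempty) : (frontier Ω).Nonempty := by
  rw [nonempty_iff_ne_empty, Ne, frontier_eq_empty_iff]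
  rintro (h | h)
  · exact hne.ne_empty h
  · rw [h] at hb
    exact NormedSpace.unbounded_univ ℝ Plane hb

theorem isCompact_frontier_of_isBounded {Ω : Set Plane} (hb : Bornology.IsBounded Ω) :
    IsCompact (frontier Ω) :=
  hb.isCompact_closure.of_isClosed_subset isClosed_frontier frontier_subset_closure

/-- A smooth field close to `∇ρ` is transversal. -/
theorem IsGlobalDefiningFunction.exists_transversal {Ω : Set Plane} {ρ : Plane → ℝ}
    (hρ : IsGlobalDefiningFunction Ω ρ) (hb : Bornology.IsBounded Ω) (hne : Ω.Nonempty) :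
    ∃ X c s, IsTransversal Ω ρ X c s := by
  have hVc : Continuous (gradient ρ) := continuous_gradient hρ.contDiff
  have hVs : HasCompactSupport (gradient ρ) := by
    have := hρ.hasCompactSupport.fderiv ℝ
    exact this.comp_left (g := (InnerProductSpace.toDual ℝ Plane).symm) (by simp)
  have hfne := frontier_nonempty_of_isBounded hb hne
  have hfc := isCompact_frontier_of_isBounded hb
  obtain ⟨x₀, hx₀, hmin⟩ := hfc.exists_isMinOn hfne hVc.norm.continuousOn
  set m := ‖gradient ρ x₀‖ with hm
  have hmpos : 0 < m := by
    rw [hm, norm_pos_iff]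
    intro h
    apply hρ.fderiv_ne_zero x₀ hx₀
    ext e
    rw [fderiv_apply_eq_inner_gradient, h]
    simp
  -- `X` is a mollification of `∇ρ`, at a scale at which `∇ρ` oscillates by at most `m / 8`, where
  -- `m` is the minimum of `|∇ρ|` on the boundary
  obtain ⟨δ, hδ, hosc⟩ := Metric.uniformContinuous_iff.1
    (hVs.uniformContinuous_of_continuous hVc) (m / 8) (by positivity)
  obtain ⟨η, hη⟩ := exists_isMollifier hδ
  have hloc : LocallyIntegrable (gradient ρ) := hVc.locallyIntegrable
  refine ⟨mollify η (gradient ρ), m ^ 2 / 4, δ, hη.contDiff_mollify hloc, ?_, by positivity, hδ,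
    fun y hy z hz => ?_⟩
  · rw [mollify_eq_convolution]
    exact hVs.convolution _ hη.hasCompactSupport
  · obtain ⟨x, hx, hxy⟩ := (infDist_lt_iff hfne).1 hy
    have h1 : ‖gradient ρ y - gradient ρ x‖ < m / 8 := by
      rw [← dist_eq_norm]
      exact hosc hxy
    have h2 : ‖gradient ρ z - gradient ρ y‖ < m / 8 := by
      rw [← dist_eq_norm]
      exact hosc hz
    have h3 : ‖mollify η (gradient ρ) y - gradient ρ y‖ ≤ m / 8 := by
      refine hη.norm_mollify_sub_le hloc y _ fun x hx => ?_
      rw [← dist_eq_norm]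
      exact (hosc hx).le
    have h4 : m ≤ ‖gradient ρ x‖ := hmin hx
    rw [fderiv_apply_eq_inner_gradient]
    generalize mollify η (gradient ρ) y = X at *
    generalize gradient ρ z = Z at *
    generalize gradient ρ y = Y at *
    generalize gradient ρ x = W at *
    have h5 : ‖W‖ ≤ ‖Y‖ + ‖Y - W‖ := by
      have := norm_sub_le Y (Y - W)
      simpa using this
    have e : inner ℝ Z X = ‖Y‖ ^ 2 + inner ℝ Y (X - Y) + inner ℝ (Z - Y) Y
        + inner ℝ (Z - Y) (X - Y) := by
      rw [← real_inner_self_eq_norm_sq]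
      simp only [inner_sub_left, inner_sub_right]
      ring
    have i1 := neg_le_of_abs_le (abs_real_inner_le_norm Y (X - Y))
    have i2 := neg_le_of_abs_le (abs_real_inner_le_norm (Z - Y) Y)
    have i3 := neg_le_of_abs_le (abs_real_inner_le_norm (Z - Y) (X - Y))
    have j1 : ‖Y‖ * ‖X - Y‖ ≤ ‖Y‖ * (m / 8) := by gcongr
    have j2 : ‖Z - Y‖ * ‖Y‖ ≤ m / 8 * ‖Y‖ := by gcongr
    have j3 : ‖Z - Y‖ * ‖X - Y‖ ≤ m / 8 * (m / 8) := by gcongr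
    have hY : 7 / 8 * m ≤ ‖Y‖ := by linarith
    rw [e]
    nlinarith [mul_le_mul hY hY (by positivity) (norm_nonneg Y)]

/-! ### Cutoff functions -/

/-- A sequence of cutoff functions in `Ω` of uniformly bounded variation, which converges to `1`
in `Ω`. The gradients concentrate at the boundary, and become normal to it: this is the content
of the condition `tendsto_tangent`, for all `w` which are tangent to `∂Ω`. -/
structure IsCutoffSeq (Ω : Set Plane) (χ : ℕ → Plane → ℝ) (C : ℝ) : Prop where
  contDiff : ∀ n, ContDiff ℝ 1 (χ n)
  hasCompactSupport : ∀ n, HasCompactSupport (χ n)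
  tsupport_subset : ∀ n, tsupport (χ n) ⊆ Ω
  nonneg : ∀ n x, 0 ≤ χ n x
  le_one : ∀ n x, χ n x ≤ 1
  tendsto_one : ∀ x ∈ Ω, Tendsto (fun n => χ n x) atTop (𝓝 1)
  integral_le : ∀ n, ∫ x, ‖fderiv ℝ (χ n) x‖ ≤ C
  concentrates : ∀ s > 0, ∀ᶠ n in atTop, ∀ x, fderiv ℝ (χ n) x ≠ 0 → infDist x (frontier Ω) < s
  tendsto_tangent : ∀ w : Plane → Plane, ContinuousOn w (closure Ω) →
    (∀ x ∈ frontier Ω, ∀ n : Plane, IsInnerUnitNormal Ω x n → inner ℝ (w x) n = 0) →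
    Tendsto (fun n => ∫ x, ‖fderiv ℝ (χ n) x (w x)‖) atTop (𝓝 0)

/-- A function which is continuous in `Ω` and vanishes off a compact part of `Ω` is integrable. -/
theorem integrable_of_continuousOn_of_eq_zero {F : Type*} [NormedAddCommGroup F] {Ω K : Set Plane}
    {h : Plane → F} (hK : IsCompact K) (hKΩ : K ⊆ Ω) (hc : ContinuousOn h Ω)
    (h0 : ∀ x ∉ K, h x = 0) : Integrable h := by
  rw [← integrableOn_iff_integrable_of_support_subset (s := K)]
  · exact (hc.mono hKΩ).integrableOn_compact hK
  · intro x hx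
    by_contra h
    exact hx (h0 x h)

section Cutoff

variable {Ω : Set Plane} {χ : Plane → ℝ}

theorem continuous_divergence {u : Plane → Plane} (hu : ContDiff ℝ 1 u) :
    Continuous (divergence u) :=
  continuous_finsetSum _ fun i _ => (EuclideanSpace.proj i).continuous.comp
    ((hu.continuous_fderiv one_ne_zero).clm_apply continuous_const)

theorem continuousOn_divergence {u : Plane → Plane} (hΩ : IsOpen Ω) (hu : ContDiffOn ℝ 1 u Ω) :
    ContinuousOn (divergence u) Ω :=
  continuousOn_finsetSum _ fun i _ => (EuclideanSpace.proj i).continuous.comp_continuousOn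
    ((hu.continuousOn_fderiv_of_isOpen hΩ le_rfl).clm_apply continuousOn_const)

/-- The divergence theorem for a vector field multiplied by a cutoff function. -/
theorem setIntegral_fderiv_cutoff (hΩ : IsOpen Ω) (hχ : ContDiff ℝ 1 χ)
    (hc : HasCompactSupport χ) (hs : tsupport χ ⊆ Ω) {g : Plane → Plane}
    (hg : ContDiffOn ℝ 1 g Ω) :
    ∫ x in Ω, fderiv ℝ χ x (g x) = -∫ x in Ω, χ x * divergence g x := by
  have hDg := hg.continuousOn_fderiv_of_isOpen hΩ le_rfl
  have hDχ : Continuous (fderiv ℝ χ) := hχ.continuous_fderiv one_ne_zero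
  have i1 : Integrable fun x => fderiv ℝ χ x (g x) :=
    integrable_of_continuousOn_of_eq_zero hc hs (hDχ.continuousOn.clm_apply hg.continuousOn)
      fun x hx => by rw [fderiv_eq_zero_of_notMem_tsupport hx]; simp
  have i2 : Integrable fun x => χ x * divergence g x :=
    integrable_of_continuousOn_of_eq_zero hc hs
      (hχ.continuous.continuousOn.mul (continuousOn_divergence hΩ hg))
      fun x hx => by rw [image_eq_zero_of_notMem_tsupport hx]; simp
  have i3 : ∀ i : Fin 2, Integrable (fun x => χ x • fderiv ℝ g x (EuclideanSpace.single i 1)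
      + fderiv ℝ χ x (EuclideanSpace.single i 1) • g x) := fun i =>
    integrable_of_continuousOn_of_eq_zero hc hs
      ((hχ.continuous.continuousOn.smul (hDg.clm_apply continuousOn_const)).add
        ((hDχ.continuousOn.clm_apply continuousOn_const).smul hg.continuousOn))
      fun x hx => by
        rw [fderiv_eq_zero_of_notMem_tsupport hx, image_eq_zero_of_notMem_tsupport hx]; simp
  have key : ∀ i : Fin 2, ∫ x in Ω, (χ x • fderiv ℝ g x (EuclideanSpace.single i 1)
      + fderiv ℝ χ x (EuclideanSpace.single i 1) • g x) i = 0 := by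
    intro i
    have h1 := setIntegral_cutoff_mul_fderiv hΩ hχ hc hs hg (EuclideanSpace.single i 1)
    have h2 := (EuclideanSpace.proj (𝕜 := ℝ) i).integral_comp_comm ((i3 i).integrableOn (s := Ω))
    rw [h1] at h2
    simpa using h2
  have hsum : ∀ x, χ x * divergence g x + fderiv ℝ χ x (g x)
      = ∑ i : Fin 2, (χ x • fderiv ℝ g x (EuclideanSpace.single i 1)
        + fderiv ℝ χ x (EuclideanSpace.single i 1) • g x) i := by
    intro x
    have hgx : g x = ∑ i : Fin 2, g x i • EuclideanSpace.single i (1 : ℝ) := by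
      ext j; fin_cases j <;> simp
    conv_lhs => rw [hgx]
    simp [divergence]
    ring
  have h0 : ∫ x in Ω, (χ x * divergence g x + fderiv ℝ χ x (g x)) = 0 := by
    simp_rw [hsum]
    have i4 : ∀ i : Fin 2, Integrable (fun x => (χ x • fderiv ℝ g x (EuclideanSpace.single i 1)
        + fderiv ℝ χ x (EuclideanSpace.single i 1) • g x) i) (volume.restrict Ω) := fun i =>
      ((EuclideanSpace.proj (𝕜 := ℝ) i).integrable_comp (i3 i)).integrableOn
    rw [integral_finsetSum _ fun i _ => i4 i]
    exact Finset.sum_eq_zero fun i _ => key i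
  rw [integral_add i2.integrableOn i1.integrableOn] at h0
  linarith

end Cutoff

theorem deriv_smoothTransition_eq_zero {t : ℝ} (ht : t < 0 ∨ 1 < t) :
    deriv Real.smoothTransition t = 0 := by
  rcases ht with ht | ht
  · have : Real.smoothTransition =ᶠ[𝓝 t] fun _ => 0 := by
      filter_upwards [Iio_mem_nhds ht] with x hx
      exact Real.smoothTransition.zero_of_nonpos (le_of_lt hx)
    rw [this.deriv_eq, deriv_const]
  · have : Real.smoothTransition =ᶠ[𝓝 t] fun _ => 1 := by
      filter_upwards [Ioi_mem_nhds ht] with x hx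
      exact Real.smoothTransition.one_of_one_le (le_of_lt hx)
    rw [this.deriv_eq, deriv_const]

theorem IsGlobalDefiningFunction.exists_pos_le {Ω : Set Plane} {ρ : Plane → ℝ}
    (hρ : IsGlobalDefiningFunction Ω ρ) {K : Set Plane} (hK : IsCompact K) (hKΩ : K ⊆ Ω) :
    ∃ m > 0, ∀ x ∈ K, m ≤ ρ x := by
  rcases K.eq_empty_or_nonempty with rfl | hne
  · exact ⟨1, one_pos, by simp⟩
  · obtain ⟨x, hx, hmin⟩ := hK.exists_isMinOn hne hρ.contDiff.continuous.continuousOn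
    exact ⟨ρ x, (hρ.mem_iff x).1 (hKΩ hx), fun y hy => hmin hy⟩

theorem IsGlobalDefiningFunction.isOpen {Ω : Set Plane} {ρ : Plane → ℝ}
    (hρ : IsGlobalDefiningFunction Ω ρ) : IsOpen Ω := by
  have : Ω = ρ ⁻¹' Ioi 0 := by ext x; exact hρ.mem_iff x
  rw [this]
  exact isOpen_Ioi.preimage hρ.contDiff.continuous

theorem IsGlobalDefiningFunction.isInnerUnitNormal {Ω : Set Plane} {ρ : Plane → ℝ}
    (hρ : IsGlobalDefiningFunction Ω ρ) {x : Plane} (hx : x ∈ frontier Ω) :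
    IsInnerUnitNormal Ω x (‖gradient ρ x‖⁻¹ • gradient ρ x) := by
  refine ⟨{y | gradient ρ y ≠ 0}, ρ, fun h => hρ.fderiv_ne_zero x hx ?_, ⟨?_, ?_, fun y hy => hy,
    ?_⟩, rfl⟩
  · ext e
    rw [fderiv_apply_eq_inner_gradient, h]
    simp
  · exact isOpen_ne.preimage (continuous_gradient hρ.contDiff)
  · exact_mod_cast hρ.contDiff.contDiffOn
  · ext y
    have := hρ.mem_iff y
    simp only [mem_inter_iff, mem_ofPred_eq]
    tauto

/-- A field which is tangent to the boundary annihilates `ρ` there, since `∇ρ / |∇ρ|` is an inner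
unit normal. -/
theorem IsGlobalDefiningFunction.fderiv_eq_zero_of_tangent {Ω : Set Plane} {ρ : Plane → ℝ}
    (hρ : IsGlobalDefiningFunction Ω ρ) {x w : Plane} (hx : x ∈ frontier Ω)
    (hw : ∀ n : Plane, IsInnerUnitNormal Ω x n → inner ℝ w n = 0) : fderiv ℝ ρ x w = 0 := by
  have h := hw _ (hρ.isInnerUnitNormal hx)
  rw [inner_smul_right, mul_eq_zero, inv_eq_zero, norm_eq_zero] at h
  rw [fderiv_apply_eq_inner_gradient, real_inner_comm]
  rcases h with h | h
  · rw [h, inner_zero_right]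
  · exact h

/-- The cutoff functions are smoothed indicators of the sets `{ρ > r}`, `r → 0`. Their total
variation is controlled by testing with the transversal field `X`, which is legitimate since the
derivative of the cutoff in the direction `X` has a sign. -/
theorem IsGlobalDefiningFunction.exists_isCutoffSeq {Ω : Set Plane} {ρ : Plane → ℝ}
    (hρ : IsGlobalDefiningFunction Ω ρ) (hb : Bornology.IsBounded Ω) {X : Plane → Plane} {c s : ℝ}
    (hX : IsTransversal Ω ρ X c s) : ∃ χ C, IsCutoffSeq Ω χ C := by
  have hΩ : IsOpen Ω := hρ.isOpen
  have hcl : IsCompact (closure Ω) := hb.isCompact_closure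
  -- in `Ω`, small values of `ρ` are attained only near the boundary
  have hdeep : ∀ s > 0, ∃ m > 0, ∀ x ∈ Ω, ρ x < m → infDist x (frontier Ω) < s := by
    intro s hs
    have hK : IsCompact (closure Ω ∩ {x | s ≤ infDist x (frontier Ω)}) :=
      hcl.inter_right (isClosed_le continuous_const (continuous_infDist_pt _))
    obtain ⟨m, hm, hmK⟩ := hρ.exists_pos_le hK (by
      rintro x ⟨hx, hxs⟩
      by_contra hxΩ
      have : x ∈ frontier Ω := by rw [hΩ.frontier_eq]; exact ⟨hx, hxΩ⟩
      rw [mem_ofPred_eq, infDist_zero_of_mem this] at hxs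
      linarith)
    refine ⟨m, hm, fun x hx hxm => ?_⟩
    by_contra h
    exact absurd (hmK x ⟨subset_closure hx, not_lt.1 h⟩) (not_le.2 hxm)
  obtain ⟨m, hm, hms⟩ := hdeep s hX.pos_radius
  let r : ℕ → ℝ := fun n => m / 4 / (n + 1)
  have hr : ∀ n, 0 < r n := fun n => by positivity
  have hrm : ∀ n, 2 * r n < m := fun n => by
    have : r n ≤ m / 4 := div_le_self (by positivity) (by linarith [n.cast_nonneg (α := ℝ)])
    linarith
  have hr0 : Tendsto r atTop (𝓝 0) :=
    tendsto_const_div_atTop_nhds_zero_nat (m / 4) |>.comp (tendsto_add_atTop_nat 1) |>.congr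
      fun n => by simp [r]
  -- `χ n` vanishes where `ρ ≤ r n` and equals `1` where `ρ ≥ 2 r n`; its gradient is `a n • ∇ρ`
  let χ : ℕ → Plane → ℝ := fun n x => Real.smoothTransition (ρ x / r n - 1)
  let a : ℕ → Plane → ℝ := fun n x => deriv Real.smoothTransition (ρ x / r n - 1) / r n
  have hst : ContDiff ℝ 1 Real.smoothTransition := Real.smoothTransition.contDiff (n := 1)
  have hχC : ∀ n, ContDiff ℝ 1 (χ n) := fun n =>
    hst.comp ((hρ.contDiff.div_const _).sub contDiff_const)
  have hDχ : ∀ n x, fderiv ℝ (χ n) x = a n x • fderiv ℝ ρ x := by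
    intro n x
    have h1 : HasFDerivAt (fun x => ρ x / r n - 1) ((r n)⁻¹ • fderiv ℝ ρ x) x := by
      simpa [div_eq_inv_mul] using
        ((hρ.contDiff.differentiable one_ne_zero x).hasFDerivAt.const_mul (r n)⁻¹).sub_const 1
    have h2 : HasDerivAt Real.smoothTransition
        (deriv Real.smoothTransition (ρ x / r n - 1)) (ρ x / r n - 1) :=
      (hst.differentiable one_ne_zero _).hasDerivAt
    have h3 := h2.comp_hasFDerivAt x h1
    have h4 : fderiv ℝ (χ n) x = _ := h3.fderiv
    rw [h4, smul_smul]
    rfl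
  have hann : ∀ n x, 0 ≤ a n x := fun n x =>
    div_nonneg Real.smoothTransition.monotone.deriv_nonneg (hr n).le
  have hane : ∀ n x, a n x ≠ 0 → r n ≤ ρ x ∧ ρ x ≤ 2 * r n := by
    intro n x h
    have h1 : ¬(ρ x / r n - 1 < 0 ∨ 1 < ρ x / r n - 1) := fun h' => h (by
      simp only [a]
      rw [deriv_smoothTransition_eq_zero h', zero_div])
    push Not at h1
    have h2 := h1.1
    have h3 := h1.2
    constructor
    · have : 1 ≤ ρ x / r n := by linarith
      rwa [le_div_iff₀ (hr n), one_mul] at this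
    · have : ρ x / r n ≤ 2 := by linarith
      rwa [div_le_iff₀ (hr n)] at this
  have hχsupp : ∀ n, tsupport (χ n) ⊆ {x | r n ≤ ρ x} := by
    intro n
    refine closure_minimal (fun x hx => ?_) (isClosed_le continuous_const hρ.contDiff.continuous)
    by_contra h
    apply hx
    have : ρ x / r n < 1 := by rw [div_lt_one (hr n)]; exact not_le.1 h
    exact Real.smoothTransition.zero_of_nonpos (by linarith)
  have hχΩ : ∀ n, tsupport (χ n) ⊆ Ω := fun n x hx =>
    (hρ.mem_iff x).2 ((hr n).trans_le (hχsupp n hx))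
  have hχc : ∀ n, HasCompactSupport (χ n) := fun n =>
    hcl.of_isClosed_subset (isClosed_tsupport _) ((hχΩ n).trans subset_closure)
  have hac : ∀ n, Continuous (a n) := fun n =>
    ((hst.continuous_deriv_one.comp
      ((hρ.contDiff.continuous.div_const _).sub continuous_const)).div_const _)
  have ha0 : ∀ n, ∀ x ∉ closure Ω, a n x = 0 := by
    intro n x hx
    by_contra h
    exact hx (subset_closure ((hρ.mem_iff x).2 ((hr n).trans_le (hane n x h).1)))
  have hai : ∀ n, Integrable (a n) := fun n =>
    integrable_of_continuousOn_of_eq_zero hcl (subset_univ _) (hac n).continuousOn (ha0 n)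
  have hX1 : ContDiff ℝ 1 X := hX.contDiff.of_le (by simp)
  set D := ∫ x in Ω, |divergence X x| with hD
  have hDi : IntegrableOn (fun x => |divergence X x|) Ω :=
    ((continuous_divergence hX1).abs.continuousOn.integrableOn_compact hcl).mono_set subset_closure
  -- `c a ≤ ∂_X χ` where `a ≠ 0`, and the integral of `∂_X χ` is `-∫ χ div X`
  have haD : ∀ n, c * ∫ x, a n x ≤ D := by
    intro n
    have e1 : ∫ x in Ω, a n x = ∫ x, a n x := by
      refine setIntegral_eq_integral_of_forall_compl_eq_zero fun x hx => ?_
      by_contra h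
      exact hx ((hρ.mem_iff x).2 ((hr n).trans_le (hane n x h).1))
    have hXi : Integrable fun x => fderiv ℝ (χ n) x (X x) :=
      integrable_of_continuousOn_of_eq_zero (hχc n) (hχΩ n)
        (((hχC n).continuous_fderiv one_ne_zero).clm_apply hX1.continuous).continuousOn
        fun x hx => by rw [fderiv_eq_zero_of_notMem_tsupport hx]; simp
    calc c * ∫ x, a n x = ∫ x in Ω, c * a n x := by rw [integral_const_mul, e1]
      _ ≤ ∫ x in Ω, fderiv ℝ (χ n) x (X x) := by
        refine integral_mono ((hai n).integrableOn.const_mul c) hXi.integrableOn fun x => ?_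
        rw [hDχ, _root_.smul_apply, smul_eq_mul, mul_comm]
        by_cases h : a n x = 0
        · simp [h]
        · have hxn := hane n x h
          have hxΩ : x ∈ Ω := (hρ.mem_iff x).2 ((hr n).trans_le hxn.1)
          exact mul_le_mul_of_nonneg_left (hX.le_fderiv x
            (hms x hxΩ (hxn.2.trans_lt (hrm n))) x (by simpa using hX.pos_radius)) (hann n x)
      _ = -∫ x in Ω, χ n x * divergence X x :=
        setIntegral_fderiv_cutoff hΩ (hχC n) (hχc n) (hχΩ n) hX1.contDiffOn
      _ ≤ ‖∫ x in Ω, χ n x * divergence X x‖ := neg_le_abs _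
      _ ≤ D := by
        refine norm_integral_le_of_norm_le hDi (Eventually.of_forall fun x => ?_)
        rw [norm_mul, Real.norm_of_nonneg (Real.smoothTransition.nonneg _)]
        exact mul_le_of_le_one_left (norm_nonneg _) (Real.smoothTransition.le_one _)
  have hDnn : 0 ≤ D := integral_nonneg fun x => abs_nonneg _
  obtain ⟨L, hL⟩ : ∃ L, ∀ x, ‖fderiv ℝ ρ x‖ ≤ L :=
    (hρ.contDiff.continuous_fderiv one_ne_zero).bounded_above_of_compact_support
      (hρ.hasCompactSupport.fderiv ℝ)
  have hL0 : 0 ≤ L := (norm_nonneg _).trans (hL 0)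
  have haD' : ∀ n, ∫ x, a n x ≤ D / c := fun n => by
    rw [le_div_iff₀ hX.pos_rate, mul_comm]
    exact haD n
  refine ⟨χ, D / c * L, hχC, hχc, hχΩ, fun n x => Real.smoothTransition.nonneg _,
    fun n x => Real.smoothTransition.le_one _, fun x hx => ?_, fun n => ?_, fun s' hs' => ?_,
    fun w hw hwt => ?_⟩
  · have hpos := (hρ.mem_iff x).1 hx
    refine tendsto_const_nhds.congr' ?_
    filter_upwards [hr0.eventually (gt_mem_nhds (half_pos hpos))] with n hn
    refine (Real.smoothTransition.one_of_one_le ?_).symm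
    have : 2 ≤ ρ x / r n := by rw [le_div_iff₀ (hr n)]; linarith
    linarith
  · calc ∫ x, ‖fderiv ℝ (χ n) x‖ ≤ ∫ x, a n x * L := by
          refine integral_mono_of_nonneg (Eventually.of_forall fun x => norm_nonneg _)
            ((hai n).mul_const L) (Eventually.of_forall fun x => ?_)
          simp only
          rw [hDχ, norm_smul, Real.norm_of_nonneg (hann n x)]
          exact mul_le_mul_of_nonneg_left (hL x) (hann n x)
      _ ≤ D / c * L := by
          rw [integral_mul_const]
          exact mul_le_mul_of_nonneg_right (haD' n) hL0
  · obtain ⟨m', hm', hms'⟩ := hdeep s' hs'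
    filter_upwards [hr0.eventually (gt_mem_nhds (half_pos hm'))] with n hn x hx
    have hax : a n x ≠ 0 := fun h => hx (by rw [hDχ, h, zero_smul])
    have hxn := hane n x hax
    exact hms' x ((hρ.mem_iff x).2 ((hr n).trans_le hxn.1)) (by linarith [hxn.2])
  · rw [Metric.tendsto_atTop]
    intro ε hε
    have hfc : ContinuousOn (fun x => ‖fderiv ℝ ρ x (w x)‖) (closure Ω) :=
      ((hρ.contDiff.continuous_fderiv one_ne_zero).continuousOn.clm_apply hw).norm
    set ε' := ε / 2 / (D / c + 1) with hε'
    have hDc : 0 < D / c + 1 := by have := hX.pos_rate; positivity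
    have hε'pos : 0 < ε' := by positivity
    -- the set where `|∂_w ρ| ≥ ε'` is a compact part of `Ω`, as `w` is tangent; so it does not meet
    -- the support of `∇χ n` for large `n`
    have hK : IsCompact (closure Ω ∩ (fun x => ‖fderiv ℝ ρ x (w x)‖) ⁻¹' Ici ε') :=
      hcl.of_isClosed_subset (hfc.preimage_isClosed_of_isClosed isClosed_closure isClosed_Ici)
        inter_subset_left
    obtain ⟨m', hm', hmK⟩ := hρ.exists_pos_le hK (by
      rintro x ⟨hx, hxs⟩
      by_contra hxΩ
      have hxf : x ∈ frontier Ω := by rw [hΩ.frontier_eq]; exact ⟨hx, hxΩ⟩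
      have : fderiv ℝ ρ x (w x) = 0 := hρ.fderiv_eq_zero_of_tangent hxf (hwt x hxf)
      simp only [mem_preimage, this, norm_zero, mem_Ici] at hxs
      linarith)
    obtain ⟨N, hN⟩ := eventually_atTop.1 (hr0.eventually (gt_mem_nhds (half_pos hm')))
    refine ⟨N, fun n hn => ?_⟩
    have hb : ∀ x, ‖fderiv ℝ (χ n) x (w x)‖ ≤ a n x * ε' := by
      intro x
      rw [hDχ, _root_.smul_apply, norm_smul, Real.norm_of_nonneg (hann n x)]
      by_cases h : a n x = 0
      · simp [h]
      · refine mul_le_mul_of_nonneg_left ?_ (hann n x)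
        have hxn := hane n x h
        have hxΩ : x ∈ Ω := (hρ.mem_iff x).2 ((hr n).trans_le hxn.1)
        by_contra hlt
        have := hmK x ⟨subset_closure hxΩ, (not_le.1 hlt).le⟩
        linarith [hN n hn, hxn.2]
    have h1 : ∫ x, ‖fderiv ℝ (χ n) x (w x)‖ ≤ D / c * ε' := by
      calc ∫ x, ‖fderiv ℝ (χ n) x (w x)‖ ≤ ∫ x, a n x * ε' :=
            integral_mono_of_nonneg (Eventually.of_forall fun x => norm_nonneg _)
              ((hai n).mul_const _) (Eventually.of_forall hb)
        _ ≤ D / c * ε' := by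
          rw [integral_mul_const]
          exact mul_le_mul_of_nonneg_right (haD' n) hε'pos.le
    have h2 : D / c * ε' ≤ ε / 2 := by
      have : (D / c + 1) * ε' = ε / 2 := by rw [hε']; field_simp
      nlinarith
    rw [Real.dist_0_eq_abs, abs_of_nonneg (integral_nonneg fun x => norm_nonneg _)]
    linarith

/-! ### Trace, cofactor matrix, and the Piola transform -/

/-- The trace of a linear map of the plane. -/
noncomputable def traceCLM : (Plane →L[ℝ] Plane) →L[ℝ] ℝ :=
  ∑ i : Fin 2, (EuclideanSpace.proj i).comp
    (ContinuousLinearMap.apply ℝ Plane (EuclideanSpace.single i (1 : ℝ)))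

theorem traceCLM_apply (M : Plane →L[ℝ] Plane) :
    traceCLM M = ∑ i : Fin 2, M (EuclideanSpace.single i 1) i := by
  simp [traceCLM]

theorem divergence_eq_traceCLM (u : Plane → Plane) (x : Plane) :
    divergence u x = traceCLM (fderiv ℝ u x) := by
  rw [traceCLM_apply, divergence]

/-- The cofactor (adjugate) `tr A - A` of a linear map `A` of the plane, which depends linearly
on `A`. -/
noncomputable def adjCLM : (Plane →L[ℝ] Plane) →L[ℝ] (Plane →L[ℝ] Plane) :=
  traceCLM.smulRight (ContinuousLinearMap.id ℝ Plane)
    - ContinuousLinearMap.id ℝ (Plane →L[ℝ] Plane)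

theorem adjCLM_apply (M : Plane →L[ℝ] Plane) (z : Plane) :
    adjCLM M z = traceCLM M • z - M z := by
  simp [adjCLM]

theorem clm_apply_coord (M : Plane →L[ℝ] Plane) (z : Plane) (i : Fin 2) :
    M z i = z 0 * M (EuclideanSpace.single 0 1) i + z 1 * M (EuclideanSpace.single 1 1) i := by
  have hz : z = z 0 • EuclideanSpace.single 0 (1 : ℝ) + z 1 • EuclideanSpace.single 1 (1 : ℝ) := by
    ext j; fin_cases j <;> simp
  conv_lhs => rw [hz]
  simp

/-- The trace of `adj(A) B A` is `det A · tr B`, since `A adj(A) = det A`. -/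
theorem traceCLM_conj_eq_zero (A B : Plane →L[ℝ] Plane) (hB : traceCLM B = 0) :
    ∑ i : Fin 2, adjCLM A (B (A (EuclideanSpace.single i 1))) i = 0 := by
  simp only [traceCLM_apply, Fin.sum_univ_two] at hB
  simp only [Fin.sum_univ_two, adjCLM_apply, traceCLM_apply, PiLp.sub_apply, PiLp.smul_apply,
    smul_eq_mul]
  rw [clm_apply_coord A (B (A (EuclideanSpace.single 0 1))) 0,
    clm_apply_coord A (B (A (EuclideanSpace.single 1 1))) 1]
  simp only [clm_apply_coord B (A _)]
  linear_combination (A (EuclideanSpace.single 0 1) 0 * A (EuclideanSpace.single 1 1) 1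
    - A (EuclideanSpace.single 0 1) 1 * A (EuclideanSpace.single 1 1) 0) * hB

/-- The Piola transform `adj(DΨ) (U ∘ Ψ)` of a vector field `U` under `Ψ`. -/
noncomputable def piola (Ψ U : Plane → Plane) (y : Plane) : Plane :=
  adjCLM (fderiv ℝ Ψ y) (U (Ψ y))

section Piola

variable {Ψ U : Plane → Plane}

theorem contDiff_piola (hΨ : ContDiff ℝ ∞ Ψ) (hU : ContDiff ℝ ∞ U) : ContDiff ℝ ∞ (piola Ψ U) := by
  have h1 : ContDiff ℝ ∞ (fderiv ℝ Ψ) := hΨ.fderiv_right (by simp)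
  exact (adjCLM.contDiff.comp h1).clm_apply (hU.comp hΨ)

theorem fderiv_piola (hΨ : ContDiff ℝ ∞ Ψ) (hU : ContDiff ℝ 1 U) (y z : Plane) :
    fderiv ℝ (piola Ψ U) y z = adjCLM (fderiv ℝ Ψ y) (fderiv ℝ U (Ψ y) (fderiv ℝ Ψ y z))
      + adjCLM (fderiv ℝ (fderiv ℝ Ψ) y z) (U (Ψ y)) := by
  have h1 : ContDiff ℝ ∞ (fderiv ℝ Ψ) := hΨ.fderiv_right (by simp)
  have h2 : HasFDerivAt (fun y => adjCLM (fderiv ℝ Ψ y))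
      (adjCLM.comp (fderiv ℝ (fderiv ℝ Ψ) y)) y :=
    adjCLM.hasFDerivAt.comp y (h1.differentiable (by simp) y).hasFDerivAt
  have h3 : HasFDerivAt (fun y => U (Ψ y)) ((fderiv ℝ U (Ψ y)).comp (fderiv ℝ Ψ y)) y :=
    (hU.differentiable one_ne_zero (Ψ y)).hasFDerivAt.comp y
      (hΨ.differentiable (by simp) y).hasFDerivAt
  have h4 : fderiv ℝ (piola Ψ U) y = _ := (h2.clm_apply h3).fderiv
  rw [h4]
  simp

/-- The Piola transform preserves solenoidal fields. The term in which `U` is differentiated is `det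
DΨ · div U`, and the term in which the cofactor matrix is differentiated vanishes by the symmetry of
the second derivatives of `Ψ`. -/
theorem divergence_piola (hΨ : ContDiff ℝ ∞ Ψ) (hU : ContDiff ℝ 1 U)
    (hdiv : ∀ p, divergence U p = 0) (y : Plane) : divergence (piola Ψ U) y = 0 := by
  have hsymm : ∀ a b, fderiv ℝ (fderiv ℝ Ψ) y a b = fderiv ℝ (fderiv ℝ Ψ) y b a := by
    have h : IsSymmSndFDerivAt ℝ Ψ y :=
      hΨ.contDiffAt.isSymmSndFDerivAt
        (by rw [minSmoothness_of_isRCLikeNormedField]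
            exact WithTop.coe_le_coe.2 (le_top : (2 : ℕ∞) ≤ ⊤))
    exact fun a b => h a b
  have h1 := traceCLM_conj_eq_zero (fderiv ℝ Ψ y) (fderiv ℝ U (Ψ y))
    (by rw [← divergence_eq_traceCLM, hdiv])
  have h2 : ∑ i : Fin 2, adjCLM (fderiv ℝ (fderiv ℝ Ψ) y (EuclideanSpace.single i 1))
      (U (Ψ y)) i = 0 := by
    simp only [Fin.sum_univ_two, adjCLM_apply, traceCLM_apply, PiLp.sub_apply, PiLp.smul_apply,
      smul_eq_mul]
    rw [clm_apply_coord _ (U (Ψ y)) 0, clm_apply_coord _ (U (Ψ y)) 1,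
      hsymm (EuclideanSpace.single 1 1) (EuclideanSpace.single 0 1)]
    ring
  unfold divergence
  simp only [fderiv_piola hΨ hU, PiLp.add_apply]
  rw [Finset.sum_add_distrib, h1, h2, add_zero]

end Piola

/-! ### Solenoidal test fields -/

/-- The divergence-free fields in `C_c^∞(Ω; ℝ²)`. -/
structure IsSolenoidalTest (Ω : Set Plane) (φ : Plane → Plane) : Prop where
  contDiff : ContDiff ℝ ∞ φ
  hasCompactSupport : HasCompactSupport φ
  tsupport_subset : tsupport φ ⊆ Ω
  divergence_eq_zero : ∀ x, divergence φ x = 0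

/-- The field `w`, extended by zero outside `Ω`, is divergence-free in the plane in the sense of
distributions. -/
def IsWeaklySolenoidal (Ω : Set Plane) (w : Plane → Plane) : Prop :=
  ∀ q : Plane → ℝ, ContDiff ℝ ∞ q → HasCompactSupport q → ∫ x in Ω, fderiv ℝ q x (w x) = 0

theorem apply_eq_sum_coord (L : Plane →L[ℝ] ℝ) (z : Plane) :
    L z = ∑ i : Fin 2, L (EuclideanSpace.single i 1) * z i := by
  have hz : z = z 0 • EuclideanSpace.single 0 (1 : ℝ) + z 1 • EuclideanSpace.single 1 (1 : ℝ) := by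
    ext j; fin_cases j <;> simp
  conv_lhs => rw [hz]
  simp [Fin.sum_univ_two, mul_comm]

/-- The divergence of the mollified field at `p` is the distributional divergence of the field,
tested with `x ↦ η (p - x)`. -/
theorem IsMollifier.divergence_mollify_eq_zero {Ω : Set Plane} (hΩ : IsOpen Ω) {w : Plane → Plane}
    {κ : ℝ} {η : Plane → ℝ} (h : IsMollifier κ η) (hwi : IntegrableOn w Ω)
    (hw : IsWeaklySolenoidal Ω w) (p : Plane) : divergence (mollify η (Ω.indicator w)) p = 0 := by
  have hwi' : Integrable (Ω.indicator w) := hwi.integrable_indicator hΩ.measurableSet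
  have hloc := hwi'.locallyIntegrable
  have h1 := hw (fun x => η (p - x)) (h.contDiff_comp_sub p) (h.hasCompactSupport_comp_sub p)
  simp_rw [h.fderiv_comp_sub] at h1
  rw [integral_neg, neg_eq_zero] at h1
  rw [← integral_indicator hΩ.measurableSet] at h1
  have h2 : ∀ i : Fin 2, (fderiv ℝ (mollify η (Ω.indicator w)) p (EuclideanSpace.single i 1)) i
      = ∫ x, fderiv ℝ η (p - x) (EuclideanSpace.single i 1) * (Ω.indicator w x) i := by
    intro i
    rw [h.fderiv_mollify_apply hloc]
    have h3 := (EuclideanSpace.proj (𝕜 := ℝ) i).integral_comp_comm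
      (h.integrable_fderiv_smul hloc p (EuclideanSpace.single i 1))
    simpa using h3.symm
  have h4 : ∀ i : Fin 2, Integrable fun x =>
      fderiv ℝ η (p - x) (EuclideanSpace.single i 1) * (Ω.indicator w x) i := by
    intro i
    have h3 := (EuclideanSpace.proj (𝕜 := ℝ) i).integrable_comp
      (h.integrable_fderiv_smul hloc p (EuclideanSpace.single i 1))
    simpa using h3
  unfold divergence
  simp_rw [h2]
  rw [← integral_finsetSum _ fun i _ => h4 i, ← h1]
  congr 1
  ext x
  by_cases hx : x ∈ Ω
  · simp only [hx, indicator_of_mem]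
    rw [apply_eq_sum_coord]
  · simp [hx]

/-! ### Deformation of the plane into the domain -/

/-- The map `y ↦ y - ε X(y)`; it moves the complement of `Ω` away from `Ω`. -/
noncomputable def deform (ε : ℝ) (X : Plane → Plane) (y : Plane) : Plane := y - ε • X y

/-- Parameters, tending to zero, for which the field `piola (deform ε X) (mollify η (Ω.indicator
w))` is supported in `Ω`. By `dist_le` the deformation is injective with a `2`-Lipschitz inverse,
and by `le_dist` the image of the complement of `Ω` keeps the distance `2κ` from `Ω`, which exceeds
the radius of the kernel. -/
structure IsDeformationSeq (Ω : Set Plane) (X : Plane → Plane) (ε κ : ℕ → ℝ)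
    (η : ℕ → Plane → ℝ) : Prop where
  contDiff : ContDiff ℝ ∞ X
  hasCompactSupport : HasCompactSupport X
  pos : ∀ n, 0 < ε n
  le_one : ∀ n, ε n ≤ 1
  tendsto_zero : Tendsto ε atTop (𝓝 0)
  isMollifier : ∀ n, IsMollifier (κ n) (η n)
  radius_le_one : ∀ n, κ n ≤ 1
  tendsto_radius : Tendsto κ atTop (𝓝 0)
  dist_le : ∀ n y y', dist y y' ≤ 2 * dist (deform (ε n) X y) (deform (ε n) X y')
  le_dist : ∀ n, ∀ y ∉ Ω, ∀ x ∈ Ω, 2 * κ n ≤ dist (deform (ε n) X y) x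

section Deformation

variable {Ω : Set Plane} {ρ : Plane → ℝ} {X : Plane → Plane} {c s : ℝ}

theorem exists_norm_le_of_hasCompactSupport {F : Type*} [NormedAddCommGroup F] {g : Plane → F}
    (hg : Continuous g) (hc : HasCompactSupport g) : ∃ B > 0, ∀ x, ‖g x‖ ≤ B := by
  obtain ⟨B, hB⟩ := hg.bounded_above_of_compact_support hc
  exact ⟨max B 1, by positivity, fun x => (hB x).trans (le_max_left _ _)⟩

/-- Near the boundary the deformation strictly decreases `ρ`, by the mean value theorem, hence it
maps points with `ρ ≤ 0` to points with `ρ < 0`. A point of the complement at a distance of at least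
`s` from the boundary stays in a ball which does not meet `∂Ω`, hence it does not reach `closure Ω`.
-/
theorem IsTransversal.exists_deform_notMem_closure (hX : IsTransversal Ω ρ X c s)
    (hρ : IsGlobalDefiningFunction Ω ρ) :
    ∃ ε₀ > 0, ∀ ε, 0 < ε → ε ≤ ε₀ → ∀ y ∉ Ω, deform ε X y ∉ closure Ω := by
  obtain ⟨B, hB, hXB⟩ := exists_norm_le_of_hasCompactSupport hX.contDiff.continuous
    hX.hasCompactSupport
  have hs := hX.pos_radius
  refine ⟨s / (2 * B), by positivity, fun ε hε hε₀ y hy hcl => ?_⟩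
  have hεB : ε * B < s := by
    have := mul_le_mul_of_nonneg_right hε₀ hB.le
    have h2 : s / (2 * B) * B = s / 2 := by field_simp
    linarith
  have hdist : ∀ t, 0 ≤ t → t ≤ ε → dist (deform t X y) y < s := by
    intro t ht htε
    rw [dist_eq_norm, deform, sub_sub_cancel_left, norm_neg, norm_smul, Real.norm_of_nonneg ht]
    exact (mul_le_mul htε (hXB y) (norm_nonneg _) hε.le).trans_lt hεB
  by_cases hys : infDist y (frontier Ω) < s
  · have hder : ∀ t, HasDerivAt (fun t => ρ (deform t X y))
        (-fderiv ℝ ρ (deform t X y) (X y)) t := by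
      intro t
      have h1 : HasDerivAt (fun t => deform t X y) (-X y) t := by
        have h0 := ((hasDerivAt_id t).smul_const (X y)).const_sub y
        rw [one_smul] at h0
        exact h0
      have h2 := (hρ.contDiff.differentiable one_ne_zero (deform t X y)).hasFDerivAt
        |>.comp_hasDerivAt t h1
      rw [map_neg] at h2
      exact h2
    obtain ⟨t, ht, hteq⟩ := exists_hasDerivAt_eq_slope (fun t => ρ (deform t X y)) _ hε
      (fun t _ => (hder t).continuousAt.continuousWithinAt) (fun t _ => hder t)
    have h1 := hX.le_fderiv y hys _ (hdist t ht.1.le ht.2.le)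
    have hρy : ρ y ≤ 0 := not_lt.1 fun h => hy ((hρ.mem_iff y).2 h)
    have h0 : deform 0 X y = y := by simp [deform]
    have h2 : 0 ≤ ρ (deform ε X y) :=
      closure_minimal (fun x hx => ((hρ.mem_iff x).1 hx).le)
        (isClosed_le continuous_const hρ.contDiff.continuous) hcl
    rw [h0, sub_zero, eq_div_iff hε.ne'] at hteq
    have hc := hX.pos_rate
    nlinarith
  · have hball : (ball y s ∩ Ω).Nonempty :=
      mem_closure_iff.1 hcl _ isOpen_ball (hdist ε hε.le le_rfl)
    have hfr : ∀ z ∈ ball y s, z ∉ frontier Ω := fun z hz hzf =>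
      hys ((infDist_le_dist_of_mem hzf).trans_lt (by rw [dist_comm]; exact hz))
    rw [hρ.isOpen.frontier_eq] at hfr
    have hsub : ball y s ⊆ Ω ∪ (closure Ω)ᶜ := fun z hz => by
      have := hfr z hz
      simp only [Set.mem_sdiff, mem_union, mem_compl_iff] at this ⊢
      tauto
    have hyc : y ∈ (closure Ω)ᶜ := (hsub (mem_ball_self hs)).resolve_left hy
    obtain ⟨z, -, hz1, hz2⟩ := (convex_ball y s).isPreconnected Ω _ hρ.isOpen
      isClosed_closure.isOpen_compl hsub hball ⟨y, mem_ball_self hs, hyc⟩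
    exact hz2 (subset_closure hz1)

/-- By compactness, the image of the complement of `Ω` has a positive distance from `Ω`: the
deformation moves points by a bounded amount, so that only a bounded set of points matters. -/
theorem exists_le_dist_deform (hb : Bornology.IsBounded Ω) (hΩ : IsOpen Ω) (hne : Ω.Nonempty)
    (hXc : Continuous X) (hXs : HasCompactSupport X) {ε : ℝ}
    (h : ∀ y ∉ Ω, deform ε X y ∉ closure Ω) :
    ∃ κ > 0, ∀ y ∉ Ω, ∀ x ∈ Ω, κ ≤ dist (deform ε X y) x := by
  obtain ⟨B, hB, hXB⟩ := exists_norm_le_of_hasCompactSupport hXc hXs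
  have hΨ : Continuous (deform ε X) := by unfold deform; fun_prop
  have hK : IsCompact (Ωᶜ ∩ {y | infDist (deform ε X y) Ω ≤ 1}) := by
    refine isCompact_of_isClosed_isBounded (hΩ.isClosed_compl.inter
      (isClosed_le ((continuous_infDist_pt _).comp hΨ) continuous_const)) ?_
    refine (hb.cthickening (δ := 2 + |ε| * B)).subset ?_
    rintro y ⟨-, hy⟩
    obtain ⟨x, hx, hxy⟩ := (infDist_lt_iff hne).1 (lt_of_le_of_lt hy one_lt_two)
    refine mem_cthickening_of_dist_le y x _ _ hx ?_
    have h1 : dist y (deform ε X y) ≤ |ε| * B := by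
      rw [dist_eq_norm, deform, sub_sub_cancel, norm_smul, Real.norm_eq_abs]
      exact mul_le_mul_of_nonneg_left (hXB y) (abs_nonneg _)
    linarith [dist_triangle y (deform ε X y) x]
  have hpos : ∀ y ∈ Ωᶜ ∩ {y | infDist (deform ε X y) Ω ≤ 1}, 0 < infDist (deform ε X y) Ω := by
    rintro y ⟨hy, -⟩
    refine lt_of_le_of_ne infDist_nonneg fun h0 => h y hy ?_
    exact (mem_closure_iff_infDist_zero hne).2 h0.symm
  obtain ⟨m, hm, hmK⟩ : ∃ m > 0, ∀ y ∈ Ωᶜ ∩ {y | infDist (deform ε X y) Ω ≤ 1},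
      m ≤ infDist (deform ε X y) Ω := by
    rcases (Ωᶜ ∩ {y | infDist (deform ε X y) Ω ≤ 1}).eq_empty_or_nonempty with h0 | h0
    · exact ⟨1, one_pos, by simp [h0]⟩
    · obtain ⟨x, hx, hmin⟩ := hK.exists_isMinOn h0
        ((continuous_infDist_pt Ω).comp hΨ).continuousOn
      exact ⟨_, hpos x hx, fun y hy => hmin hy⟩
  refine ⟨min 1 m, by positivity, fun y hy x hx => ?_⟩
  have h1 : infDist (deform ε X y) Ω ≤ dist (deform ε X y) x := infDist_le_dist_of_mem hx
  by_cases h2 : infDist (deform ε X y) Ω ≤ 1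
  · exact (min_le_right _ _).trans ((hmK y ⟨hy, h2⟩).trans h1)
  · exact (min_le_left _ _).trans ((not_le.1 h2).le.trans h1)

theorem exists_norm_sub_le_of_hasCompactSupport (hX : ContDiff ℝ ∞ X) (hc : HasCompactSupport X) :
    ∃ L > 0, ∀ x y, ‖X x - X y‖ ≤ L * ‖x - y‖ := by
  obtain ⟨L, hL, hLX⟩ := exists_norm_le_of_hasCompactSupport
    (hX.continuous_fderiv (by simp)) (hc.fderiv ℝ)
  refine ⟨L, hL, fun x y => ?_⟩
  exact convex_univ.norm_image_sub_le_of_norm_fderiv_le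
    (fun x _ => hX.differentiable (by simp) x) (fun x _ => hLX x) (mem_univ y) (mem_univ x)

theorem IsTransversal.exists_isDeformationSeq (hX : IsTransversal Ω ρ X c s)
    (hρ : IsGlobalDefiningFunction Ω ρ) (hb : Bornology.IsBounded Ω) (hne : Ω.Nonempty) :
    ∃ ε κ η, IsDeformationSeq Ω X ε κ η := by
  obtain ⟨ε₀, hε₀, hε₀Ω⟩ := hX.exists_deform_notMem_closure hρ
  obtain ⟨L, hL, hLX⟩ := exists_norm_sub_le_of_hasCompactSupport hX.contDiff hX.hasCompactSupport
  set e := min (min ε₀ 1) (1 / (2 * L)) with he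
  have hepos : 0 < e := by positivity
  let ε : ℕ → ℝ := fun n => e / (n + 1)
  have hε : ∀ n, 0 < ε n := fun n => by positivity
  have hεe : ∀ n, ε n ≤ e := fun n => div_le_self hepos.le (by linarith [n.cast_nonneg (α := ℝ)])
  have h1 : ∀ n, ∃ κ > 0, ∀ y ∉ Ω, ∀ x ∈ Ω, κ ≤ dist (deform (ε n) X y) x := fun n =>
    exists_le_dist_deform hb hρ.isOpen hne hX.contDiff.continuous hX.hasCompactSupport
      (hε₀Ω (ε n) (hε n) ((hεe n).trans ((min_le_left _ _).trans (min_le_left _ _))))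
  choose k hk hkΩ using h1
  have h2 : ∀ n : ℕ, ∃ η, IsMollifier (min (k n / 2) (1 / (n + 1))) η := fun n =>
    exists_isMollifier (by have := hk n; positivity)
  choose η hη using h2
  refine ⟨ε, fun n => min (k n / 2) (1 / (n + 1)), η, hX.contDiff, hX.hasCompactSupport, hε,
    fun n => (hεe n).trans ((min_le_left _ _).trans (min_le_right _ _)), ?_, hη, fun n => ?_, ?_,
    fun n y y' => ?_, fun n y hy x hx => ?_⟩
  · exact tendsto_const_div_atTop_nhds_zero_nat e |>.comp (tendsto_add_atTop_nat 1) |>.congr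
      fun n => by simp [ε]
  · refine (min_le_right _ _).trans ?_
    rw [div_le_one (by positivity)]
    linarith [n.cast_nonneg (α := ℝ)]
  · exact squeeze_zero (fun n => (hη n).pos.le) (fun n => min_le_right _ _)
      tendsto_one_div_add_atTop_nhds_zero_nat
  · have hLe : ε n * L ≤ 1 / 2 := by
      have := mul_le_mul_of_nonneg_right ((hεe n).trans (min_le_right _ _)) hL.le
      have h3 : 1 / (2 * L) * L = 1 / 2 := by field_simp
      linarith
    have h4 : ‖ε n • X y - ε n • X y'‖ ≤ 1 / 2 * ‖y - y'‖ := by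
      rw [← smul_sub, norm_smul, Real.norm_of_nonneg (hε n).le]
      calc ε n * ‖X y - X y'‖ ≤ ε n * (L * ‖y - y'‖) :=
            mul_le_mul_of_nonneg_left (hLX y y') (hε n).le
        _ = ε n * L * ‖y - y'‖ := by ring
        _ ≤ 1 / 2 * ‖y - y'‖ := mul_le_mul_of_nonneg_right hLe (norm_nonneg _)
    have h5 : deform (ε n) X y - deform (ε n) X y' = (y - y') - (ε n • X y - ε n • X y') := by
      simp only [deform]
      abel
    rw [dist_eq_norm, dist_eq_norm, h5]
    linarith [norm_sub_norm_le (y - y') (ε n • X y - ε n • X y')]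
  · have h3 := hkΩ n y hy x hx
    have h4 : min (k n / 2) (1 / ((n : ℝ) + 1)) ≤ k n / 2 := min_le_left _ _
    linarith

end Deformation

/-! ### Estimates for the deformation -/

theorem fderiv_deform {ε : ℝ} {X : Plane → Plane} (hX : ContDiff ℝ ∞ X) :
    fderiv ℝ (deform ε X) = fun y => ContinuousLinearMap.id ℝ Plane - ε • fderiv ℝ X y := by
  ext1 y
  have h : HasFDerivAt (deform ε X) (ContinuousLinearMap.id ℝ Plane - ε • fderiv ℝ X y) y :=
    (hasFDerivAt_id y).sub ((hX.differentiable (by simp) y).hasFDerivAt.const_smul ε)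
  exact h.fderiv

theorem adjCLM_id : adjCLM (ContinuousLinearMap.id ℝ Plane) = ContinuousLinearMap.id ℝ Plane := by
  ext z : 1
  rw [adjCLM_apply, traceCLM_apply]
  simp only [Fin.sum_univ_two]
  simp
  module

theorem contDiff_deform {ε : ℝ} {X : Plane → Plane} (hX : ContDiff ℝ ∞ X) :
    ContDiff ℝ ∞ (deform ε X) :=
  contDiff_id.sub (hX.const_smul ε)

theorem fderiv_fderiv_deform {ε : ℝ} {X : Plane → Plane} (hX : ContDiff ℝ ∞ X) (y z : Plane) :
    fderiv ℝ (fderiv ℝ (deform ε X)) y z = -(ε • fderiv ℝ (fderiv ℝ X) y z) := by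
  have h1 : ContDiff ℝ ∞ (fderiv ℝ X) := hX.fderiv_right (by simp)
  have h : HasFDerivAt (fderiv ℝ (deform ε X)) (0 - ε • fderiv ℝ (fderiv ℝ X) y) y := by
    rw [fderiv_deform hX]
    exact (hasFDerivAt_const _ y).sub ((h1.differentiable (by simp) y).hasFDerivAt.const_smul ε)
  rw [h.fderiv]
  simp

theorem tendsto_clm_apply {ι : Type*} {l : Filter ι} {M : ι → Plane →L[ℝ] Plane}
    {M₀ : Plane →L[ℝ] Plane} {z : ι → Plane} {z₀ : Plane} (hM : Tendsto M l (𝓝 M₀))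
    (hz : Tendsto z l (𝓝 z₀)) : Tendsto (fun n => M n (z n)) l (𝓝 (M₀ z₀)) := by
  have h := (isBoundedBilinearMap_apply (𝕜 := ℝ) (E := Plane) (F := Plane)).continuous.tendsto
    (M₀, z₀)
  exact h.comp (hM.prodMk_nhds hz)

namespace IsDeformationSeq

variable {Ω : Set Plane} {X : Plane → Plane} {ε κ : ℕ → ℝ} {η : ℕ → Plane → ℝ}

theorem contDiff_deform (h : IsDeformationSeq Ω X ε κ η) (n : ℕ) :
    ContDiff ℝ ∞ (deform (ε n) X) := EulerPlane.contDiff_deform h.contDiff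

theorem dist_deform_le (h : IsDeformationSeq Ω X ε κ η) :
    ∃ B > 0, ∀ n y, dist (deform (ε n) X y) y ≤ ε n * B := by
  obtain ⟨B, hB, hXB⟩ := exists_norm_le_of_hasCompactSupport h.contDiff.continuous
    h.hasCompactSupport
  refine ⟨B, hB, fun n y => ?_⟩
  rw [dist_eq_norm, deform, sub_sub_cancel_left, norm_neg, norm_smul,
    Real.norm_of_nonneg (h.pos n).le]
  exact mul_le_mul_of_nonneg_left (hXB y) (h.pos n).le

/-- The deformations are close to the identity in `C²`, uniformly at the rate `ε`. The derivatives
themselves are bounded because `ε ≤ 1`. -/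
theorem norm_fderiv_deform_sub_le (h : IsDeformationSeq Ω X ε κ η) :
    ∃ B > 0, ∀ n y, ‖fderiv ℝ (deform (ε n) X) y - ContinuousLinearMap.id ℝ Plane‖ ≤ ε n * B ∧
      ‖adjCLM (fderiv ℝ (deform (ε n) X) y) - ContinuousLinearMap.id ℝ Plane‖ ≤ ε n * B ∧
      ‖fderiv ℝ (deform (ε n) X) y‖ ≤ B ∧ ‖adjCLM (fderiv ℝ (deform (ε n) X) y)‖ ≤ B ∧
      ∀ z, ‖adjCLM (fderiv ℝ (fderiv ℝ (deform (ε n) X)) y z)‖ ≤ ε n * B * ‖z‖ := by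
  obtain ⟨B₁, hB₁, h1⟩ := exists_norm_le_of_hasCompactSupport
    (h.contDiff.continuous_fderiv (by simp)) (h.hasCompactSupport.fderiv ℝ)
  have hD : ContDiff ℝ ∞ (fderiv ℝ X) := h.contDiff.fderiv_right (by simp)
  obtain ⟨B₂, hB₂, h2⟩ := exists_norm_le_of_hasCompactSupport
    (hD.continuous_fderiv (by simp)) ((h.hasCompactSupport.fderiv ℝ).fderiv ℝ)
  obtain ⟨a, ha, hadj⟩ : ∃ a ≥ 0, ∀ M, ‖adjCLM M‖ ≤ a * ‖M‖ :=
    ⟨_, norm_nonneg adjCLM, adjCLM.le_opNorm⟩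
  obtain ⟨i, hi, hid⟩ : ∃ i ≥ 0, ‖ContinuousLinearMap.id ℝ Plane‖ ≤ i := ⟨_, norm_nonneg _, le_rfl⟩
  set B := B₁ + a * B₁ + i + a * B₂ with hB
  have e1 : ∀ n y, ‖fderiv ℝ (deform (ε n) X) y - ContinuousLinearMap.id ℝ Plane‖ ≤ ε n * B₁ := by
    intro n y
    rw [fderiv_deform h.contDiff, sub_sub_cancel_left, norm_neg, norm_smul,
      Real.norm_of_nonneg (h.pos n).le]
    exact mul_le_mul_of_nonneg_left (h1 y) (h.pos n).le
  have e2 : ∀ n y, ‖adjCLM (fderiv ℝ (deform (ε n) X) y) - ContinuousLinearMap.id ℝ Plane‖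
      ≤ ε n * (a * B₁) := by
    intro n y
    have e : adjCLM (fderiv ℝ (deform (ε n) X) y) - ContinuousLinearMap.id ℝ Plane
        = adjCLM (fderiv ℝ (deform (ε n) X) y - ContinuousLinearMap.id ℝ Plane) :=
      ((map_sub adjCLM _ _).trans (congrArg _ adjCLM_id)).symm
    rw [e]
    refine (hadj _).trans ?_
    calc a * _ ≤ a * (ε n * B₁) := mul_le_mul_of_nonneg_left (e1 n y) ha
      _ = ε n * (a * B₁) := by ring
  have haB₁ : 0 ≤ a * B₁ := by positivity
  have haB₂ : 0 ≤ a * B₂ := by positivity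
  have tri : ∀ (M : Plane →L[ℝ] Plane) n b, 0 ≤ b → ‖M - ContinuousLinearMap.id ℝ Plane‖ ≤ ε n * b →
      ‖M‖ ≤ b + i := by
    intro M n b hb hM
    have := norm_add_le (M - ContinuousLinearMap.id ℝ Plane) (ContinuousLinearMap.id ℝ Plane)
    rw [sub_add_cancel] at this
    have h3 : ε n * b ≤ b := mul_le_of_le_one_left hb (h.le_one n)
    linarith
  refine ⟨B, by positivity, fun n y => ⟨(e1 n y).trans ?_, (e2 n y).trans ?_,
    (tri _ n _ hB₁.le (e1 n y)).trans ?_, (tri _ n _ haB₁ (e2 n y)).trans ?_, fun z => ?_⟩⟩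
  · exact mul_le_mul_of_nonneg_left (by linarith) (h.pos n).le
  · exact mul_le_mul_of_nonneg_left (by linarith) (h.pos n).le
  · linarith
  · linarith
  · rw [fderiv_fderiv_deform h.contDiff]
    refine (hadj _).trans ?_
    rw [norm_neg, norm_smul, Real.norm_of_nonneg (h.pos n).le]
    have h3 : ‖fderiv ℝ (fderiv ℝ X) y z‖ ≤ B₂ * ‖z‖ :=
      ((fderiv ℝ (fderiv ℝ X) y).le_opNorm z).trans
        (mul_le_mul_of_nonneg_right (h2 y) (norm_nonneg _))
    calc a * (ε n * ‖fderiv ℝ (fderiv ℝ X) y z‖) ≤ a * (ε n * (B₂ * ‖z‖)) := by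
          have := (h.pos n).le
          gcongr
      _ = ε n * (a * B₂) * ‖z‖ := by ring
      _ ≤ ε n * B * ‖z‖ := by
          have := (h.pos n).le
          gcongr
          linarith

/-- Schur's test: since the deformation is bi-Lipschitz, the kernel `η (Ψ y - x)` has a bounded
integral with respect to `y`. The kernel is supported in a ball of radius `4κ`, whose volume is `16`
times that of the ball of radius `κ`, and it is bounded by `4` over the latter; hence the constant
`64`. -/
theorem lintegral_kernel_le (h : IsDeformationSeq Ω X ε κ η) (n : ℕ) (x : Plane) :
    ∫⁻ y, ENNReal.ofReal (η n (deform (ε n) X y - x)) ≤ 64 := by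
  have hη := h.isMollifier n
  have hκ := hη.pos
  by_cases hex : ∃ y₀, η n (deform (ε n) X y₀ - x) ≠ 0
  · obtain ⟨y₀, hy₀⟩ := hex
    have hlt : ∀ y, η n (deform (ε n) X y - x) ≠ 0 → ‖deform (ε n) X y - x‖ < κ n := fun y hy =>
      not_le.1 fun h' => hy (hη.eq_zero _ h')
    have hsub : ∀ y, η n (deform (ε n) X y - x) ≠ 0 → y ∈ closedBall y₀ (4 * κ n) := by
      intro y hy
      have h1 := hlt y hy
      have h2 := hlt y₀ hy₀
      rw [← dist_eq_norm] at h1 h2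
      have h3 := h.dist_le n y y₀
      have h4 := dist_triangle_right (deform (ε n) X y) (deform (ε n) X y₀) x
      rw [mem_closedBall]
      linarith
    set V := volume.real (closedBall (0 : Plane) (κ n)) with hV
    have hVpos : 0 < V :=
      ENNReal.toReal_pos (measure_closedBall_pos _ _ hκ).ne' measure_closedBall_lt_top.ne
    have hvol : volume (closedBall y₀ (4 * κ n)) = ENNReal.ofReal (16 * V) := by
      rw [Measure.addHaar_closedBall_mul volume y₀ (by norm_num : (0 : ℝ) ≤ 4) hκ.le, hV,
        ENNReal.ofReal_mul (by norm_num), Measure.real,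
        ENNReal.ofReal_toReal measure_closedBall_lt_top.ne]
      congr 2
      simp
      norm_num
    calc ∫⁻ y, ENNReal.ofReal (η n (deform (ε n) X y - x))
        ≤ ∫⁻ y, (closedBall y₀ (4 * κ n)).indicator (fun _ => ENNReal.ofReal (4 / V)) y := by
          refine lintegral_mono fun y => ?_
          by_cases hy : η n (deform (ε n) X y - x) = 0
          · simp [hy]
          · rw [indicator_of_mem (hsub y hy)]
            exact ENNReal.ofReal_le_ofReal (hη.le _)
      _ = ENNReal.ofReal (4 / V) * ENNReal.ofReal (16 * V) := by
          rw [lintegral_indicator_const measurableSet_closedBall, hvol]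
      _ = 64 := by
          rw [← ENNReal.ofReal_mul (by positivity)]
          have : 4 / V * (16 * V) = 64 := by field_simp; norm_num
          rw [this]
          norm_num
  · push Not at hex
    simp [hex]

/-- The bound of `lintegral_kernel_le`, integrated against `g` by Tonelli's theorem. -/
theorem lintegral_mollify_deform_le (h : IsDeformationSeq Ω X ε κ η) (n : ℕ) {g : Plane → ℝ}
    (hg : Integrable g) (hg0 : ∀ x, 0 ≤ g x) :
    ∫⁻ y, ENNReal.ofReal (mollify (η n) g (deform (ε n) X y)) ≤ ENNReal.ofReal (64 * ∫ x, g x) := by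
  have hη := h.isMollifier n
  have hΨ : Continuous (deform (ε n) X) := (h.contDiff_deform n).continuous
  have e1 : ∀ y, ENNReal.ofReal (mollify (η n) g (deform (ε n) X y))
      = ∫⁻ x, ENNReal.ofReal (η n (deform (ε n) X y - x)) * ENNReal.ofReal (g x) := by
    intro y
    rw [mollify, ofReal_integral_eq_lintegral_ofReal (hη.integrable_smul hg.locallyIntegrable _)
      (Eventually.of_forall fun x => smul_nonneg (hη.nonneg _) (hg0 x))]
    congr 1
    ext x
    rw [smul_eq_mul, ENNReal.ofReal_mul (hη.nonneg _)]
  simp_rw [e1]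
  rw [lintegral_lintegral_swap]
  · calc ∫⁻ x, ∫⁻ y, ENNReal.ofReal (η n (deform (ε n) X y - x)) * ENNReal.ofReal (g x)
        ≤ ∫⁻ x, 64 * ENNReal.ofReal (g x) := by
          refine lintegral_mono fun x => ?_
          rw [lintegral_mul_const']
          · exact mul_le_mul_left (h.lintegral_kernel_le n x) _
          · exact ENNReal.ofReal_ne_top
      _ = ENNReal.ofReal (64 * ∫ x, g x) := by
          rw [lintegral_const_mul' _ _ (by norm_num), ENNReal.ofReal_mul (by norm_num),
            ofReal_integral_eq_lintegral_ofReal hg (Eventually.of_forall hg0)]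
          norm_num
  · refine AEMeasurable.mul (M := ℝ≥0∞) ?_ ?_
    · refine (Measurable.ennreal_ofReal (Continuous.measurable ?_)).aemeasurable
      exact hη.contDiff.continuous.comp ((hΨ.comp continuous_fst).sub continuous_snd)
    · exact hg.aestronglyMeasurable.aemeasurable.ennreal_ofReal.comp_snd

theorem integrable_mollify_deform (h : IsDeformationSeq Ω X ε κ η) (n : ℕ) {g : Plane → ℝ}
    (hg : Integrable g) (hg0 : ∀ x, 0 ≤ g x) :
    Integrable fun y => mollify (η n) g (deform (ε n) X y) := by
  have hη := h.isMollifier n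
  have hc : Continuous fun y => mollify (η n) g (deform (ε n) X y) :=
    (hη.contDiff_mollify hg.locallyIntegrable).continuous.comp (h.contDiff_deform n).continuous
  refine ⟨hc.aestronglyMeasurable, ?_⟩
  have hnn : ∀ y, 0 ≤ mollify (η n) g (deform (ε n) X y) := fun y => integral_nonneg fun x =>
    smul_nonneg (hη.nonneg _) (hg0 x)
  rw [hasFiniteIntegral_iff_ofReal (Eventually.of_forall hnn)]
  exact (h.lintegral_mollify_deform_le n hg hg0).trans_lt ENNReal.ofReal_lt_top

theorem integral_mollify_deform_le (h : IsDeformationSeq Ω X ε κ η) (n : ℕ) {g : Plane → ℝ}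
    (hg : Integrable g) (hg0 : ∀ x, 0 ≤ g x) :
    ∫ y, mollify (η n) g (deform (ε n) X y) ≤ 64 * ∫ x, g x := by
  have hη := h.isMollifier n
  have hnn : ∀ y, 0 ≤ mollify (η n) g (deform (ε n) X y) := fun y => integral_nonneg fun x =>
    smul_nonneg (hη.nonneg _) (hg0 x)
  have h1 := h.lintegral_mollify_deform_le n hg hg0
  rw [← ofReal_integral_eq_lintegral_ofReal (h.integrable_mollify_deform n hg hg0)
    (Eventually.of_forall hnn)] at h1
  exact (ENNReal.ofReal_le_ofReal_iff (mul_nonneg (by norm_num) (integral_nonneg hg0))).1 h1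

/-- The test fields which replace `w`: the field is nonzero at `y` only if `deform ε X y` is closer
to `Ω` than the radius of the kernel, which excludes all `y` outside `Ω`. -/
theorem isSolenoidalTest (h : IsDeformationSeq Ω X ε κ η) (hΩ : IsOpen Ω)
    (hb : Bornology.IsBounded Ω) (hne : Ω.Nonempty) {w : Plane → Plane} (hwi : IntegrableOn w Ω)
    (hw : IsWeaklySolenoidal Ω w) (n : ℕ) :
    IsSolenoidalTest Ω (piola (deform (ε n) X) (mollify (η n) (Ω.indicator w))) := by
  have hη := h.isMollifier n
  have hwi' : Integrable (Ω.indicator w) := hwi.integrable_indicator hΩ.measurableSet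
  have hU : ContDiff ℝ ∞ (mollify (η n) (Ω.indicator w)) :=
    hη.contDiff_mollify hwi'.locallyIntegrable
  have hΨ := h.contDiff_deform n
  have hsub : tsupport (piola (deform (ε n) X) (mollify (η n) (Ω.indicator w))) ⊆ Ω := by
    have h1 : tsupport (piola (deform (ε n) X) (mollify (η n) (Ω.indicator w)))
        ⊆ {y | infDist (deform (ε n) X y) Ω ≤ κ n} := by
      refine closure_minimal (fun y hy => ?_)
        (isClosed_le ((continuous_infDist_pt _).comp hΨ.continuous) continuous_const)
      by_contra hyκ
      apply hy
      have : mollify (η n) (Ω.indicator w) (deform (ε n) X y) = 0 := by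
        refine hη.mollify_eq_zero _ fun x hx => ?_
        by_contra hne
        have hxΩ : x ∈ Ω := by
          by_contra hxΩ
          exact hne (indicator_of_notMem hxΩ _)
        exact hyκ ((infDist_le_dist_of_mem hxΩ).trans (by rw [dist_comm]; exact hx.le))
      rw [piola, this, map_zero]
    intro y hy
    by_contra hyΩ
    have h2 : 2 * κ n ≤ infDist (deform (ε n) X y) Ω :=
      (le_infDist hne).2 fun {x} hx => h.le_dist n y hyΩ x hx
    have h3 : infDist (deform (ε n) X y) Ω ≤ κ n := h1 hy
    linarith [hη.pos]
  refine ⟨contDiff_piola hΨ hU, ?_, hsub, ?_⟩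
  · exact hb.isCompact_closure.of_isClosed_subset (isClosed_tsupport _)
      (hsub.trans subset_closure)
  · exact divergence_piola hΨ (hU.of_le (by simp)) (hη.divergence_mollify_eq_zero hΩ hwi hw)

/-- The mollified and deformed field converges at points of continuity. -/
theorem tendsto_mollify_deform {F : Type*} [NormedAddCommGroup F] [NormedSpace ℝ F]
    [CompleteSpace F] (h : IsDeformationSeq Ω X ε κ η)
    {g : Plane → F} (hg : LocallyIntegrable g) {y : Plane} (hy : ContinuousAt g y) :
    Tendsto (fun n => mollify (η n) g (deform (ε n) X y)) atTop (𝓝 (g y)) := by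
  obtain ⟨B, hB, hBd⟩ := h.dist_deform_le
  rw [Metric.tendsto_atTop]
  intro e he
  obtain ⟨δ, hδ, hδy⟩ := Metric.continuousAt_iff.1 hy (e / 2) (by positivity)
  have hlim : Tendsto (fun n => κ n + ε n * B) atTop (𝓝 0) := by
    simpa using h.tendsto_radius.add (h.tendsto_zero.mul_const B)
  obtain ⟨N, hN⟩ := eventually_atTop.1 (hlim.eventually (gt_mem_nhds hδ))
  refine ⟨N, fun n hn => ?_⟩
  rw [dist_eq_norm]
  refine lt_of_le_of_lt ((h.isMollifier n).norm_mollify_sub_le hg _ (g y) (M := e / 2)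
    fun x hx => ?_) (by linarith)
  rw [← dist_eq_norm]
  refine (hδy ?_).le
  have := dist_triangle x (deform (ε n) X y) y
  linarith [hN n hn, hBd n y]

theorem tendsto_adj_fderiv_deform (h : IsDeformationSeq Ω X ε κ η) (y : Plane) :
    Tendsto (fun n => adjCLM (fderiv ℝ (deform (ε n) X) y)) atTop
      (𝓝 (ContinuousLinearMap.id ℝ Plane)) := by
  obtain ⟨B, hB, hBn⟩ := h.norm_fderiv_deform_sub_le
  rw [tendsto_iff_norm_sub_tendsto_zero]
  refine squeeze_zero (fun n => norm_nonneg _) (fun n => (hBn n y).2.1) ?_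
  simpa using h.tendsto_zero.mul_const B

theorem tendsto_fderiv_deform (h : IsDeformationSeq Ω X ε κ η) (y : Plane) :
    Tendsto (fun n => fderiv ℝ (deform (ε n) X) y) atTop (𝓝 (ContinuousLinearMap.id ℝ Plane)) := by
  obtain ⟨B, hB, hBn⟩ := h.norm_fderiv_deform_sub_le
  rw [tendsto_iff_norm_sub_tendsto_zero]
  refine squeeze_zero (fun n => norm_nonneg _) (fun n => (hBn n y).1) ?_
  simpa using h.tendsto_zero.mul_const B

theorem tendsto_piola (h : IsDeformationSeq Ω X ε κ η) {g : Plane → Plane}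
    (hg : LocallyIntegrable g) {y : Plane} (hy : ContinuousAt g y) :
    Tendsto (fun n => piola (deform (ε n) X) (mollify (η n) g) y) atTop (𝓝 (g y)) := by
  exact tendsto_clm_apply (h.tendsto_adj_fderiv_deform y) (h.tendsto_mollify_deform hg hy)

end IsDeformationSeq

section

/-! ### The space `H(Ω)` -/

variable {Ω : Set Plane}

theorem isFiniteMeasure_restrict_of_isBounded (hb : Bornology.IsBounded Ω) :
    IsFiniteMeasure (volume.restrict Ω) :=
  ⟨by simpa using hb.measure_lt_top⟩

theorem memLp_of_continuousOn_of_bound {F : Type*} [NormedAddCommGroup F]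
    (hΩ : IsOpen Ω) (hb : Bornology.IsBounded Ω) {g : Plane → F} (hg : ContinuousOn g Ω) {B : ℝ}
    (hB : ∀ x ∈ Ω, ‖g x‖ ≤ B) (p : ℝ≥0∞) : MemLp g p (volume.restrict Ω) := by
  have := isFiniteMeasure_restrict_of_isBounded hb
  exact MemLp.of_bound (hg.aestronglyMeasurable hΩ.measurableSet) B
    ((ae_restrict_iff' hΩ.measurableSet).2 (Eventually.of_forall hB))

theorem integrable_inner_of_memLp {μ : Measure Plane} {f g : Plane → Plane} (hf : MemLp f 2 μ)
    (hg : MemLp g 2 μ) : Integrable (fun x => inner ℝ (f x) (g x)) μ :=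
  (hf.norm.integrable_mul hg.norm).mono' (hf.1.inner hg.1)
    (Eventually.of_forall fun x => norm_inner_le_norm (f x) (g x))

/-- The elements of `H(Ω)` are orthogonal to the gradients of functions in `C¹(Ω)` with bounded
gradient. -/
theorem setIntegral_fderiv_eq_zero_of_mem_H (hΩ : IsOpen Ω) (hb : Bornology.IsBounded Ω)
    {f : L2 Ω} (hf : f ∈ H Ω) {g : Plane → ℝ} (hg : ContDiffOn ℝ 1 g Ω) {B : ℝ}
    (hB : ∀ x ∈ Ω, ‖fderiv ℝ g x‖ ≤ B) : ∫ x in Ω, fderiv ℝ g x (f x) = 0 := by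
  have hDg : ContinuousOn (fderiv ℝ g) Ω := hg.continuousOn_fderiv_of_isOpen hΩ le_rfl
  have hGc : ContinuousOn (gradient g) Ω :=
    (InnerProductSpace.toDual ℝ Plane).symm.continuous.comp_continuousOn hDg
  have hGm : MemLp (gradient g) 2 (volume.restrict Ω) :=
    memLp_of_continuousOn_of_bound hΩ hb hGc (B := B)
      (fun x hx => by rw [gradient, LinearIsometryEquiv.norm_map]; exact hB x hx) 2
  have hae := hGm.coeFn_toLp
  have hmem : hGm.toLp (gradient g) ∈ gradientFields Ω := by
    refine ⟨g, fun K hK hKc => ?_, fun φ hφ hφc hφs i => ?_⟩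
    · obtain ⟨M, hM⟩ := hKc.exists_bound_of_continuousOn (hg.continuousOn.mono hK)
      have : IsFiniteMeasure (volume.restrict K) :=
        isFiniteMeasure_restrict_of_isBounded hKc.isBounded
      exact MemLp.of_bound ((hg.continuousOn.mono hK).aestronglyMeasurable_of_isCompact hKc
        hKc.measurableSet) M ((ae_restrict_iff' hKc.measurableSet).2 (Eventually.of_forall hM))
    · have hφ1 : ContDiff ℝ 1 φ := hφ.of_le (by simp)
      have h1 := setIntegral_cutoff_mul_fderiv hΩ hφ1 hφc hφs hg (EuclideanSpace.single i 1)
      have i1 : Integrable fun x => φ x • fderiv ℝ g x (EuclideanSpace.single i 1) :=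
        integrable_of_continuousOn_of_eq_zero hφc hφs
          (hφ.continuous.continuousOn.smul (hDg.clm_apply continuousOn_const))
          fun x hx => by rw [image_eq_zero_of_notMem_tsupport hx, zero_smul]
      have i2 : Integrable fun x => fderiv ℝ φ x (EuclideanSpace.single i 1) • g x :=
        integrable_of_continuousOn_of_eq_zero hφc hφs
          (((hφ1.continuous_fderiv one_ne_zero).clm_apply continuous_const).continuousOn.smul
            hg.continuousOn)
          fun x hx => by rw [fderiv_eq_zero_of_notMem_tsupport hx]; simp
      rw [integral_add i1.integrableOn i2.integrableOn] at h1
      have h2 : ∫ x in Ω, (hGm.toLp (gradient g)) x i * φ x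
          = ∫ x in Ω, φ x • fderiv ℝ g x (EuclideanSpace.single i 1) := by
        refine integral_congr_ae ?_
        filter_upwards [hae] with x hx
        have e : gradient g x i = inner ℝ (gradient g x) (EuclideanSpace.single i 1) := by
          rw [EuclideanSpace.inner_single_right]
          simp
        rw [hx, fderiv_apply_eq_inner_gradient, smul_eq_mul, mul_comm, e]
      rw [h2]
      simp only [smul_eq_mul] at h1 ⊢
      simp_rw [mul_comm (g _)]
      linarith
  rw [← mem_H.1 hf _ hmem]
  refine integral_congr_ae ?_
  filter_upwards [hae] with x hx
  rw [hx, fderiv_apply_eq_inner_gradient, real_inner_comm]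

/-- The orthogonality to all gradients in `Ω` includes the gradients of test functions which do not
vanish at the boundary; hence the extension by zero is divergence-free in the plane. -/
theorem isWeaklySolenoidal_of_mem_H (hΩ : IsOpen Ω) (hb : Bornology.IsBounded Ω)
    {f : L2 Ω} (hf : f ∈ H Ω) : IsWeaklySolenoidal Ω f := by
  intro q hq hqc
  have hq1 : ContDiff ℝ 1 q := hq.of_le (by simp)
  obtain ⟨B, hB⟩ := (hq1.continuous_fderiv one_ne_zero).bounded_above_of_compact_support
    (hqc.fderiv ℝ)
  exact setIntegral_fderiv_eq_zero_of_mem_H hΩ hb hf hq1.contDiffOn fun x _ => hB x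

theorem IsSolenoidalTest.memLp {φ : Plane → Plane} (hφ : IsSolenoidalTest Ω φ) :
    MemLp φ 2 (volume.restrict Ω) :=
  (hφ.contDiff.continuous.memLp_of_hasCompactSupport hφ.hasCompactSupport).restrict Ω

/-- The definition of the weak gradient of `p`, tested with the components of `φ`, gives
`∫ ∇p · φ = -∫ p div φ = 0`. -/
theorem IsSolenoidalTest.toLp_mem_H {φ : Plane → Plane} (hφ : IsSolenoidalTest Ω φ) :
    hφ.memLp.toLp φ ∈ H Ω := by
  rw [mem_H]
  rintro g ⟨p, hp, hpg⟩
  let c : Fin 2 → Plane → ℝ := fun i x => φ x i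
  have hc : ∀ i, ContDiff ℝ ∞ (c i) := fun i =>
    (EuclideanSpace.proj (𝕜 := ℝ) i).contDiff.comp hφ.contDiff
  have hcc : ∀ i, HasCompactSupport (c i) := fun i =>
    hφ.hasCompactSupport.comp_left (g := fun z : Plane => z i) rfl
  have hcs : ∀ i, tsupport (c i) ⊆ tsupport φ := fun i =>
    tsupport_comp_subset (g := fun z : Plane => z i) rfl φ
  have hcd : ∀ i x z, fderiv ℝ (c i) x z = (fderiv ℝ φ x z) i := by
    intro i x z
    have h1 : HasFDerivAt (c i) ((EuclideanSpace.proj (𝕜 := ℝ) i).comp (fderiv ℝ φ x)) x :=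
      (EuclideanSpace.proj (𝕜 := ℝ) i).hasFDerivAt.comp x
        (hφ.contDiff.differentiable (by simp) x).hasFDerivAt
    rw [h1.fderiv]
    rfl
  have hpi : ∀ i, IntegrableOn (fun x => p x * fderiv ℝ (c i) x (EuclideanSpace.single i 1)) Ω := by
    intro i
    have hK : IsCompact (tsupport φ) := hφ.hasCompactSupport
    have hcont : Continuous fun x => fderiv ℝ (c i) x (EuclideanSpace.single i 1) :=
      ((hc i).continuous_fderiv (by simp)).clm_apply continuous_const
    have h1 : IntegrableOn (fun x => p x * fderiv ℝ (c i) x (EuclideanSpace.single i 1))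
        (tsupport φ) := by
      have : IsFiniteMeasure (volume.restrict (tsupport φ)) :=
        isFiniteMeasure_restrict_of_isBounded hK.isBounded
      exact IntegrableOn.mul_continuousOn
        ((hp _ hφ.tsupport_subset hK).integrable (by norm_num)) hcont.continuousOn hK
    have h2 : Integrable fun x => p x * fderiv ℝ (c i) x (EuclideanSpace.single i 1) := by
      rw [← integrableOn_iff_integrable_of_support_subset (s := tsupport φ)]
      · exact h1
      · intro x hx
        by_contra hxs
        apply hx
        simp only
        rw [fderiv_eq_zero_of_notMem_tsupport fun h => hxs (hcs i h)]
        simp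
    exact h2.integrableOn
  have hgi : ∀ i : Fin 2, IntegrableOn (fun x => g x i * c i x) Ω := by
    intro i
    have h1 : MemLp (fun x => g x i) 2 (volume.restrict Ω) :=
      (Lp.memLp g).continuousLinearMap_comp (EuclideanSpace.proj (𝕜 := ℝ) i)
    have h2 : MemLp (c i) 2 (volume.restrict Ω) :=
      ((hc i).continuous.memLp_of_hasCompactSupport (hcc i)).restrict Ω
    exact h1.integrable_mul h2
  have h1 : ∀ i, ∫ x in Ω, p x * fderiv ℝ (c i) x (EuclideanSpace.single i 1)
      = -∫ x in Ω, g x i * c i x := fun i =>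
    hpg (c i) (hc i) (hcc i) ((hcs i).trans hφ.tsupport_subset) i
  have h2 : ∫ x in Ω, inner ℝ ((hφ.memLp.toLp φ) x) (g x)
      = ∑ i : Fin 2, ∫ x in Ω, g x i * c i x := by
    rw [← integral_finsetSum _ fun i _ => hgi i]
    refine integral_congr_ae ?_
    filter_upwards [hφ.memLp.coeFn_toLp] with x hx
    rw [hx, PiLp.inner_apply]
    rfl
  have h3 : ∑ i : Fin 2, ∫ x in Ω, p x * fderiv ℝ (c i) x (EuclideanSpace.single i 1) = 0 := by
    rw [← integral_finsetSum _ fun i _ => hpi i]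
    have : ∀ x, ∑ i : Fin 2, p x * fderiv ℝ (c i) x (EuclideanSpace.single i 1) = 0 := by
      intro x
      simp_rw [hcd]
      rw [← Finset.mul_sum]
      have := hφ.divergence_eq_zero x
      unfold divergence at this
      rw [this, mul_zero]
    simp [this]
  simp_rw [h1] at h3
  rw [Finset.sum_neg_distrib, neg_eq_zero] at h3
  rw [h2, h3]

/-! ### Tangent fields -/

/-- Divergence-free fields of class `C¹` in `Ω` which are continuous up to the boundary and tangent
to it; `M` bounds the field and its gradient. -/
structure IsTangentField (Ω : Set Plane) (w : Plane → Plane) (M : ℝ) : Prop where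
  contDiffOn : ContDiffOn ℝ 1 w Ω
  continuousOn : ContinuousOn w (closure Ω)
  norm_le : ∀ x ∈ Ω, ‖w x‖ ≤ M
  norm_fderiv_le : ∀ x ∈ Ω, ‖fderiv ℝ w x‖ ≤ M
  divergence_eq_zero : ∀ x ∈ Ω, divergence w x = 0
  tangent : ∀ x ∈ frontier Ω, ∀ n : Plane, IsInnerUnitNormal Ω x n → inner ℝ (w x) n = 0

theorem divergence_smul {q : Plane → ℝ} {w : Plane → Plane} {x : Plane}
    (hq : DifferentiableAt ℝ q x) (hw : DifferentiableAt ℝ w x) :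
    divergence (fun x => q x • w x) x = fderiv ℝ q x (w x) + q x * divergence w x := by
  unfold divergence
  rw [fderiv_fun_smul hq hw, apply_eq_sum_coord (fderiv ℝ q x)]
  simp
  ring

theorem IsTangentField.integrableOn {w : Plane → Plane} {M : ℝ} (hw : IsTangentField Ω w M)
    (hΩ : IsOpen Ω) (hb : Bornology.IsBounded Ω) : IntegrableOn w Ω :=
  memLp_one_iff_integrable.1
    (memLp_of_continuousOn_of_bound hΩ hb hw.contDiffOn.continuousOn hw.norm_le 1)

/-- In `∫ χ_r ∇q · w = -∫ q ∇χ_r · w` the right-hand side tends to zero, since the gradients of the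
cutoff functions become normal to the boundary. -/
theorem IsTangentField.isWeaklySolenoidal {w : Plane → Plane} {M : ℝ} (hw : IsTangentField Ω w M)
    (hΩ : IsOpen Ω) (hb : Bornology.IsBounded Ω) {χ : ℕ → Plane → ℝ} {C : ℝ}
    (hχ : IsCutoffSeq Ω χ C) : IsWeaklySolenoidal Ω w := by
  intro q hq hqc
  have hq1 : ContDiff ℝ 1 q := hq.of_le (by simp)
  have := isFiniteMeasure_restrict_of_isBounded hb
  obtain ⟨B, hB0, hB⟩ := exists_norm_le_of_hasCompactSupport hq.continuous hqc
  obtain ⟨B', hB0', hB'⟩ := exists_norm_le_of_hasCompactSupport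
    (hq1.continuous_fderiv one_ne_zero) (hqc.fderiv ℝ)
  have hdiv : ∀ x ∈ Ω, divergence (fun x => q x • w x) x = fderiv ℝ q x (w x) := by
    intro x hx
    rw [divergence_smul (hq1.differentiable one_ne_zero x)
      ((hw.contDiffOn.differentiableOn one_ne_zero x hx).differentiableAt (hΩ.mem_nhds hx)),
      hw.divergence_eq_zero x hx, mul_zero, add_zero]
  have hqw : ContDiffOn ℝ 1 (fun x => q x • w x) Ω := hq1.contDiffOn.smul hw.contDiffOn
  have h1 : ∀ n, ∫ x in Ω, fderiv ℝ (χ n) x (q x • w x)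
      = -∫ x in Ω, χ n x * fderiv ℝ q x (w x) := by
    intro n
    rw [setIntegral_fderiv_cutoff hΩ (hχ.contDiff n) (hχ.hasCompactSupport n)
      (hχ.tsupport_subset n) hqw]
    congr 1
    exact setIntegral_congr_fun hΩ.measurableSet fun x hx => by simp only [hdiv x hx]
  have hDc : ContinuousOn (fun x => fderiv ℝ q x (w x)) Ω :=
    (hq1.continuous_fderiv one_ne_zero).continuousOn.clm_apply hw.contDiffOn.continuousOn
  have hDb : ∀ x ∈ Ω, ‖fderiv ℝ q x (w x)‖ ≤ B' * M := fun x hx =>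
    ((fderiv ℝ q x).le_opNorm _).trans
      (mul_le_mul (hB' x) (hw.norm_le x hx) (norm_nonneg _) hB0'.le)
  have hDi : IntegrableOn (fun x => fderiv ℝ q x (w x)) Ω :=
    memLp_one_iff_integrable.1 (memLp_of_continuousOn_of_bound hΩ hb hDc hDb 1)
  have lim1 : Tendsto (fun n => ∫ x in Ω, χ n x * fderiv ℝ q x (w x)) atTop
      (𝓝 (∫ x in Ω, fderiv ℝ q x (w x))) := by
    refine tendsto_integral_of_dominated_convergence (fun x => ‖fderiv ℝ q x (w x)‖)
      (fun n => (hχ.contDiff n).continuous.aestronglyMeasurable.mul hDi.aestronglyMeasurable)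
      hDi.norm (fun n => Eventually.of_forall fun x => ?_) ?_
    · rw [norm_mul, Real.norm_of_nonneg (hχ.nonneg n x)]
      exact mul_le_of_le_one_left (norm_nonneg _) (hχ.le_one n x)
    · refine (ae_restrict_iff' hΩ.measurableSet).2 (Eventually.of_forall fun x hx => ?_)
      simpa using (hχ.tendsto_one x hx).mul_const (fderiv ℝ q x (w x))
  have lim2 : Tendsto (fun n => ∫ x in Ω, fderiv ℝ (χ n) x (q x • w x)) atTop (𝓝 0) := by
    have h2 := (hχ.tendsto_tangent w hw.continuousOn hw.tangent).const_mul B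
    rw [mul_zero] at h2
    refine squeeze_zero_norm (fun n => ?_) h2
    have hi : Integrable fun x => ‖fderiv ℝ (χ n) x (w x)‖ :=
      (integrable_of_continuousOn_of_eq_zero (hχ.hasCompactSupport n) (hχ.tsupport_subset n)
        (((hχ.contDiff n).continuous_fderiv one_ne_zero).continuousOn.clm_apply
          hw.contDiffOn.continuousOn) fun x hx => by
            rw [fderiv_eq_zero_of_notMem_tsupport hx]; simp).norm
    calc ‖∫ x in Ω, fderiv ℝ (χ n) x (q x • w x)‖
        ≤ ∫ x in Ω, B * ‖fderiv ℝ (χ n) x (w x)‖ := by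
          refine norm_integral_le_of_norm_le (hi.integrableOn.const_mul B)
            (Eventually.of_forall fun x => ?_)
          rw [map_smul, norm_smul]
          exact mul_le_mul_of_nonneg_right (hB x) (norm_nonneg _)
      _ = B * ∫ x in Ω, ‖fderiv ℝ (χ n) x (w x)‖ := integral_const_mul _ _
      _ ≤ B * ∫ x, ‖fderiv ℝ (χ n) x (w x)‖ :=
          mul_le_mul_of_nonneg_left (setIntegral_le_integral hi
            (Eventually.of_forall fun x => norm_nonneg _)) hB0.le
  have h3 := tendsto_nhds_unique lim2 (by simpa only [h1] using lim1.neg)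
  linarith

/-! ### Density of the solenoidal test fields -/

/-- The mollified and deformed fields are bounded in duality with `L²`. The estimate is stated with
the weight `l` of Young's inequality: with a small `l` it is effective if `f` is small. -/
theorem IsDeformationSeq.exists_abs_integral_inner_piola_le {X : Plane → Plane} {ε κ : ℕ → ℝ}
    {η : ℕ → Plane → ℝ} (h : IsDeformationSeq Ω X ε κ η) :
    ∃ B > 0, ∀ n (f g : Plane → Plane) (l : ℝ), 0 < l → Integrable f → MemLp f 2 → MemLp g 2 →
      |∫ y, inner ℝ (piola (deform (ε n) X) (mollify (η n) f) y) (g y)|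
        ≤ B * (l⁻¹ * ∫ x, ‖f x‖ ^ 2) + B * (l * ∫ x, ‖g x‖ ^ 2) := by
  obtain ⟨B, hB, hBn⟩ := h.norm_fderiv_deform_sub_le
  refine ⟨64 * B, by positivity, fun n f g l hl hfi hf hg => ?_⟩
  have hη := h.isMollifier n
  have hf2 : Integrable fun x => ‖f x‖ ^ 2 := (memLp_two_iff_integrable_sq_norm hf.1).1 hf
  have hg2 : Integrable fun x => ‖g x‖ ^ 2 := (memLp_two_iff_integrable_sq_norm hg.1).1 hg
  have hpt : ∀ y, ‖inner ℝ (piola (deform (ε n) X) (mollify (η n) f) y) (g y)‖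
      ≤ B * (l⁻¹ * mollify (η n) (fun x => ‖f x‖ ^ 2) (deform (ε n) X y) + l * ‖g y‖ ^ 2) := by
    intro y
    set p := deform (ε n) X y
    have h1 : ‖mollify (η n) f p‖ * ‖g y‖
        ≤ l⁻¹ * mollify (η n) (fun x => ‖f x‖ ^ 2) p + l * ‖g y‖ ^ 2 := by
      have e1 : ‖mollify (η n) f p‖ ≤ ∫ x, η n (p - x) * ‖f x‖ := by
        refine (norm_integral_le_integral_norm _).trans (le_of_eq ?_)
        congr 1
        ext x
        rw [norm_smul, Real.norm_of_nonneg (hη.nonneg _)]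
      have i1 : Integrable fun x => η n (p - x) * ‖f x‖ :=
        hη.integrable_smul hfi.norm.locallyIntegrable p
      have i2 : Integrable fun x => η n (p - x) * ‖f x‖ ^ 2 :=
        hη.integrable_smul hf2.locallyIntegrable p
      calc ‖mollify (η n) f p‖ * ‖g y‖ ≤ (∫ x, η n (p - x) * ‖f x‖) * ‖g y‖ :=
            mul_le_mul_of_nonneg_right e1 (norm_nonneg _)
        _ = ∫ x, η n (p - x) * ‖f x‖ * ‖g y‖ := (integral_mul_const _ _).symm
        _ ≤ ∫ x, (l⁻¹ * (η n (p - x) * ‖f x‖ ^ 2) + l * ‖g y‖ ^ 2 * η n (p - x)) := by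
            refine integral_mono (i1.mul_const _) ((i2.const_mul _).add
              ((hη.integrable_comp_sub p).const_mul _)) fun x => ?_
            have h2 : ‖f x‖ * ‖g y‖ ≤ l⁻¹ * ‖f x‖ ^ 2 + l * ‖g y‖ ^ 2 := by
              have e : l⁻¹ * ‖f x‖ ^ 2 + l * ‖g y‖ ^ 2 - ‖f x‖ * ‖g y‖
                  = l⁻¹ * ((‖f x‖ - l * ‖g y‖ / 2) ^ 2 + 3 / 4 * (l * ‖g y‖) ^ 2) := by
                field_simp
                ring
              have : 0 ≤ l⁻¹ * ((‖f x‖ - l * ‖g y‖ / 2) ^ 2 + 3 / 4 * (l * ‖g y‖) ^ 2) := by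
                positivity
              linarith
            have h3 := mul_le_mul_of_nonneg_left h2 (hη.nonneg (p - x))
            simp only
            linarith
        _ = _ := by
            rw [integral_add (i2.const_mul _) ((hη.integrable_comp_sub p).const_mul _),
              integral_const_mul, integral_const_mul, hη.integral_comp_sub, mul_one]
            rfl
    calc ‖inner ℝ (piola (deform (ε n) X) (mollify (η n) f) y) (g y)‖
        ≤ ‖piola (deform (ε n) X) (mollify (η n) f) y‖ * ‖g y‖ := norm_inner_le_norm _ _
      _ ≤ (B * ‖mollify (η n) f p‖) * ‖g y‖ := by
          refine mul_le_mul_of_nonneg_right ?_ (norm_nonneg _)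
          exact (ContinuousLinearMap.le_opNorm _ _).trans
            (mul_le_mul_of_nonneg_right (hBn n y).2.2.2.1 (norm_nonneg _))
      _ ≤ _ := by
          rw [mul_assoc]
          exact mul_le_mul_of_nonneg_left h1 hB.le
  have i3 := h.integrable_mollify_deform n hf2 fun x => sq_nonneg ‖f x‖
  have h4 := h.integral_mollify_deform_le n hf2 fun x => sq_nonneg ‖f x‖
  rw [← Real.norm_eq_abs]
  refine (norm_integral_le_of_norm_le (((i3.const_mul _).add (hg2.const_mul _)).const_mul B)
    (Eventually.of_forall hpt)).trans ?_
  rw [integral_const_mul]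
  simp only [Pi.add_apply]
  rw [integral_add (i3.const_mul _) (hg2.const_mul _), integral_const_mul, integral_const_mul]
  have h5 : l⁻¹ * ∫ y, mollify (η n) (fun x => ‖f x‖ ^ 2) (deform (ε n) X y)
      ≤ l⁻¹ * (64 * ∫ x, ‖f x‖ ^ 2) := mul_le_mul_of_nonneg_left h4 (by positivity)
  have h6 : 0 ≤ l * ∫ x, ‖g x‖ ^ 2 := mul_nonneg hl.le (integral_nonneg fun x => sq_nonneg _)
  nlinarith

/-- The solenoidal test fields are dense in `H(Ω)`: the deformation and mollification of `v`,
extended by zero, produces test fields which converge weakly to `v`. The convergence is verified for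
a continuous, compactly supported approximation `g` of the extension of `v`, and the error is
controlled uniformly by `exists_abs_integral_inner_piola_le`. -/
theorem IsDeformationSeq.eq_zero_of_forall_isSolenoidalTest {X : Plane → Plane} {ε κ : ℕ → ℝ}
    {η : ℕ → Plane → ℝ} (h : IsDeformationSeq Ω X ε κ η) (hΩ : IsOpen Ω)
    (hb : Bornology.IsBounded Ω) (hne : Ω.Nonempty) {v : L2 Ω} (hv : v ∈ H Ω)
    (hort : ∀ φ, IsSolenoidalTest Ω φ → ∫ x in Ω, inner ℝ (φ x) (v x) = 0) : v = 0 := by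
  have := isFiniteMeasure_restrict_of_isBounded hb
  set f : Plane → Plane := Ω.indicator v with hf
  have hvi : IntegrableOn v Ω := (Lp.memLp v).integrable (by norm_num)
  have hfi : Integrable f := hvi.integrable_indicator hΩ.measurableSet
  have hf2 : MemLp f 2 := (memLp_indicator_iff_restrict hΩ.measurableSet).2 (Lp.memLp v)
  have hfs : Integrable fun x => ‖f x‖ ^ 2 := (memLp_two_iff_integrable_sq_norm hf2.1).1 hf2
  obtain ⟨B, hB, hBn⟩ := h.exists_abs_integral_inner_piola_le
  set I := ∫ x, ‖f x‖ ^ 2 with hI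
  have hI0 : 0 ≤ I := integral_nonneg fun x => sq_nonneg _
  have hzero : ∀ n, ∫ y, inner ℝ (piola (deform (ε n) X) (mollify (η n) f) y) (f y) = 0 := by
    intro n
    rw [← hort _ (h.isSolenoidalTest hΩ hb hne hvi (isWeaklySolenoidal_of_mem_H hΩ hb hv) n),
      ← integral_indicator hΩ.measurableSet]
    congr 1
    ext y
    by_cases hy : y ∈ Ω <;> simp [hf, hy]
  -- the approximation by `g` has the error `e` in `L²`, and `e` is also the weight in Young's
  -- inequality
  have key : ∀ e : ℝ, 0 < e → I ≤ (B + 1) * (1 + I) * e := by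
    intro e he
    obtain ⟨g, hgc, hge, hg, hgm⟩ := MemLp.exists_hasCompactSupport_integral_rpow_sub_le
      (p := 2) (by norm_num) (f := f) (μ := volume) (by simpa using hf2)
      (ε := e ^ 2) (by positivity)
    have hge : ∫ x, ‖f x - g x‖ ^ 2 ≤ e ^ 2 := by simpa using hge
    have hgm : MemLp g 2 := by simpa using hgm
    have hgi : Integrable g := hg.integrable_of_hasCompactSupport hgc
    have hd2 : MemLp (fun x => f x - g x) 2 := hf2.sub hgm
    have hds : Integrable fun x => ‖f x - g x‖ ^ 2 :=
      (memLp_two_iff_integrable_sq_norm hd2.1).1 hd2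
    have he2 : e⁻¹ * ∫ x, ‖f x - g x‖ ^ 2 ≤ e := by
      calc e⁻¹ * ∫ x, ‖f x - g x‖ ^ 2 ≤ e⁻¹ * e ^ 2 :=
            mul_le_mul_of_nonneg_left hge (by positivity)
        _ = e := by field_simp
    obtain ⟨G, hG0, hG⟩ := exists_norm_le_of_hasCompactSupport hg hgc
    obtain ⟨A, hA, hAn⟩ := h.norm_fderiv_deform_sub_le
    have hRb : ∀ n y, ‖piola (deform (ε n) X) (mollify (η n) g) y‖ ≤ A * G := fun n y =>
      (ContinuousLinearMap.le_opNorm _ _).trans (mul_le_mul (hAn n y).2.2.2.1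
        ((h.isMollifier n).norm_mollify_le _ fun x _ => hG x) (norm_nonneg _) hA.le)
    have hRc : ∀ n, Continuous (piola (deform (ε n) X) (mollify (η n) g)) := fun n =>
      (contDiff_piola (h.contDiff_deform n)
        ((h.isMollifier n).contDiff_mollify hgi.locallyIntegrable)).continuous
    have hbd : ∀ n y, ‖inner ℝ (piola (deform (ε n) X) (mollify (η n) g) y) (f y)‖
        ≤ A * G * ‖f y‖ := fun n y =>
      (norm_inner_le_norm _ _).trans (mul_le_mul_of_nonneg_right (hRb n y) (norm_nonneg _))
    have hmeas : ∀ n, AEStronglyMeasurable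
        (fun y => inner ℝ (piola (deform (ε n) X) (mollify (η n) g) y) (f y)) volume := fun n =>
      (hRc n).aestronglyMeasurable.inner hfi.aestronglyMeasurable
    have lim : Tendsto (fun n => ∫ y, inner ℝ (piola (deform (ε n) X) (mollify (η n) g) y) (f y))
        atTop (𝓝 (∫ y, inner ℝ (g y) (f y))) := by
      refine tendsto_integral_of_dominated_convergence (fun y => A * G * ‖f y‖) hmeas
        (hfi.norm.const_mul _) (fun n => Eventually.of_forall (hbd n))
        (Eventually.of_forall fun y => ?_)
      exact (h.tendsto_piola hgi.locallyIntegrable hg.continuousAt).inner tendsto_const_nhds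
    have hn : ∀ n, |∫ y, inner ℝ (piola (deform (ε n) X) (mollify (η n) g) y) (f y)|
        ≤ B * e + B * (e * I) := by
      intro n
      have hη := h.isMollifier n
      have h1 := hBn n (fun x => f x - g x) f e he (hfi.sub hgi) hd2 hf2
      have hdm : Integrable fun y =>
          inner ℝ (piola (deform (ε n) X) (mollify (η n) g) y) (f y) :=
        (hfi.norm.const_mul (A * G)).mono' (hmeas n) (Eventually.of_forall (hbd n))
      have hfm : Integrable fun y =>
          inner ℝ (piola (deform (ε n) X) (mollify (η n) f) y) (f y) := by
        have h2 := (h.isSolenoidalTest hΩ hb hne hvi (isWeaklySolenoidal_of_mem_H hΩ hb hv) n)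
        exact (integrable_inner_of_memLp (h2.contDiff.continuous.memLp_of_hasCompactSupport
          h2.hasCompactSupport) hf2)
      -- the test field obtained from `f` is orthogonal to `f`, so only the approximation error
      -- is left
      have e1 : ∫ y, inner ℝ (piola (deform (ε n) X) (mollify (η n) fun x => f x - g x) y) (f y)
          = -∫ y, inner ℝ (piola (deform (ε n) X) (mollify (η n) g) y) (f y) := by
        rw [← zero_sub, ← hzero n, ← integral_sub hfm hdm]
        congr 1
        ext y
        rw [← inner_sub_left]
        congr 1
        simp only [piola, mollify, smul_sub]
        rw [integral_sub (hη.integrable_smul hfi.locallyIntegrable _)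
          (hη.integrable_smul hgi.locallyIntegrable _), map_sub]
      rw [e1, abs_neg] at h1
      refine h1.trans ?_
      have := mul_le_mul_of_nonneg_left he2 hB.le
      linarith
    have h3 : |∫ y, inner ℝ (g y) (f y)| ≤ B * e + B * (e * I) :=
      le_of_tendsto lim.abs (Eventually.of_forall hn)
    have hgf : Integrable fun y => inner ℝ (g y) (f y) := integrable_inner_of_memLp hgm hf2
    have hff : Integrable fun y => inner ℝ (f y) (f y) := integrable_inner_of_memLp hf2 hf2
    have h4 : I - ∫ y, inner ℝ (g y) (f y) ≤ e + e * I := by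
      have e2 : I = ∫ y, inner ℝ (f y) (f y) := by
        rw [hI]
        congr 1
        ext y
        rw [real_inner_self_eq_norm_sq]
      calc I - ∫ y, inner ℝ (g y) (f y)
          = ∫ y, (inner ℝ (f y) (f y) - inner ℝ (g y) (f y)) := by
            rw [integral_sub hff hgf, ← e2]
        _ ≤ ∫ y, (e⁻¹ * ‖f y - g y‖ ^ 2 + e * ‖f y‖ ^ 2) := by
            refine integral_mono (hff.sub hgf) ((hds.const_mul _).add (hfs.const_mul _))
              fun y => ?_
            simp only
            rw [← inner_sub_left]
            refine (real_inner_le_norm _ _).trans ?_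
            have e3 : e⁻¹ * ‖f y - g y‖ ^ 2 + e * ‖f y‖ ^ 2 - ‖f y - g y‖ * ‖f y‖
                = e⁻¹ * ((‖f y - g y‖ - e * ‖f y‖ / 2) ^ 2 + 3 / 4 * (e * ‖f y‖) ^ 2) := by
              field_simp
              ring
            have : 0 ≤ e⁻¹ * ((‖f y - g y‖ - e * ‖f y‖ / 2) ^ 2 + 3 / 4 * (e * ‖f y‖) ^ 2) := by
              positivity
            linarith
        _ = e⁻¹ * (∫ y, ‖f y - g y‖ ^ 2) + e * I := by
            rw [integral_add (hds.const_mul _) (hfs.const_mul _), integral_const_mul,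
              integral_const_mul]
        _ ≤ e + e * I := by linarith
    have h5 := le_of_abs_le h3
    nlinarith
  have hI00 : I = 0 := by
    refine le_antisymm ?_ hI0
    have lim : Tendsto (fun e : ℝ => (B + 1) * (1 + I) * e) (𝓝[>] 0) (𝓝 0) := by
      have : Continuous fun e : ℝ => (B + 1) * (1 + I) * e := by fun_prop
      simpa using this.continuousWithinAt.tendsto (x := 0) (s := Ioi 0)
    exact ge_of_tendsto lim (by filter_upwards [self_mem_nhdsWithin] with e he using key e he)
  have hf0 : f =ᵐ[volume] 0 := by
    have h6 := (integral_eq_zero_iff_of_nonneg (fun x => sq_nonneg ‖f x‖) hfs).1 hI00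
    filter_upwards [h6] with x hx
    simpa using hx
  rw [Lp.eq_zero_iff_ae_eq_zero]
  filter_upwards [ae_restrict_of_ae hf0, ae_restrict_mem hΩ.measurableSet] with x hx hxΩ
  rw [hf, indicator_of_mem hxΩ] at hx
  exact hx

end

section

/-! ### The jump across the boundary and the normal flux -/

variable {Ω : Set Plane}

theorem aestronglyMeasurable_clm_apply {F : Type*} [NormedAddCommGroup F] [NormedSpace ℝ F]
    {μ : Measure Plane} {A : Plane → Plane →L[ℝ] F} {u : Plane → Plane}
    (hA : AEStronglyMeasurable A μ) (hu : AEStronglyMeasurable u μ) :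
    AEStronglyMeasurable (fun x => A x (u x)) μ :=
  (ContinuousLinearMap.id ℝ (Plane →L[ℝ] F)).aestronglyMeasurable_comp₂ hA hu

theorem integrable_indicator_of_isOpen {F : Type*} [NormedAddCommGroup F] (hΩ : IsOpen Ω)
    {g : Plane → F} (hg : IntegrableOn g Ω) : Integrable (Ω.indicator g) := by
  rwa [integrable_indicator_iff hΩ.measurableSet]

set_option maxHeartbeats 1000000 in
/-- The gradient of a mollified field which jumps across `∂Ω` is the mollified gradient plus a
boundary layer, described by the gradients of the cutoff functions. -/
theorem IsCutoffSeq.tendsto_boundary_layer (hΩ : IsOpen Ω) (hb : Bornology.IsBounded Ω)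
    {χ : ℕ → Plane → ℝ} {C M κ : ℝ} (hχ : IsCutoffSeq Ω χ C) {w : Plane → Plane}
    (hw : IsTangentField Ω w M) {η : Plane → ℝ} (hη : IsMollifier κ η) (p z : Plane) :
    Tendsto (fun r => ∫ x in Ω, fderiv ℝ (χ r) x z • (η (p - x) • w x)) atTop
      (𝓝 (fderiv ℝ (mollify η (Ω.indicator w)) p z
        - mollify η (Ω.indicator (fderiv ℝ w)) p z)) := by
  have hwi := hw.integrableOn hΩ hb
  have hwi' : Integrable (Ω.indicator w) := hwi.integrable_indicator hΩ.measurableSet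
  have hDc : ContinuousOn (fderiv ℝ w) Ω := hw.contDiffOn.continuousOn_fderiv_of_isOpen hΩ le_rfl
  have hDi : IntegrableOn (fderiv ℝ w) Ω :=
    memLp_one_iff_integrable.1 (memLp_of_continuousOn_of_bound hΩ hb hDc hw.norm_fderiv_le 1)
  have hDi' : Integrable (Ω.indicator (fderiv ℝ w)) := integrable_indicator_of_isOpen hΩ hDi
  have hηp := hη.contDiff_comp_sub p
  have hg : ContDiffOn ℝ 1 (fun x => η (p - x) • w x) Ω :=
    (hηp.of_le (by simp)).contDiffOn.smul hw.contDiffOn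
  have hDg : ∀ x ∈ Ω, fderiv ℝ (fun x => η (p - x) • w x) x z
      = η (p - x) • fderiv ℝ w x z - fderiv ℝ η (p - x) z • w x := by
    intro x hx
    rw [fderiv_fun_smul (hηp.differentiable (by simp) x)
      ((hw.contDiffOn.differentiableOn one_ne_zero x hx).differentiableAt (hΩ.mem_nhds hx))]
    rw [_root_.add_apply, _root_.smul_apply, ContinuousLinearMap.smulRight_apply,
      hη.fderiv_comp_sub, neg_smul, ← sub_eq_add_neg]
  have i1 : Integrable fun x => η (p - x) • Ω.indicator (fderiv ℝ w) x :=
    hη.integrable_smul hDi'.locallyIntegrable p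
  have i2 := hη.integrable_fderiv_smul hwi'.locallyIntegrable p z
  have i1z : Integrable fun x => (η (p - x) • Ω.indicator (fderiv ℝ w) x) z :=
    (ContinuousLinearMap.apply ℝ Plane z).integrable_comp i1
  have e1 : mollify η (Ω.indicator (fderiv ℝ w)) p z
      = ∫ x, (η (p - x) • Ω.indicator (fderiv ℝ w) x) z :=
    ContinuousLinearMap.integral_apply i1 z
  let L : Plane → Plane := fun x => fderiv ℝ η (p - x) z • w x - η (p - x) • fderiv ℝ w x z
  have hLeq : ∀ x, Ω.indicator L x = fderiv ℝ η (p - x) z • Ω.indicator w x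
      - (η (p - x) • Ω.indicator (fderiv ℝ w) x) z := by
    intro x
    by_cases hx : x ∈ Ω <;> simp [hx, L]
  have hLi' : Integrable (Ω.indicator L) := by
    refine (i2.sub i1z).congr (Eventually.of_forall fun x => ?_)
    rw [hLeq]
    rfl
  have hLi : IntegrableOn L Ω := (integrable_indicator_iff hΩ.measurableSet).1 hLi'
  have e2 : fderiv ℝ (mollify η (Ω.indicator w)) p z - mollify η (Ω.indicator (fderiv ℝ w)) p z
      = ∫ x in Ω, L x := by
    rw [hη.fderiv_mollify_apply hwi'.locallyIntegrable, e1, ← integral_sub i2 i1z,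
      ← integral_indicator hΩ.measurableSet]
    simp_rw [hLeq]
  -- integration by parts; there are no boundary terms, as the cutoff functions are supported in `Ω`
  have e3 : ∀ r, ∫ x in Ω, fderiv ℝ (χ r) x z • (η (p - x) • w x) = ∫ x in Ω, χ r x • L x := by
    intro r
    have h1 := setIntegral_cutoff_mul_fderiv hΩ (hχ.contDiff r) (hχ.hasCompactSupport r)
      (hχ.tsupport_subset r) hg z
    have j1 : Integrable fun x => χ r x • fderiv ℝ (fun x => η (p - x) • w x) x z :=
      integrable_of_continuousOn_of_eq_zero (hχ.hasCompactSupport r) (hχ.tsupport_subset r)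
        ((hχ.contDiff r).continuous.continuousOn.smul
          ((hg.continuousOn_fderiv_of_isOpen hΩ le_rfl).clm_apply continuousOn_const))
        fun x hx => by rw [image_eq_zero_of_notMem_tsupport hx, zero_smul]
    have j2 : Integrable fun x => fderiv ℝ (χ r) x z • (η (p - x) • w x) :=
      integrable_of_continuousOn_of_eq_zero (hχ.hasCompactSupport r) (hχ.tsupport_subset r)
        ((((hχ.contDiff r).continuous_fderiv one_ne_zero).clm_apply
          continuous_const).continuousOn.smul hg.continuousOn)
        fun x hx => by rw [fderiv_eq_zero_of_notMem_tsupport hx]; simp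
    rw [integral_add j1.integrableOn j2.integrableOn] at h1
    rw [eq_neg_of_add_eq_zero_right h1, ← integral_neg]
    refine setIntegral_congr_fun hΩ.measurableSet fun x hx => ?_
    simp only [hDg x hx, L]
    rw [← smul_neg, neg_sub]
  simp_rw [e3]
  rw [e2]
  refine tendsto_integral_of_dominated_convergence (fun x => ‖L x‖)
    (fun r => (hχ.contDiff r).continuous.aestronglyMeasurable.smul hLi.aestronglyMeasurable)
    hLi.norm (fun r => Eventually.of_forall fun x => ?_) ?_
  · rw [norm_smul, Real.norm_of_nonneg (hχ.nonneg r x)]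
    exact mul_le_of_le_one_left (norm_nonneg _) (hχ.le_one r x)
  · refine (ae_restrict_iff' hΩ.measurableSet).2 (Eventually.of_forall fun x hx => ?_)
    simpa using (hχ.tendsto_one x hx).smul_const (L x)

/-- An element of `H(Ω)` has no flux through the boundary: `∫ g ∇χ_r · v = -∫ χ_r ∇g · v`, by the
orthogonality of `v` to `∇(χ_r g)`, and the right-hand side tends to `-∫ ∇g · v = 0`. -/
theorem IsCutoffSeq.tendsto_flux_zero (hΩ : IsOpen Ω) (hb : Bornology.IsBounded Ω)
    {χ : ℕ → Plane → ℝ} {C B : ℝ} (hχ : IsCutoffSeq Ω χ C) {v : L2 Ω} (hv : v ∈ H Ω)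
    {g : Plane → ℝ} (hg : ContDiffOn ℝ 1 g Ω) (hB : ∀ x ∈ Ω, ‖fderiv ℝ g x‖ ≤ B) :
    (∀ r, IntegrableOn (fun x => fderiv ℝ (χ r) x (v x) * g x) Ω) ∧
    Tendsto (fun r => ∫ x in Ω, fderiv ℝ (χ r) x (v x) * g x) atTop (𝓝 0) := by
  have := isFiniteMeasure_restrict_of_isBounded hb
  have hvi : IntegrableOn v Ω := (Lp.memLp v).integrable (by norm_num)
  have hDg : ContinuousOn (fderiv ℝ g) Ω := hg.continuousOn_fderiv_of_isOpen hΩ le_rfl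
  have hmDg : AEStronglyMeasurable (fun x => fderiv ℝ g x (v x)) (volume.restrict Ω) := by
    have h1 : AEStronglyMeasurable (fderiv ℝ g) (volume.restrict Ω) :=
      hDg.aestronglyMeasurable hΩ.measurableSet
    exact aestronglyMeasurable_clm_apply h1 hvi.aestronglyMeasurable
  have hi : IntegrableOn (fun x => fderiv ℝ g x (v x)) Ω := by
    refine (hvi.norm.const_mul B).mono' hmDg
      ((ae_restrict_iff' hΩ.measurableSet).2 (Eventually.of_forall fun x hx => ?_))
    exact ((fderiv ℝ g x).le_opNorm _).trans (mul_le_mul_of_nonneg_right (hB x hx) (norm_nonneg _))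
  have key : ∀ r, IntegrableOn (fun x => fderiv ℝ (χ r) x (v x) * g x) Ω ∧
      ∫ x in Ω, fderiv ℝ (χ r) x (v x) * g x = -∫ x in Ω, χ r x * fderiv ℝ g x (v x) := by
    intro r
    have hc : ContDiff ℝ 1 fun x => χ r x • g x :=
      contDiff_cutoff_smul hΩ (hχ.contDiff r) (hχ.tsupport_subset r) hg
    have hcs : HasCompactSupport fun x => χ r x • g x := (hχ.hasCompactSupport r).smul_right
    obtain ⟨B', hB', hB'c⟩ := exists_norm_le_of_hasCompactSupport
      (hc.continuous_fderiv one_ne_zero) (hcs.fderiv ℝ)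
    have h1 := setIntegral_fderiv_eq_zero_of_mem_H hΩ hb hv hc.contDiffOn fun x _ => hB'c x
    have h2 : ∀ x ∈ Ω, fderiv ℝ (fun x => χ r x • g x) x (v x)
        = χ r x * fderiv ℝ g x (v x) + fderiv ℝ (χ r) x (v x) * g x := by
      intro x hx
      rw [fderiv_fun_smul ((hχ.contDiff r).differentiable one_ne_zero x)
        ((hg.differentiableOn one_ne_zero x hx).differentiableAt (hΩ.mem_nhds hx))]
      simp
    have j1 : IntegrableOn (fun x => χ r x * fderiv ℝ g x (v x)) Ω := by
      refine hi.norm.mono' ((hχ.contDiff r).continuous.aestronglyMeasurable.mul hmDg)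
        (Eventually.of_forall fun x => ?_)
      rw [norm_mul, Real.norm_of_nonneg (hχ.nonneg r x)]
      exact mul_le_of_le_one_left (norm_nonneg _) (hχ.le_one r x)
    have j3 : IntegrableOn (fun x => fderiv ℝ (fun x => χ r x • g x) x (v x)) Ω := by
      refine (hvi.norm.const_mul B').mono' ?_ (Eventually.of_forall fun x =>
        ((fderiv ℝ _ x).le_opNorm _).trans
          (mul_le_mul_of_nonneg_right (hB'c x) (norm_nonneg _)))
      have h3 : AEStronglyMeasurable (fderiv ℝ fun x => χ r x • g x) (volume.restrict Ω) :=
        (hc.continuous_fderiv one_ne_zero).aestronglyMeasurable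
      exact aestronglyMeasurable_clm_apply h3 hvi.aestronglyMeasurable
    have j2 : IntegrableOn (fun x => fderiv ℝ (χ r) x (v x) * g x) Ω := by
      refine (j3.sub j1).congr ((ae_restrict_iff' hΩ.measurableSet).2
        (Eventually.of_forall fun x hx => ?_))
      simp only [Pi.sub_apply, h2 x hx]
      ring
    refine ⟨j2, ?_⟩
    rw [setIntegral_congr_fun hΩ.measurableSet h2, integral_add j1 j2] at h1
    linarith
  refine ⟨fun r => (key r).1, ?_⟩
  simp_rw [fun r => (key r).2]
  rw [← neg_zero, ← setIntegral_fderiv_eq_zero_of_mem_H hΩ hb hv hg hB]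
  refine Tendsto.neg (tendsto_integral_of_dominated_convergence (fun x => ‖fderiv ℝ g x (v x)‖)
    (fun r => (hχ.contDiff r).continuous.aestronglyMeasurable.mul hmDg)
    hi.norm (fun r => Eventually.of_forall fun x => ?_) ?_)
  · rw [norm_mul, Real.norm_of_nonneg (hχ.nonneg r x)]
    exact mul_le_of_le_one_left (norm_nonneg _) (hχ.le_one r x)
  · refine (ae_restrict_iff' hΩ.measurableSet).2 (Eventually.of_forall fun x hx => ?_)
    simpa using (hχ.tendsto_one x hx).mul_const (fderiv ℝ g x (v x))

/-- The regularity of the velocity near the boundary, for a representative `f` of it: it is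
bounded by `K` and Hölder continuous with exponent `α` and constant `c`. -/
structure IsRegularNearBoundary (Ω : Set Plane) (δ : ℝ) (α c : ℝ≥0) (K : ℝ) (f : Plane → Plane) :
    Prop where
  norm_le : ∀ x ∈ Ω, infDist x (frontier Ω) < δ → ‖f x‖ ≤ K
  norm_sub_le : ∀ x ∈ Ω, infDist x (frontier Ω) < δ → ∀ y ∈ Ω, infDist y (frontier Ω) < δ →
    ‖f x - f y‖ ≤ c * dist x y ^ (α : ℝ)

end

section

/-! ### The boundary layer -/

/-- Uniform bounds for the deformations, their derivatives and cofactor matrices. -/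
structure DeformationBounds (X : Plane → Plane) (ε : ℕ → ℝ) (B : ℝ) : Prop where
  pos : 0 < B
  dist_le : ∀ n y, dist (deform (ε n) X y) y ≤ ε n * B
  fderiv_sub_le : ∀ n y, ‖fderiv ℝ (deform (ε n) X) y - ContinuousLinearMap.id ℝ Plane‖ ≤ ε n * B
  fderiv_le : ∀ n y, ‖fderiv ℝ (deform (ε n) X) y‖ ≤ B
  adj_le : ∀ n y, ‖adjCLM (fderiv ℝ (deform (ε n) X) y)‖ ≤ B
  adj_fderiv_le : ∀ n y z,
    ‖adjCLM (fderiv ℝ (fderiv ℝ (deform (ε n) X)) y z)‖ ≤ ε n * B * ‖z‖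

variable {Ω : Set Plane} {X : Plane → Plane} {ε κ : ℕ → ℝ} {η : ℕ → Plane → ℝ}

theorem IsDeformationSeq.exists_bounds (h : IsDeformationSeq Ω X ε κ η) :
    ∃ B, DeformationBounds X ε B := by
  obtain ⟨B₁, hB₁, h1⟩ := h.dist_deform_le
  obtain ⟨B₂, hB₂, h2⟩ := h.norm_fderiv_deform_sub_le
  have hm : ∀ n, ε n * B₁ ≤ ε n * max B₁ B₂ := fun n =>
    mul_le_mul_of_nonneg_left (le_max_left _ _) (h.pos n).le
  have hm' : ∀ n, ε n * B₂ ≤ ε n * max B₁ B₂ := fun n =>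
    mul_le_mul_of_nonneg_left (le_max_right _ _) (h.pos n).le
  refine ⟨max B₁ B₂, lt_max_of_lt_left hB₁, fun n y => (h1 n y).trans (hm n), fun n y =>
    (h2 n y).1.trans (hm' n), fun n y => (h2 n y).2.2.1.trans (le_max_right _ _), fun n y =>
    (h2 n y).2.2.2.1.trans (le_max_right _ _), fun n y z => ((h2 n y).2.2.2.2 z).trans ?_⟩
  exact mul_le_mul_of_nonneg_right (hm' n) (norm_nonneg z)

set_option maxHeartbeats 1000000 in
/-- The boundary layer does not contribute in the limit. Since `v` has no flux through the boundary,
only the oscillation of `v` at the scale of the deformation matters, and it is small near the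
boundary. At a fixed point `y` the layer is a limit of integrals over the gradients of the cutoff
functions; these are estimated uniformly by Schur's test, and Fatou's lemma is used to pass to the
limit under the integral over `y`. -/
theorem IsDeformationSeq.lintegral_boundary_layer_le (h : IsDeformationSeq Ω X ε κ η)
    (hΩ : IsOpen Ω) (hb : Bornology.IsBounded Ω) {χ : ℕ → Plane → ℝ} {C M B δ K : ℝ} {α c : ℝ≥0}
    (hχ : IsCutoffSeq Ω χ C) {w : Plane → Plane} (hw : IsTangentField Ω w M) (hM : 0 ≤ M)
    (hB : DeformationBounds X ε B) {v : L2 Ω} (hv : v ∈ H Ω) {f : Plane → Plane}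
    (hfv : f =ᵐ[volume.restrict Ω] v) (hf : IsRegularNearBoundary Ω δ α c K f) (hK : 0 ≤ K)
    (hδ : 0 < δ) (n : ℕ) (hn : κ n + ε n * B < δ / 2) :
    ∫⁻ y in Ω, ‖inner ℝ (adjCLM (fderiv ℝ (deform (ε n) X) y)
        (fderiv ℝ (mollify (η n) (Ω.indicator w)) (deform (ε n) X y)
            (fderiv ℝ (deform (ε n) X) y (f y))
          - mollify (η n) (Ω.indicator (fderiv ℝ w)) (deform (ε n) X y)
            (fderiv ℝ (deform (ε n) X) y (f y)))) (f y)‖ₑ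
      ≤ ENNReal.ofReal
        (B * M * K * (ε n * B * K + c * (κ n + ε n * B) ^ (α : ℝ)) * (64 * C)) := by
  have hη := h.isMollifier n
  set b := B * M * K * (ε n * B * K + c * (κ n + ε n * B) ^ (α : ℝ)) with hbdef
  have hτ : 0 ≤ κ n + ε n * B := by
    have := hη.pos; have := h.pos n; have := hB.pos; positivity
  have hb0 : 0 ≤ b := by
    have := h.pos n; have := hB.pos; positivity
  have hDχi : ∀ r, Integrable fun x => ‖fderiv ℝ (χ r) x‖ := fun r =>
    (((hχ.contDiff r).continuous_fderiv one_ne_zero).integrable_of_hasCompactSupport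
      ((hχ.hasCompactSupport r).fderiv ℝ)).norm
  set m : ℕ → Plane → ℝ := fun r y =>
    mollify (η n) (fun x => ‖fderiv ℝ (χ r) x‖) (deform (ε n) X y) with hm
  have hmc : ∀ r, Continuous (m r) := fun r =>
    (hη.contDiff_mollify (hDχi r).locallyIntegrable).continuous.comp
      (h.contDiff_deform n).continuous
  have hpt : ∀ y ∈ Ω, ‖inner ℝ (adjCLM (fderiv ℝ (deform (ε n) X) y)
        (fderiv ℝ (mollify (η n) (Ω.indicator w)) (deform (ε n) X y)
            (fderiv ℝ (deform (ε n) X) y (f y))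
          - mollify (η n) (Ω.indicator (fderiv ℝ w)) (deform (ε n) X y)
            (fderiv ℝ (deform (ε n) X) y (f y)))) (f y)‖ₑ
      ≤ liminf (fun r => ENNReal.ofReal (b * m r y)) atTop := by
    intro y hy
    set p := deform (ε n) X y
    set A := fderiv ℝ (deform (ε n) X) y
    set z := A (f y)
    let l : Plane →L[ℝ] ℝ := (innerSL ℝ (f y)).comp (adjCLM A)
    have hl : ∀ u, l u = inner ℝ (adjCLM A u) (f y) := fun u => by
      rw [real_inner_comm]
      rfl
    -- the weight of `∇χ_r` in the boundary layer, with which the flux of `v` is tested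
    have hg : ContDiffOn ℝ 1 (fun x => η n (p - x) * l (w x)) Ω :=
      ((hη.contDiff_comp_sub p).of_le (by simp)).contDiffOn.mul (l.contDiff.comp_contDiffOn
        hw.contDiffOn)
    obtain ⟨E, hE0, hE⟩ := exists_norm_le_of_hasCompactSupport
      (hη.contDiff_comp_sub p).continuous (hη.hasCompactSupport_comp_sub p)
    obtain ⟨E', hE0', hE'⟩ := exists_norm_le_of_hasCompactSupport
      ((hη.contDiff_comp_sub p).continuous_fderiv (by simp))
      ((hη.hasCompactSupport_comp_sub p).fderiv ℝ)
    have hgB : ∀ x ∈ Ω, ‖fderiv ℝ (fun x => η n (p - x) * l (w x)) x‖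
        ≤ E * (‖l‖ * M) + ‖l‖ * M * E' := by
      intro x hx
      have hwx : DifferentiableAt ℝ w x :=
        (hw.contDiffOn.differentiableOn one_ne_zero x hx).differentiableAt (hΩ.mem_nhds hx)
      have hlw : HasFDerivAt (fun x => l (w x)) (l.comp (fderiv ℝ w x)) x :=
        l.hasFDerivAt.comp x hwx.hasFDerivAt
      rw [fderiv_fun_mul ((hη.contDiff_comp_sub p).differentiable (by simp) x)
        hlw.differentiableAt, hlw.fderiv]
      refine (norm_add_le _ _).trans (add_le_add ?_ ?_)
      · rw [norm_smul]
        refine mul_le_mul (hE x) ?_ (norm_nonneg _) hE0.le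
        exact (l.opNorm_comp_le _).trans
          (mul_le_mul_of_nonneg_left (hw.norm_fderiv_le x hx) (norm_nonneg _))
      · rw [norm_smul]
        refine mul_le_mul ?_ (hE' x) (norm_nonneg _) (by positivity)
        exact (l.le_opNorm _).trans
          (mul_le_mul_of_nonneg_left (hw.norm_le x hx) (norm_nonneg _))
    obtain ⟨hfluxi, hflux⟩ := hχ.tendsto_flux_zero hΩ hb hv hg hgB
    have hlay := hχ.tendsto_boundary_layer hΩ hb hw hη p z
    have hlayi : ∀ r, IntegrableOn (fun x => fderiv ℝ (χ r) x z • (η n (p - x) • w x)) Ω := by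
      intro r
      refine Integrable.integrableOn (integrable_of_continuousOn_of_eq_zero
        (hχ.hasCompactSupport r) (hχ.tsupport_subset r)
        ((((hχ.contDiff r).continuous_fderiv one_ne_zero).clm_apply
          continuous_const).continuousOn.smul
          ((hη.contDiff_comp_sub p).continuous.continuousOn.smul hw.contDiffOn.continuousOn))
        fun x hx => ?_)
      rw [fderiv_eq_zero_of_notMem_tsupport hx]
      simp
    -- subtracting the flux of `v`, which vanishes in the limit, replaces `z` by `z - f x`
    have hlim : Tendsto (fun r => ∫ x in Ω,
        fderiv ℝ (χ r) x (z - f x) * (η n (p - x) * l (w x))) atTop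
        (𝓝 (l (fderiv ℝ (mollify (η n) (Ω.indicator w)) p z
          - mollify (η n) (Ω.indicator (fderiv ℝ w)) p z))) := by
      have h1 := ((l.continuous.tendsto _).comp hlay).sub hflux
      rw [sub_zero] at h1
      refine h1.congr fun r => ?_
      simp only [Function.comp]
      rw [← l.integral_comp_comm (hlayi r), ← integral_sub (l.integrable_comp (hlayi r))
        (hfluxi r)]
      refine integral_congr_ae ?_
      filter_upwards [hfv] with x hx
      simp only [map_smul, smul_eq_mul, map_sub, ← hx]
      ring
    -- where `∇χ_r(x) ≠ 0` and `η(p - x) ≠ 0`, the points `x` and `y` are both near the boundary and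
    -- close to each other
    have hpb : ∀ᶠ r in atTop, ‖∫ x in Ω, fderiv ℝ (χ r) x (z - f x) * (η n (p - x) * l (w x))‖
        ≤ b * m r y := by
      filter_upwards [hχ.concentrates (δ / 2) (by positivity)] with r hr
      have hi : Integrable fun x => η n (p - x) * ‖fderiv ℝ (χ r) x‖ :=
        hη.integrable_smul (hDχi r).locallyIntegrable p
      have e : b * m r y = ∫ x, b * (η n (p - x) * ‖fderiv ℝ (χ r) x‖) := by
        rw [integral_const_mul]
        rfl
      rw [e]
      refine (norm_integral_le_of_norm_le ((hi.const_mul b).integrableOn)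
        ((ae_restrict_iff' hΩ.measurableSet).2 (Eventually.of_forall fun x hx => ?_))).trans
        (setIntegral_le_integral (hi.const_mul b) (Eventually.of_forall fun x => ?_))
      · by_cases hD : fderiv ℝ (χ r) x = 0
        · simp [hD]
        by_cases hηx : η n (p - x) = 0
        · simp [hηx]
        have hxd := hr x hD
        have hpx : dist p x < κ n := by
          rw [dist_eq_norm]
          exact not_le.1 fun h' => hηx (hη.eq_zero _ h')
        have hyx : dist y x ≤ κ n + ε n * B := by
          have h1 := dist_triangle_left y x p
          have h2 : dist p y ≤ ε n * B := hB.dist_le n y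
          linarith
        have hyd : infDist y (frontier Ω) < δ := by
          have := infDist_le_infDist_add_dist (s := frontier Ω) (x := y) (y := x)
          linarith
        have hfy := hf.norm_le y hy hyd
        have hfyx := hf.norm_sub_le y hy hyd x hx (hxd.trans (by linarith))
        have hzf : ‖z - f x‖ ≤ ε n * B * K + c * (κ n + ε n * B) ^ (α : ℝ) := by
          have e2 : z - f x = (A - ContinuousLinearMap.id ℝ Plane) (f y) + (f y - f x) := by
            simp [z]
          rw [e2]
          refine (norm_add_le _ _).trans (add_le_add ?_ (hfyx.trans ?_))
          · refine (ContinuousLinearMap.le_opNorm _ _).trans ?_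
            exact mul_le_mul (hB.fderiv_sub_le n y) hfy (norm_nonneg _)
              (mul_nonneg (h.pos n).le hB.pos.le)
          · gcongr
        have hlw : ‖l (w x)‖ ≤ B * M * K := by
          rw [hl]
          refine (norm_inner_le_norm _ _).trans ?_
          refine mul_le_mul ?_ hfy (norm_nonneg _) (mul_nonneg hB.pos.le hM)
          refine (ContinuousLinearMap.le_opNorm _ _).trans ?_
          exact mul_le_mul (hB.adj_le n y) (hw.norm_le x hx) (norm_nonneg _) hB.pos.le
        have hD2 : ‖fderiv ℝ (χ r) x (z - f x)‖
            ≤ ‖fderiv ℝ (χ r) x‖ * (ε n * B * K + c * (κ n + ε n * B) ^ (α : ℝ)) :=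
          (ContinuousLinearMap.le_opNorm _ _).trans
            (mul_le_mul_of_nonneg_left hzf (norm_nonneg _))
        rw [norm_mul, norm_mul, Real.norm_of_nonneg (hη.nonneg _)]
        calc ‖fderiv ℝ (χ r) x (z - f x)‖ * (η n (p - x) * ‖l (w x)‖)
            ≤ (‖fderiv ℝ (χ r) x‖ * (ε n * B * K + c * (κ n + ε n * B) ^ (α : ℝ)))
              * (η n (p - x) * (B * M * K)) := by
              refine mul_le_mul hD2 (mul_le_mul_of_nonneg_left hlw (hη.nonneg _))
                (mul_nonneg (hη.nonneg _) (norm_nonneg _)) ?_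
              exact (norm_nonneg _).trans hD2
          _ = b * (η n (p - x) * ‖fderiv ℝ (χ r) x‖) := by
              rw [hbdef]
              ring
      · exact mul_nonneg hb0 (mul_nonneg (hη.nonneg _) (norm_nonneg _))
    rw [← hl]
    have h2 := (continuous_enorm.tendsto _).comp hlim
    rw [← h2.liminf_eq]
    refine liminf_le_liminf ?_
    filter_upwards [hpb] with r hr
    simp only [Function.comp]
    rw [← ofReal_norm]
    exact ENNReal.ofReal_le_ofReal hr
  calc _ ≤ ∫⁻ y in Ω, liminf (fun r => ENNReal.ofReal (b * m r y)) atTop :=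
        setLIntegral_mono' hΩ.measurableSet hpt
    _ ≤ liminf (fun r => ∫⁻ y in Ω, ENNReal.ofReal (b * m r y)) atTop :=
        lintegral_liminf_le fun r =>
          (continuous_const.mul (hmc r)).measurable.ennreal_ofReal
    _ ≤ liminf (fun _ : ℕ => ENNReal.ofReal (b * (64 * C))) atTop := by
        refine liminf_le_liminf (Eventually.of_forall fun r => ?_)
        calc ∫⁻ y in Ω, ENNReal.ofReal (b * m r y)
            ≤ ∫⁻ y, ENNReal.ofReal b * ENNReal.ofReal (m r y) := by
              refine (setLIntegral_le_lintegral _ _).trans (le_of_eq ?_)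
              congr 1
              ext y
              rw [ENNReal.ofReal_mul hb0]
          _ ≤ ENNReal.ofReal b * ENNReal.ofReal (64 * C) := by
              rw [lintegral_const_mul' _ _ ENNReal.ofReal_ne_top]
              gcongr
              refine (h.lintegral_mollify_deform_le n (hDχi r) fun x => norm_nonneg _).trans ?_
              exact ENNReal.ofReal_le_ofReal
                (mul_le_mul_of_nonneg_left (hχ.integral_le r) (by norm_num))
          _ = _ := (ENNReal.ofReal_mul hb0).symm
    _ = _ := liminf_const _

end

section

variable {Ω : Set Plane} {X : Plane → Plane} {ε κ : ℕ → ℝ} {η : ℕ → Plane → ℝ}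

/-! ### Passage to the limit in the transport term -/

theorem IsCutoffSeq.nonneg_variation {χ : ℕ → Plane → ℝ} {C : ℝ} (hχ : IsCutoffSeq Ω χ C) :
    0 ≤ C :=
  (integral_nonneg fun _ => norm_nonneg _).trans (hχ.integral_le 0)

/-- The quadratic form of a bounded field of matrices is bounded on `L²`. -/
theorem integrableOn_inner_clm {A : Plane → Plane →L[ℝ] Plane} {f : Plane → Plane} {b : ℝ}
    (hΩ : IsOpen Ω) (hA : AEStronglyMeasurable A (volume.restrict Ω)) (hAb : ∀ x ∈ Ω, ‖A x‖ ≤ b)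
    (hf : MemLp f 2 (volume.restrict Ω)) :
    IntegrableOn (fun x => inner ℝ (A x (f x)) (f x)) Ω ∧
      |∫ x in Ω, inner ℝ (A x (f x)) (f x)| ≤ b * ∫ x in Ω, ‖f x‖ ^ 2 := by
  have hf2 : IntegrableOn (fun x => ‖f x‖ ^ 2) Ω := (memLp_two_iff_integrable_sq_norm hf.1).1 hf
  have hbd : ∀ᵐ x ∂(volume.restrict Ω), ‖inner ℝ (A x (f x)) (f x)‖ ≤ b * ‖f x‖ ^ 2 := by
    refine (ae_restrict_iff' hΩ.measurableSet).2 (Eventually.of_forall fun x hx => ?_)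
    calc ‖inner ℝ (A x (f x)) (f x)‖ ≤ ‖A x (f x)‖ * ‖f x‖ := norm_inner_le_norm _ _
      _ ≤ (b * ‖f x‖) * ‖f x‖ := by
        refine mul_le_mul_of_nonneg_right ?_ (norm_nonneg _)
        exact ((A x).le_opNorm _).trans (mul_le_mul_of_nonneg_right (hAb x hx) (norm_nonneg _))
      _ = b * ‖f x‖ ^ 2 := by ring
  refine ⟨(hf2.const_mul b).mono' ((aestronglyMeasurable_clm_apply hA hf.1).inner hf.1) hbd, ?_⟩
  rw [← Real.norm_eq_abs, ← integral_const_mul]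
  exact norm_integral_le_of_norm_le (hf2.const_mul b) hbd

set_option maxHeartbeats 1000000 in
/-- The transport term for the deformed field differs from the one with the mollified gradient of
`w` by the boundary layer and the term in which the cofactor matrix is differentiated; both are
small. -/
theorem IsDeformationSeq.abs_quadratic_sub_le (h : IsDeformationSeq Ω X ε κ η)
    (hΩ : IsOpen Ω) (hb : Bornology.IsBounded Ω) {χ : ℕ → Plane → ℝ} {C M B δ K : ℝ} {α c : ℝ≥0}
    (hχ : IsCutoffSeq Ω χ C) {w : Plane → Plane} (hw : IsTangentField Ω w M) (hM : 0 ≤ M)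
    (hB : DeformationBounds X ε B) {v : L2 Ω} (hv : v ∈ H Ω) {f : Plane → Plane}
    (hfv : f =ᵐ[volume.restrict Ω] v) (hf : IsRegularNearBoundary Ω δ α c K f) (hK : 0 ≤ K)
    (hδ : 0 < δ) (n : ℕ) (hn : κ n + ε n * B < δ / 2) :
    |(∫ x in Ω, inner ℝ (fderiv ℝ (piola (deform (ε n) X) (mollify (η n) (Ω.indicator w))) x (v x))
          (v x))
        - ∫ x in Ω, inner ℝ (adjCLM (fderiv ℝ (deform (ε n) X) x)
          (mollify (η n) (Ω.indicator (fderiv ℝ w)) (deform (ε n) X x)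
            (fderiv ℝ (deform (ε n) X) x (v x)))) (v x)|
      ≤ ε n * B * M * (∫ x in Ω, ‖v x‖ ^ 2)
        + B * M * K * (ε n * B * K + c * (κ n + ε n * B) ^ (α : ℝ)) * (64 * C) := by
  have hη := h.isMollifier n
  have hΨ := h.contDiff_deform n
  have hwi' : Integrable (Ω.indicator w) :=
    integrable_indicator_of_isOpen hΩ (hw.integrableOn hΩ hb)
  have hDc : ContinuousOn (fderiv ℝ w) Ω := hw.contDiffOn.continuousOn_fderiv_of_isOpen hΩ le_rfl
  have hDi : IntegrableOn (fderiv ℝ w) Ω :=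
    memLp_one_iff_integrable.1 (memLp_of_continuousOn_of_bound hΩ hb hDc hw.norm_fderiv_le 1)
  have hDi' : Integrable (Ω.indicator (fderiv ℝ w)) := integrable_indicator_of_isOpen hΩ hDi
  set U := mollify (η n) (Ω.indicator w) with hUdef
  set G := mollify (η n) (Ω.indicator (fderiv ℝ w)) with hGdef
  have hU : ContDiff ℝ ∞ U := hη.contDiff_mollify hwi'.locallyIntegrable
  have hG : Continuous G := (hη.contDiff_mollify hDi'.locallyIntegrable).continuous
  have hUM : ∀ p, ‖U p‖ ≤ M := fun p => hη.norm_mollify_le p fun x _ => by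
    by_cases hx : x ∈ Ω
    · simpa [hx] using hw.norm_le x hx
    · simpa [hx] using hM
  have hD1 : ContDiff ℝ ∞ (fderiv ℝ (deform (ε n) X)) := hΨ.fderiv_right (by simp)
  have hvL : MemLp v 2 (volume.restrict Ω) := Lp.memLp v
  -- the term in which the cofactor matrix is differentiated
  let A₁ : Plane → Plane →L[ℝ] Plane := fun x =>
    (ContinuousLinearMap.apply ℝ Plane (U (deform (ε n) X x))).comp
      (adjCLM.comp (fderiv ℝ (fderiv ℝ (deform (ε n) X)) x))
  have hA₁ : ∀ x z, A₁ x z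
      = adjCLM (fderiv ℝ (fderiv ℝ (deform (ε n) X)) x z) (U (deform (ε n) X x)) :=
    fun x z => rfl
  have hA₁c : Continuous A₁ := by
    have h1 : Continuous fun x => ContinuousLinearMap.apply ℝ Plane (U (deform (ε n) X x)) :=
      (ContinuousLinearMap.apply ℝ Plane).continuous.comp (hU.continuous.comp hΨ.continuous)
    exact h1.clm_comp (continuous_const.clm_comp (hD1.continuous_fderiv (by simp)))
  have hεB : 0 ≤ ε n * B := mul_nonneg (h.pos n).le hB.pos.le
  have hA₁b : ∀ x ∈ Ω, ‖A₁ x‖ ≤ ε n * B * M := fun x _ => by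
    refine ContinuousLinearMap.opNorm_le_bound _ (mul_nonneg hεB hM) fun z => ?_
    rw [hA₁]
    refine (ContinuousLinearMap.le_opNorm _ _).trans ?_
    calc _ ≤ (ε n * B * ‖z‖) * M := mul_le_mul (hB.adj_fderiv_le n x z) (hUM _) (norm_nonneg _)
          (mul_nonneg hεB (norm_nonneg _))
      _ = _ := by ring
  obtain ⟨i1, b1⟩ := integrableOn_inner_clm hΩ hA₁c.aestronglyMeasurable hA₁b hvL
  -- the term with the mollified gradient of `w`
  let A₂ : Plane → Plane →L[ℝ] Plane := fun x =>
    (adjCLM (fderiv ℝ (deform (ε n) X) x)).comp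
      ((G (deform (ε n) X x)).comp (fderiv ℝ (deform (ε n) X) x))
  have hA₂c : Continuous A₂ := by
    have h1 : Continuous fun x => adjCLM (fderiv ℝ (deform (ε n) X) x) :=
      adjCLM.continuous.comp hD1.continuous
    have h2 : Continuous fun x => G (deform (ε n) X x) := hG.comp hΨ.continuous
    exact h1.clm_comp (h2.clm_comp hD1.continuous)
  have hGM : ∀ p, ‖G p‖ ≤ M := fun p => hη.norm_mollify_le p fun x _ => by
    by_cases hx : x ∈ Ω
    · simpa [hx] using hw.norm_fderiv_le x hx
    · simpa [hx] using hM
  have hA₂b : ∀ x ∈ Ω, ‖A₂ x‖ ≤ B * (M * B) := fun x _ => by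
    refine (ContinuousLinearMap.opNorm_comp_le _ _).trans ?_
    refine mul_le_mul (hB.adj_le n x) ?_ (norm_nonneg _) hB.pos.le
    refine (ContinuousLinearMap.opNorm_comp_le _ _).trans ?_
    exact mul_le_mul (hGM _) (hB.fderiv_le n x) (norm_nonneg _) hM
  obtain ⟨i2, -⟩ := integrableOn_inner_clm hΩ hA₂c.aestronglyMeasurable hA₂b hvL
  -- the full gradient
  have hwi := hw.integrableOn hΩ hb
  have hφ : ContDiff ℝ ∞ (piola (deform (ε n) X) U) := contDiff_piola hΨ hU
  have hφc : Continuous (fderiv ℝ (piola (deform (ε n) X) U)) := hφ.continuous_fderiv (by simp)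
  obtain ⟨b₀, hb₀⟩ := hb.isCompact_closure.exists_bound_of_continuousOn hφc.continuousOn
  obtain ⟨i0, -⟩ := integrableOn_inner_clm hΩ hφc.aestronglyMeasurable
    (fun x hx => hb₀ x (subset_closure hx)) hvL
  have hdecomp : ∀ x z, fderiv ℝ (piola (deform (ε n) X) U) x z - A₂ x z - A₁ x z
      = adjCLM (fderiv ℝ (deform (ε n) X) x)
        (fderiv ℝ U (deform (ε n) X x) (fderiv ℝ (deform (ε n) X) x z)
          - G (deform (ε n) X x) (fderiv ℝ (deform (ε n) X) x z)) := by
    intro x z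
    rw [fderiv_piola hΨ (hU.of_le (by simp)), hA₁, map_sub]
    simp only [A₂, ContinuousLinearMap.comp_apply]
    abel
  have h3 := h.lintegral_boundary_layer_le hΩ hb hχ hw hM hB hv hfv hf hK hδ n hn
  set b₃ := B * M * K * (ε n * B * K + c * (κ n + ε n * B) ^ (α : ℝ)) * (64 * C) with hb₃
  have hb₃0 : 0 ≤ b₃ := by
    have := hχ.nonneg_variation
    have := hη.pos
    have := hB.pos
    have := h.pos n
    positivity
  have h4 : |∫ x in Ω, (inner ℝ (fderiv ℝ (piola (deform (ε n) X) U) x (v x)) (v x)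
      - inner ℝ (A₂ x (v x)) (v x) - inner ℝ (A₁ x (v x)) (v x))| ≤ b₃ := by
    rw [← Real.norm_eq_abs, ← ENNReal.ofReal_le_ofReal_iff hb₃0, ofReal_norm]
    refine (enorm_integral_le_lintegral_enorm _).trans (le_trans (le_of_eq ?_) h3)
    refine lintegral_congr_ae ?_
    filter_upwards [hfv] with x hx
    rw [← inner_sub_left, ← inner_sub_left, hdecomp, hx]
  have i02 : IntegrableOn (fun x => inner ℝ (fderiv ℝ (piola (deform (ε n) X) U) x (v x)) (v x)
      - inner ℝ (A₂ x (v x)) (v x)) Ω := i0.sub i2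
  rw [integral_sub i02 i1, integral_sub i0 i2] at h4
  have h5 := abs_le.1 h4
  have h6 := abs_le.1 b1
  change |_ - ∫ x in Ω, inner ℝ (A₂ x (v x)) (v x)| ≤ _
  rw [abs_le]
  constructor <;> linarith [h5.1, h5.2, h6.1, h6.2]

/-- The transport terms of the deformed fields are bounded, uniformly in the velocities with given
energy and given regularity near the boundary. This is the domination which allows to integrate the
limit of `tendsto_quadratic` in time. -/
theorem IsDeformationSeq.exists_abs_quadratic_le (h : IsDeformationSeq Ω X ε κ η)
    (hΩ : IsOpen Ω) (hb : Bornology.IsBounded Ω) {χ : ℕ → Plane → ℝ} {C M δ K E : ℝ} {α c : ℝ≥0}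
    (hχ : IsCutoffSeq Ω χ C) {w : Plane → Plane} (hw : IsTangentField Ω w M) (hM : 0 ≤ M)
    (hK : 0 ≤ K) (hδ : 0 < δ) :
    ∃ B' : ℝ, ∀ᶠ n in atTop, ∀ v : L2 Ω, v ∈ H Ω → ∀ f : Plane → Plane,
      f =ᵐ[volume.restrict Ω] v → IsRegularNearBoundary Ω δ α c K f →
      ∫ x in Ω, ‖v x‖ ^ 2 ≤ E →
      |∫ x in Ω, inner ℝ (fderiv ℝ (piola (deform (ε n) X) (mollify (η n) (Ω.indicator w))) x (v x))
          (v x)| ≤ B' := by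
  obtain ⟨B, hB⟩ := h.exists_bounds
  have hlim : Tendsto (fun n => κ n + ε n * B) atTop (𝓝 0) := by
    simpa using h.tendsto_radius.add (h.tendsto_zero.mul_const B)
  refine ⟨B * M * E + B * M * K * (B * K + c * (1 + B) ^ (α : ℝ)) * (64 * C) + B * (M * B) * E, ?_⟩
  filter_upwards [hlim.eventually (gt_mem_nhds (by positivity : (0 : ℝ) < δ / 2))] with n hn
    v hv f hfv hf hE
  have h1 := h.abs_quadratic_sub_le hΩ hb hχ hw hM hB hv hfv hf hK hδ n hn
  have hη := h.isMollifier n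
  have hΨ := h.contDiff_deform n
  have hDc : ContinuousOn (fderiv ℝ w) Ω := hw.contDiffOn.continuousOn_fderiv_of_isOpen hΩ le_rfl
  have hDi : IntegrableOn (fderiv ℝ w) Ω :=
    memLp_one_iff_integrable.1 (memLp_of_continuousOn_of_bound hΩ hb hDc hw.norm_fderiv_le 1)
  have hDi' : Integrable (Ω.indicator (fderiv ℝ w)) := integrable_indicator_of_isOpen hΩ hDi
  have hG : Continuous (mollify (η n) (Ω.indicator (fderiv ℝ w))) :=
    (hη.contDiff_mollify hDi'.locallyIntegrable).continuous
  have hD1 : ContDiff ℝ ∞ (fderiv ℝ (deform (ε n) X)) := hΨ.fderiv_right (by simp)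
  have hGM : ∀ p, ‖mollify (η n) (Ω.indicator (fderiv ℝ w)) p‖ ≤ M := fun p =>
    hη.norm_mollify_le p fun x _ => by
      by_cases hx : x ∈ Ω
      · simpa [hx] using hw.norm_fderiv_le x hx
      · simpa [hx] using hM
  let A₂ : Plane → Plane →L[ℝ] Plane := fun x =>
    (adjCLM (fderiv ℝ (deform (ε n) X) x)).comp
      ((mollify (η n) (Ω.indicator (fderiv ℝ w)) (deform (ε n) X x)).comp
        (fderiv ℝ (deform (ε n) X) x))
  have hA₂c : Continuous A₂ := by
    have h1 : Continuous fun x => adjCLM (fderiv ℝ (deform (ε n) X) x) :=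
      adjCLM.continuous.comp hD1.continuous
    exact h1.clm_comp ((hG.comp hΨ.continuous).clm_comp hD1.continuous)
  have hA₂b : ∀ x ∈ Ω, ‖A₂ x‖ ≤ B * (M * B) := fun x _ => by
    refine (ContinuousLinearMap.opNorm_comp_le _ _).trans ?_
    refine mul_le_mul (hB.adj_le n x) ?_ (norm_nonneg _) hB.pos.le
    refine (ContinuousLinearMap.opNorm_comp_le _ _).trans ?_
    exact mul_le_mul (hGM _) (hB.fderiv_le n x) (norm_nonneg _) hM
  obtain ⟨-, b2⟩ := integrableOn_inner_clm hΩ hA₂c.aestronglyMeasurable hA₂b (Lp.memLp v)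
  have hEnn : 0 ≤ ∫ x in Ω, ‖v x‖ ^ 2 := integral_nonneg fun x => sq_nonneg _
  have hC := hχ.nonneg_variation
  have hBp := hB.pos
  have hεn := h.pos n
  have hε1 := h.le_one n
  have hκ1 := h.radius_le_one n
  have hκ0 := hη.pos
  have e1 : ε n * B * M * (∫ x in Ω, ‖v x‖ ^ 2) ≤ B * M * E := by
    calc _ ≤ 1 * B * M * E := by gcongr
      _ = _ := by ring
  have e2 : B * M * K * (ε n * B * K + c * (κ n + ε n * B) ^ (α : ℝ)) * (64 * C)
      ≤ B * M * K * (1 * B * K + c * (1 + 1 * B) ^ (α : ℝ)) * (64 * C) := by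
    gcongr
  rw [one_mul] at e2
  have e3 : B * (M * B) * (∫ x in Ω, ‖v x‖ ^ 2) ≤ B * (M * B) * E := by gcongr
  have h5 := abs_le.1 h1
  have h6 : |∫ x in Ω, inner ℝ (adjCLM (fderiv ℝ (deform (ε n) X) x)
          (mollify (η n) (Ω.indicator (fderiv ℝ w)) (deform (ε n) X x)
            (fderiv ℝ (deform (ε n) X) x (v x)))) (v x)| ≤ B * (M * B) * ∫ x in Ω, ‖v x‖ ^ 2 := b2
  have h7 := abs_le.1 h6
  rw [abs_le]
  constructor <;> linarith [h5.1, h5.2, h7.1, h7.2]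

/-- The transport terms of the deformed fields converge to the transport term of `w`. For
`α > 0` the bound for the boundary layer tends to zero, and the term with the mollified gradient of
`w` converges by dominated convergence, since `∇w` is continuous in `Ω`. -/
theorem IsDeformationSeq.tendsto_quadratic (h : IsDeformationSeq Ω X ε κ η)
    (hΩ : IsOpen Ω) (hb : Bornology.IsBounded Ω) {χ : ℕ → Plane → ℝ} {C M δ K : ℝ} {α c : ℝ≥0}
    (hχ : IsCutoffSeq Ω χ C) {w : Plane → Plane} (hw : IsTangentField Ω w M) (hM : 0 ≤ M)
    {v : L2 Ω} (hv : v ∈ H Ω) {f : Plane → Plane}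
    (hfv : f =ᵐ[volume.restrict Ω] v) (hf : IsRegularNearBoundary Ω δ α c K f) (hK : 0 ≤ K)
    (hδ : 0 < δ) (hα : 0 < α) :
    Tendsto (fun n => ∫ x in Ω, inner ℝ
      (fderiv ℝ (piola (deform (ε n) X) (mollify (η n) (Ω.indicator w))) x (v x)) (v x)) atTop
      (𝓝 (∫ x in Ω, inner ℝ (fderiv ℝ w x (v x)) (v x))) := by
  obtain ⟨B, hB⟩ := h.exists_bounds
  have hlim : Tendsto (fun n => κ n + ε n * B) atTop (𝓝 0) := by
    simpa using h.tendsto_radius.add (h.tendsto_zero.mul_const B)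
  have hDc : ContinuousOn (fderiv ℝ w) Ω := hw.contDiffOn.continuousOn_fderiv_of_isOpen hΩ le_rfl
  have hDi : IntegrableOn (fderiv ℝ w) Ω :=
    memLp_one_iff_integrable.1 (memLp_of_continuousOn_of_bound hΩ hb hDc hw.norm_fderiv_le 1)
  have hDi' : Integrable (Ω.indicator (fderiv ℝ w)) := integrable_indicator_of_isOpen hΩ hDi
  have hvL : MemLp v 2 (volume.restrict Ω) := Lp.memLp v
  have hv2 : IntegrableOn (fun x => ‖v x‖ ^ 2) Ω := (memLp_two_iff_integrable_sq_norm hvL.1).1 hvL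
  have lim2 : Tendsto (fun n => ∫ x in Ω, inner ℝ (adjCLM (fderiv ℝ (deform (ε n) X) x)
          (mollify (η n) (Ω.indicator (fderiv ℝ w)) (deform (ε n) X x)
            (fderiv ℝ (deform (ε n) X) x (v x)))) (v x)) atTop
      (𝓝 (∫ x in Ω, inner ℝ (fderiv ℝ w x (v x)) (v x))) := by
    refine tendsto_integral_of_dominated_convergence (fun x => B * (M * B) * ‖v x‖ ^ 2)
      (fun n => ?_) (hv2.const_mul _) (fun n => Eventually.of_forall fun x => ?_) ?_
    · have hD1 : ContDiff ℝ ∞ (fderiv ℝ (deform (ε n) X)) :=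
        (h.contDiff_deform n).fderiv_right (by simp)
      have hG : Continuous fun x => mollify (η n) (Ω.indicator (fderiv ℝ w)) (deform (ε n) X x) :=
        ((h.isMollifier n).contDiff_mollify hDi'.locallyIntegrable).continuous.comp
          (h.contDiff_deform n).continuous
      have hadj : Continuous fun x => adjCLM (fderiv ℝ (deform (ε n) X) x) :=
        adjCLM.continuous.comp hD1.continuous
      exact (aestronglyMeasurable_clm_apply hadj.aestronglyMeasurable
        (aestronglyMeasurable_clm_apply hG.aestronglyMeasurable
          (aestronglyMeasurable_clm_apply hD1.continuous.aestronglyMeasurable hvL.1))).inner hvL.1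
    · have hGM : ‖mollify (η n) (Ω.indicator (fderiv ℝ w)) (deform (ε n) X x)‖ ≤ M :=
        (h.isMollifier n).norm_mollify_le _ fun x _ => by
          by_cases hx : x ∈ Ω
          · simpa [hx] using hw.norm_fderiv_le x hx
          · simpa [hx] using hM
      refine (norm_inner_le_norm _ _).trans ?_
      calc _ ≤ (B * (M * (B * ‖v x‖))) * ‖v x‖ := by
            refine mul_le_mul_of_nonneg_right ?_ (norm_nonneg _)
            refine (ContinuousLinearMap.le_opNorm _ _).trans
              (mul_le_mul (hB.adj_le n x) ?_ (norm_nonneg _) hB.pos.le)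
            refine (ContinuousLinearMap.le_opNorm _ _).trans
              (mul_le_mul hGM ?_ (norm_nonneg _) hM)
            exact (ContinuousLinearMap.le_opNorm _ _).trans
              (mul_le_mul_of_nonneg_right (hB.fderiv_le n x) (norm_nonneg _))
        _ = _ := by ring
    · refine (ae_restrict_iff' hΩ.measurableSet).2 (Eventually.of_forall fun x hx => ?_)
      have hc : ContinuousAt (Ω.indicator (fderiv ℝ w)) x := by
        refine (hDc.continuousAt (hΩ.mem_nhds hx)).congr ?_
        filter_upwards [hΩ.mem_nhds hx] with y hy
        rw [indicator_of_mem hy]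
      have h1 := h.tendsto_mollify_deform hDi'.locallyIntegrable hc
      rw [indicator_of_mem hx] at h1
      have h2 : Tendsto (fun n => fderiv ℝ (deform (ε n) X) x (v x)) atTop (𝓝 (v x)) :=
        tendsto_clm_apply (h.tendsto_fderiv_deform x) tendsto_const_nhds
      have h3 : Tendsto (fun n => adjCLM (fderiv ℝ (deform (ε n) X) x)
          (mollify (η n) (Ω.indicator (fderiv ℝ w)) (deform (ε n) X x)
            (fderiv ℝ (deform (ε n) X) x (v x)))) atTop (𝓝 (fderiv ℝ w x (v x))) :=
        tendsto_clm_apply (M₀ := ContinuousLinearMap.id ℝ Plane) (z₀ := fderiv ℝ w x (v x))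
          (h.tendsto_adj_fderiv_deform x) (tendsto_clm_apply h1 h2)
      exact h3.inner tendsto_const_nhds
  have hz : Tendsto (fun n => ε n * B * M * (∫ x in Ω, ‖v x‖ ^ 2)
        + B * M * K * (ε n * B * K + c * (κ n + ε n * B) ^ (α : ℝ)) * (64 * C)) atTop (𝓝 0) := by
    have h1 : Tendsto (fun n => (κ n + ε n * B) ^ (α : ℝ)) atTop (𝓝 0) := by
      have h2 := hlim.rpow_const (p := (α : ℝ)) (Or.inr α.2)
      rwa [Real.zero_rpow (by exact_mod_cast hα.ne')] at h2
    have h2 := ((h.tendsto_zero.mul_const B).mul_const M).mul_const (∫ x in Ω, ‖v x‖ ^ 2)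
    have h3 := ((((h.tendsto_zero.mul_const B).mul_const K).add
      (h1.const_mul (c : ℝ))).const_mul (B * M * K)).mul_const (64 * C)
    simpa using h2.add h3
  have hdiff := squeeze_zero_norm' (f := fun n => (∫ x in Ω, inner ℝ
      (fderiv ℝ (piola (deform (ε n) X) (mollify (η n) (Ω.indicator w))) x (v x)) (v x))
      - ∫ x in Ω, inner ℝ (adjCLM (fderiv ℝ (deform (ε n) X) x)
          (mollify (η n) (Ω.indicator (fderiv ℝ w)) (deform (ε n) X x)
            (fderiv ℝ (deform (ε n) X) x (v x)))) (v x)) (by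
    filter_upwards [hlim.eventually (gt_mem_nhds (by positivity : (0 : ℝ) < δ / 2))] with n hn
    exact h.abs_quadratic_sub_le hΩ hb hχ hw hM hB hv hfv hf hK hδ n hn) hz
  simpa using hdiff.add lim2

/-- The deformed fields converge weakly to `w`. -/
theorem IsDeformationSeq.tendsto_integral_inner (h : IsDeformationSeq Ω X ε κ η)
    (hΩ : IsOpen Ω) (hb : Bornology.IsBounded Ω) {M : ℝ}
    {w : Plane → Plane} (hw : IsTangentField Ω w M) (hM : 0 ≤ M) (v : L2 Ω) :
    Tendsto (fun n => ∫ x in Ω, inner ℝ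
      (piola (deform (ε n) X) (mollify (η n) (Ω.indicator w)) x) (v x)) atTop
      (𝓝 (∫ x in Ω, inner ℝ (w x) (v x))) := by
  have := isFiniteMeasure_restrict_of_isBounded hb
  obtain ⟨B, hB⟩ := h.exists_bounds
  have hwi' : Integrable (Ω.indicator w) :=
    integrable_indicator_of_isOpen hΩ (hw.integrableOn hΩ hb)
  have hvi : IntegrableOn v Ω := (Lp.memLp v).integrable (by norm_num)
  refine tendsto_integral_of_dominated_convergence (fun x => B * M * ‖v x‖) (fun n => ?_)
    (hvi.norm.const_mul _) (fun n => Eventually.of_forall fun x => ?_) ?_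
  · exact (contDiff_piola (h.contDiff_deform n) ((h.isMollifier n).contDiff_mollify
      hwi'.locallyIntegrable)).continuous.aestronglyMeasurable.inner hvi.aestronglyMeasurable
  · refine (norm_inner_le_norm _ _).trans (mul_le_mul_of_nonneg_right ?_ (norm_nonneg _))
    refine (ContinuousLinearMap.le_opNorm _ _).trans (mul_le_mul (hB.adj_le n x) ?_
      (norm_nonneg _) hB.pos.le)
    refine (h.isMollifier n).norm_mollify_le _ fun x _ => ?_
    by_cases hx : x ∈ Ω
    · simpa [hx] using hw.norm_le x hx
    · simpa [hx] using hM
  · refine (ae_restrict_iff' hΩ.measurableSet).2 (Eventually.of_forall fun x hx => ?_)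
    have hc : ContinuousAt (Ω.indicator w) x := by
      refine (hw.contDiffOn.continuousOn.continuousAt (hΩ.mem_nhds hx)).congr ?_
      filter_upwards [hΩ.mem_nhds hx] with y hy
      rw [indicator_of_mem hy]
    have h1 := h.tendsto_piola hwi'.locallyIntegrable hc
    rw [indicator_of_mem hx] at h1
    exact h1.inner tendsto_const_nhds

end

section

variable {Ω : Set Plane}

/-! ### Boundedness near the boundary -/

theorem isOpen_inter_boundaryStrip (hΩ : IsOpen Ω) (δ : ℝ) : IsOpen (Ω ∩ boundaryStrip Ω δ) := by
  have : Ω ∩ boundaryStrip Ω δ = Ω ∩ {x | infDist x (frontier Ω) < δ} := by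
    ext x
    simp only [boundaryStrip, mem_inter_iff, mem_ofPred_eq]
    exact ⟨fun h => ⟨h.1, h.2.2⟩, fun h => ⟨h.1, subset_closure h.1, h.2⟩⟩
  rw [this]
  exact hΩ.inter (isOpen_lt (continuous_infDist_pt _) continuous_const)

theorem nonempty_inter_boundaryStrip (hb : Bornology.IsBounded Ω) (hne : Ω.Nonempty) {δ : ℝ}
    (hδ : 0 < δ) : (Ω ∩ boundaryStrip Ω δ).Nonempty := by
  obtain ⟨z, hz⟩ := frontier_nonempty_of_isBounded hb hne
  obtain ⟨x, hx, hxz⟩ := Metric.mem_closure_iff.1 (frontier_subset_closure hz) δ hδ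
  refine ⟨x, hx, subset_closure hx, (infDist_le_dist_of_mem hz).trans_lt ?_⟩
  rwa [dist_comm]

/-- A field with bounded energy which is Hölder continuous on the boundary strip is bounded
there, since the energy bounds it at one point of the strip. -/
theorem exists_isRegularNearBoundary (hΩ : IsOpen Ω) (hb : Bornology.IsBounded Ω)
    (hne : Ω.Nonempty) {δ : ℝ} (hδ : 0 < δ) (C α : ℝ≥0) (E : ℝ) :
    ∃ K : ℝ, 0 ≤ K ∧ ∀ v : L2 Ω, ∫ x in Ω, ‖v x‖ ^ 2 ≤ E → ∀ f : Plane → Plane,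
      f =ᵐ[volume.restrict (Ω ∩ boundaryStrip Ω δ)] v → HolderOnWith C α f (boundaryStrip Ω δ) →
        ∃ g : Plane → Plane, g =ᵐ[volume.restrict Ω] v ∧ IsRegularNearBoundary Ω δ α C K g := by
  classical
  set S := Ω ∩ boundaryStrip Ω δ with hS
  have hSo : IsOpen S := isOpen_inter_boundaryStrip hΩ δ
  have hS0 : volume S ≠ 0 := (hSo.measure_pos volume (nonempty_inter_boundaryStrip hb hne hδ)).ne'
  have hSt : volume S ≠ ⊤ := (hb.subset inter_subset_left).measure_lt_top.ne
  have hmem : ∀ x ∈ Ω, infDist x (frontier Ω) < δ → x ∈ S :=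
    fun x hx hxd => ⟨hx, subset_closure hx, hxd⟩
  refine ⟨√((volume.real S)⁻¹ * E) + C * diam Ω ^ (α : ℝ),
    add_nonneg (Real.sqrt_nonneg _) (by positivity), fun v hv f hfv hf => ?_⟩
  have hH : ∀ x ∈ S, ∀ y ∈ S, ‖f x - f y‖ ≤ C * dist x y ^ (α : ℝ) := by
    intro x hx y hy
    rw [← dist_eq_norm]
    exact hf.dist_le hx.2 hy.2
  have hv2 : IntegrableOn (fun x => ‖v x‖ ^ 2) Ω :=
    (memLp_two_iff_integrable_sq_norm (Lp.memLp v).1).1 (Lp.memLp v)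
  have hfv2 : (fun x => ‖f x‖ ^ 2) =ᵐ[volume.restrict S] fun x => ‖v x‖ ^ 2 := by
    filter_upwards [hfv] with x hx
    rw [hx]
  have hf2 : IntegrableOn (fun x => ‖f x‖ ^ 2) S :=
    Integrable.congr (hv2.mono_set inter_subset_left) hfv2.symm
  -- a point of the strip where `|f|²` does not exceed its average
  obtain ⟨x₀, hx₀, hx₀f⟩ := exists_le_setAverage hS0 hSt hf2
  have h1 : ‖f x₀‖ ^ 2 ≤ (volume.real S)⁻¹ * E := by
    refine hx₀f.trans ?_
    rw [setAverage_eq, smul_eq_mul, integral_congr_ae hfv2]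
    refine mul_le_mul_of_nonneg_left (le_trans ?_ hv) (by positivity)
    exact setIntegral_mono_set hv2 (Eventually.of_forall fun x => sq_nonneg _)
      (Eventually.of_forall inter_subset_left)
  have h2 : ‖f x₀‖ ≤ √((volume.real S)⁻¹ * E) := Real.le_sqrt_of_sq_le h1
  refine ⟨S.piecewise f v, ?_, fun x hx hxd => ?_, fun x hx hxd y hy hyd => ?_⟩
  · filter_upwards [ae_restrict_of_ae ((ae_restrict_iff' hSo.measurableSet).1 hfv)] with x hx
    by_cases hxS : x ∈ S
    · rw [piecewise_eq_of_mem _ _ _ hxS, hx hxS]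
    · rw [piecewise_eq_of_notMem _ _ _ hxS]
  · have hxS := hmem x hx hxd
    rw [piecewise_eq_of_mem _ _ _ hxS]
    calc ‖f x‖ ≤ ‖f x₀‖ + ‖f x - f x₀‖ := by
          simpa using norm_add_le (f x₀) (f x - f x₀)
      _ ≤ _ := by
          refine add_le_add h2 ((hH x hxS x₀ hx₀).trans ?_)
          gcongr
          exact dist_le_diam_of_mem hb hx hx₀.1
  · rw [piecewise_eq_of_mem _ _ _ (hmem x hx hxd), piecewise_eq_of_mem _ _ _ (hmem y hy hyd)]
    exact hH x (hmem x hx hxd) y (hmem y hy hyd)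

end

section

/-! ### Integrated forms of equations in time -/

/-- A function which satisfies `f' = g` weakly in `(0, T)`, with initial value `c`, equals
the primitive of `g` almost everywhere. The test functions need not vanish at time `0`. -/
theorem ae_eq_add_integral_of_forall_test {f g : ℝ → ℝ} {c T : ℝ} (hT : 0 < T)
    (hf : IntegrableOn f (Ioo 0 T)) (hg : IntegrableOn g (Ioo 0 T))
    (h : ∀ θ : ℝ → ℝ, ContDiff ℝ ∞ θ → HasCompactSupport θ → tsupport θ ⊆ Iio T →
      (∫ t in (0 : ℝ)..T, (deriv θ t * f t + θ t * g t)) + θ 0 * c = 0) :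
    ∀ᵐ t ∂(volume.restrict (Ioo 0 T)), f t = c + ∫ s in (0 : ℝ)..t, g s := by
  have hgI : IntervalIntegrable g volume 0 T :=
    (intervalIntegrable_iff_integrableOn_Ioo_of_le hT.le).2 hg
  have hfI : IntervalIntegrable f volume 0 T :=
    (intervalIntegrable_iff_integrableOn_Ioo_of_le hT.le).2 hf
  set G : ℝ → ℝ := fun t => ∫ s in (0 : ℝ)..t, g s with hG
  have hGac : AbsolutelyContinuousOnInterval G 0 T :=
    hgI.absolutelyContinuousOnInterval_intervalIntegral (by simp)
  have hGc : ContinuousOn G (Icc 0 T) := by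
    have := hGac.continuousOn
    rwa [uIcc_of_le hT.le] at this
  have hGI : IntervalIntegrable G volume 0 T := by
    refine ContinuousOn.intervalIntegrable ?_
    rwa [uIcc_of_le hT.le]
  have hFi : IntegrableOn (fun t => f t - (c + G t)) (Ioo 0 T) := by
    refine hf.sub ((integrable_const c).add ?_)
    exact (intervalIntegrable_iff_integrableOn_Ioo_of_le hT.le).1 hGI
  have key := isOpen_Ioo.ae_eq_zero_of_integral_contDiff_smul_eq_zero
    (f := fun t => f t - (c + G t)) hFi.locallyIntegrableOn ?_
  · rw [ae_restrict_iff' measurableSet_Ioo]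
    filter_upwards [key] with t ht hmem
    exact sub_eq_zero.1 (ht hmem)
  -- `ζ` is the derivative of a test function `θ`: the primitive `Z` which vanishes at `T`, cut off
  -- at negative times
  intro ζ hζ hζc hζs
  set Z : ℝ → ℝ := fun t => ∫ s in T..t, ζ s with hZ
  have hZd : ∀ t, HasDerivAt Z (ζ t) t := fun t =>
    intervalIntegral.integral_hasDerivAt_right (hζ.continuous.intervalIntegrable _ _)
      hζ.continuous.stronglyMeasurable.stronglyMeasurableAtFilter hζ.continuous.continuousAt
  have hZ' : deriv Z = ζ := funext fun t => (hZd t).deriv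
  have hZs : ContDiff ℝ ∞ Z := by
    rw [contDiff_infty_iff_deriv, hZ']
    exact ⟨fun t => (hZd t).differentiableAt, hζ⟩
  obtain ⟨r, hr, hZr⟩ : ∃ r > 0, ∀ t, T - r < t → Z t = 0 := by
    have hTn : T ∉ tsupport ζ := fun hm => lt_irrefl T (hζs hm).2
    obtain ⟨r, hr, hball⟩ := Metric.isOpen_iff.1 (isClosed_tsupport ζ).isOpen_compl T hTn
    refine ⟨r, hr, fun t ht => ?_⟩
    have h0 : ∀ s, T - r < s → ζ s = 0 := by
      intro s hs
      by_contra hne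
      have hm := subset_tsupport ζ hne
      have hsT := (hζs hm).2
      refine hball (?_ : s ∈ ball T r) hm
      rw [mem_ball, Real.dist_eq, abs_lt]
      constructor <;> linarith
    refine intervalIntegral.integral_zero_ae (Eventually.of_forall fun s hs => h0 s ?_)
    have := hs.1
    rcases min_choice T t with h | h <;> rw [h] at this <;> linarith
  set θ : ℝ → ℝ := fun t => Real.smoothTransition (t + 2) * Z t with hθ
  have hθs : ContDiff ℝ ∞ θ :=
    (Real.smoothTransition.contDiff.comp (contDiff_id.add contDiff_const)).mul hZs
  have hsub : Function.support θ ⊆ Icc (-2) (T - r) := by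
    intro t ht
    constructor
    · by_contra hlt
      refine ht ?_
      simp only [hθ]
      rw [Real.smoothTransition.zero_of_nonpos (by linarith), zero_mul]
    · by_contra hlt
      exact ht (by simp only [hθ]; rw [hZr t (by linarith), mul_zero])
  have htsub : tsupport θ ⊆ Icc (-2) (T - r) := closure_minimal hsub isClosed_Icc
  have hθc : HasCompactSupport θ := isCompact_Icc.of_isClosed_subset (isClosed_tsupport θ) htsub
  have hθZ : ∀ t, 0 ≤ t → θ t = Z t := fun t ht => by
    simp only [hθ]
    rw [Real.smoothTransition.one_of_one_le (by linarith), one_mul]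
  have hθ' : ∀ t, 0 ≤ t → deriv θ t = ζ t := fun t ht => by
    have : θ =ᶠ[𝓝 t] Z := by
      filter_upwards [lt_mem_nhds (show -1 < t by linarith)] with s hs
      simp only [hθ]
      rw [Real.smoothTransition.one_of_one_le (by linarith), one_mul]
    rw [this.deriv_eq, hZ']
  have h1 := h θ hθs hθc fun t ht => lt_of_le_of_lt (htsub ht).2 (by linarith)
  have hζf : IntervalIntegrable (fun t => ζ t * f t) volume 0 T :=
    hfI.continuousOn_mul hζ.continuous.continuousOn
  have hζG : IntervalIntegrable (fun t => ζ t * G t) volume 0 T :=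
    hGI.continuousOn_mul hζ.continuous.continuousOn
  have hZg : IntervalIntegrable (fun t => Z t * g t) volume 0 T :=
    hgI.continuousOn_mul hZs.continuous.continuousOn
  have h2 : ∫ t in (0 : ℝ)..T, (deriv θ t * f t + θ t * g t)
      = (∫ t in (0 : ℝ)..T, ζ t * f t) + ∫ t in (0 : ℝ)..T, Z t * g t := by
    rw [← intervalIntegral.integral_add hζf hZg]
    refine intervalIntegral.integral_congr fun t ht => ?_
    rw [uIcc_of_le hT.le] at ht
    rw [hθ' t ht.1, hθZ t ht.1]
  have hZT : Z T = 0 := hZr T (by linarith)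
  -- integration by parts, where `G` is absolutely continuous with `G' = g` almost everywhere
  have h3 : ∫ t in (0 : ℝ)..T, Z t * g t = -∫ t in (0 : ℝ)..T, ζ t * G t := by
    have hZac : AbsolutelyContinuousOnInterval Z 0 T :=
      (hZs.of_le (by simp)).contDiffOn.absolutelyContinuousOnInterval
    have e1 := hZac.integral_mul_deriv_eq_deriv_mul hGac
    rw [hZT, hZ'] at e1
    have hG0 : G 0 = 0 := by simp [hG]
    rw [hG0] at e1
    have e2 : ∫ t in (0 : ℝ)..T, Z t * deriv G t = ∫ t in (0 : ℝ)..T, Z t * g t := by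
      refine intervalIntegral.integral_congr_ae ?_
      filter_upwards [hgI.ae_hasDerivAt_integral] with t ht hmem
      rw [(ht (uIoc_subset_uIcc hmem) 0 (by simp)).deriv]
    rw [← e2, e1]
    ring
  have h4 : ∫ t in (0 : ℝ)..T, ζ t * c = -(Z 0) * c := by
    rw [intervalIntegral.integral_mul_const, hZ, intervalIntegral.integral_symm]
  have h5 : ∫ t in (0 : ℝ)..T, ζ t * (f t - (c + G t)) = 0 := by
    have e : ∀ t, ζ t * (f t - (c + G t)) = ζ t * f t - (ζ t * c + ζ t * G t) := fun t => by ring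
    simp_rw [e]
    have hζc' : IntervalIntegrable (fun t => ζ t * c) volume 0 T :=
      (hζ.continuous.mul continuous_const).intervalIntegrable _ _
    rw [intervalIntegral.integral_sub hζf (hζc'.add hζG), intervalIntegral.integral_add hζc' hζG,
      h4]
    rw [h2, h3, hθZ 0 le_rfl] at h1
    linarith
  rw [intervalIntegral.integral_of_le hT.le] at h5
  rw [← h5]
  symm
  refine setIntegral_eq_integral_of_forall_compl_eq_zero fun t ht => ?_
  have : ζ t = 0 := by
    by_contra hne
    exact ht (Ioo_subset_Ioc_self (hζs (subset_tsupport ζ hne)))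
  rw [this, zero_mul]

variable {Ω : Set Plane}

/-! ### The quadratic form of the transport term -/

/-- The quadratic form `∫_Ω A(x) v(x) · v(x) dx` of a field `A` of matrices. -/
noncomputable def quadForm (Ω : Set Plane) (A : Plane → Plane →L[ℝ] Plane) (v : Plane → Plane) :
    ℝ := ∫ x in Ω, inner ℝ (A x (v x)) (v x)

/-- The multiplication by a bounded field of matrices, as a bounded operator on `L²`. -/
theorem exists_clm_of_bound {A : Plane → Plane →L[ℝ] Plane} {b : ℝ} (hΩ : IsOpen Ω)
    (hA : AEStronglyMeasurable A (volume.restrict Ω)) (hAb : ∀ x ∈ Ω, ‖A x‖ ≤ b) :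
    ∃ L : L2 Ω →L[ℝ] L2 Ω, ∀ f : L2 Ω, L f =ᵐ[volume.restrict Ω] fun x => A x (f x) := by
  have hbd : ∀ f : Plane → Plane, ∀ᵐ x ∂(volume.restrict Ω), ‖A x (f x)‖ ≤ b * ‖f x‖ := fun f =>
    (ae_restrict_iff' hΩ.measurableSet).2 (Eventually.of_forall fun x hx =>
      ((A x).le_opNorm _).trans (mul_le_mul_of_nonneg_right (hAb x hx) (norm_nonneg _)))
  have hm : ∀ f : L2 Ω, MemLp (fun x => A x (f x)) 2 (volume.restrict Ω) := fun f =>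
    (Lp.memLp f).of_le_mul (aestronglyMeasurable_clm_apply hA (Lp.memLp f).1) (hbd f)
  let L₀ : L2 Ω →ₗ[ℝ] L2 Ω :=
    { toFun := fun f => (hm f).toLp _
      map_add' := fun f g => by
        refine Lp.ext ?_
        filter_upwards [(hm (f + g)).coeFn_toLp, (hm f).coeFn_toLp, (hm g).coeFn_toLp,
          Lp.coeFn_add f g, Lp.coeFn_add ((hm f).toLp _) ((hm g).toLp _)] with x h1 h2 h3 h4 h5
        rw [h1, h5, Pi.add_apply, h2, h3, h4, Pi.add_apply, map_add]
      map_smul' := fun c f => by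
        refine Lp.ext ?_
        filter_upwards [(hm (c • f)).coeFn_toLp, (hm f).coeFn_toLp, Lp.coeFn_smul c f,
          Lp.coeFn_smul c ((hm f).toLp _)] with x h1 h2 h3 h4
        rw [h1, RingHom.id_apply, h4, Pi.smul_apply, h2, h3, Pi.smul_apply, map_smul] }
  refine ⟨L₀.mkContinuous b fun f => Lp.norm_le_mul_norm_of_ae_le_mul ?_,
    fun f => (hm f).coeFn_toLp⟩
  filter_upwards [(hm f).coeFn_toLp, hbd f] with x h1 h2
  change ‖(hm f).toLp _ x‖ ≤ _
  rwa [h1]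

theorem continuous_quadForm {A : Plane → Plane →L[ℝ] Plane} {b : ℝ} (hΩ : IsOpen Ω)
    (hA : AEStronglyMeasurable A (volume.restrict Ω)) (hAb : ∀ x ∈ Ω, ‖A x‖ ≤ b) :
    Continuous fun f : L2 Ω => quadForm Ω A f := by
  obtain ⟨L, hL⟩ := exists_clm_of_bound hΩ hA hAb
  have : (fun f : L2 Ω => quadForm Ω A f) = fun f => inner ℝ (L f) f := by
    ext f
    rw [L2.inner_def]
    refine integral_congr_ae ?_
    filter_upwards [hL f] with x hx
    rw [hx]
  rw [this]
  fun_prop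

theorem integral_norm_sq_eq (f : L2 Ω) : ∫ x in Ω, ‖f x‖ ^ 2 = ‖f‖ ^ 2 := by
  rw [← real_inner_self_eq_norm_sq, L2.inner_def]
  simp_rw [real_inner_self_eq_norm_sq]

theorem abs_quadForm_le {A : Plane → Plane →L[ℝ] Plane} {b : ℝ} (hΩ : IsOpen Ω)
    (hA : AEStronglyMeasurable A (volume.restrict Ω)) (hAb : ∀ x ∈ Ω, ‖A x‖ ≤ b) (f : L2 Ω) :
    |quadForm Ω A f| ≤ b * ‖f‖ ^ 2 := by
  rw [← integral_norm_sq_eq]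
  exact (integrableOn_inner_clm hΩ hA hAb (Lp.memLp f)).2

end

section

variable {Ω : Set Plane} {T : ℝ} {v₀ : H Ω} {v : ℝ → H Ω}

/-! ### The weak formulation, integrated in time -/

instance completeSpace_H (Ω : Set Plane) : CompleteSpace (H Ω) :=
  (Submodule.isClosed_orthogonal (Submodule.span ℝ (gradientFields Ω))).completeSpace_coe

theorem integral_inner_eq_inner_toLp {f : Plane → Plane} (hf : MemLp f 2 (volume.restrict Ω))
    (g : L2 Ω) : ∫ x in Ω, inner ℝ (f x) (g x) = inner ℝ (hf.toLp f) g := by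
  rw [L2.inner_def]
  refine integral_congr_ae ?_
  filter_upwards [hf.coeFn_toLp] with x hx
  rw [hx]

/-- The product of a solenoidal test field and a function of time is a test field. -/
theorem IsSolenoidalTest.isTestField {φ : Plane → Plane} (hφ : IsSolenoidalTest Ω φ) {θ : ℝ → ℝ}
    (hθ : ContDiff ℝ ∞ θ) (hθc : HasCompactSupport θ) (hθs : tsupport θ ⊆ Iio T) :
    IsTestField Ω T fun t x => θ t • φ x := by
  have hsub : tsupport (fun z : ℝ × Plane => θ z.1 • φ z.2) ⊆ tsupport θ ×ˢ tsupport φ := by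
    refine closure_minimal (fun z hz => ?_) ((isClosed_tsupport θ).prod (isClosed_tsupport φ))
    exact ⟨subset_tsupport θ fun h => hz (by simp [h]), subset_tsupport φ fun h => hz (by simp [h])⟩
  refine ⟨(hθ.comp contDiff_fst).smul (hφ.contDiff.comp contDiff_snd), ?_,
    hsub.trans (prod_mono hθs hφ.tsupport_subset), fun t _ x _ => ?_⟩
  · exact (hθc.isCompact.prod hφ.hasCompactSupport.isCompact).of_isClosed_subset
      (isClosed_tsupport _) hsub
  · rw [divergence_smul (by fun_prop) (hφ.contDiff.differentiable (by simp) x),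
      hφ.divergence_eq_zero x]
    simp

theorem IsSolenoidalTest.exists_norm_fderiv_le {φ : Plane → Plane} (hφ : IsSolenoidalTest Ω φ) :
    ∃ b : ℝ, ∀ x, ‖fderiv ℝ φ x‖ ≤ b :=
  (hφ.contDiff.continuous_fderiv (by simp)).bounded_above_of_compact_support
    (hφ.hasCompactSupport.fderiv ℝ)

namespace IsAdmissibleWeakSolution

theorem ae_norm_le (hv : IsAdmissibleWeakSolution Ω T v₀ v) :
    ∀ᵐ t ∂(volume.restrict (Ioo 0 T)), ‖v t‖ ≤ ‖v₀‖ := by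
  filter_upwards [hv.energy_le] with t ht
  rw [integral_norm_sq_eq, integral_norm_sq_eq] at ht
  exact le_of_sq_le_sq ht (norm_nonneg _)

theorem aestronglyMeasurable_coe (hv : IsAdmissibleWeakSolution Ω T v₀ v) :
    AEStronglyMeasurable (fun t => (v t : L2 Ω)) (volume.restrict (Ioo 0 T)) :=
  (H Ω).subtypeL.continuous.comp_aestronglyMeasurable hv.memLp_top.1

theorem integrableOn_quadForm (hv : IsAdmissibleWeakSolution Ω T v₀ v)
    {A : Plane → Plane →L[ℝ] Plane} {b : ℝ} (hΩ : IsOpen Ω)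
    (hA : AEStronglyMeasurable A (volume.restrict Ω)) (hAb : ∀ x ∈ Ω, ‖A x‖ ≤ b) :
    IntegrableOn (fun t => quadForm Ω A (v t : L2 Ω)) (Ioo 0 T) := by
  have : IsFiniteMeasure (volume.restrict (Ioo (0 : ℝ) T)) := ⟨by simp⟩
  refine Integrable.of_bound
    ((continuous_quadForm hΩ hA hAb).comp_aestronglyMeasurable hv.aestronglyMeasurable_coe)
    (|b| * ‖v₀‖ ^ 2) ?_
  filter_upwards [hv.ae_norm_le] with t ht
  refine (abs_quadForm_le hΩ hA hAb _).trans ?_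
  exact mul_le_mul (le_abs_self b) (pow_le_pow_left₀ (norm_nonneg _) ht 2) (sq_nonneg _)
    (abs_nonneg _)

/-- The weak formulation with a stationary test field `φ`, integrated in time. -/
theorem ae_integral_inner_eq (hv : IsAdmissibleWeakSolution Ω T v₀ v) (hΩ : IsOpen Ω)
    (hT : 0 < T) {φ : Plane → Plane} (hφ : IsSolenoidalTest Ω φ) :
    ∀ᵐ t ∂(volume.restrict (Ioo 0 T)), ∫ x in Ω, inner ℝ (φ x) ((v t : L2 Ω) x)
      = (∫ x in Ω, inner ℝ (φ x) ((v₀ : L2 Ω) x))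
        + ∫ s in (0 : ℝ)..t, quadForm Ω (fderiv ℝ φ) (v s : L2 Ω) := by
  obtain ⟨b, hb⟩ := hφ.exists_norm_fderiv_le
  have hDc : Continuous (fderiv ℝ φ) := hφ.contDiff.continuous_fderiv (by simp)
  have : IsFiniteMeasure (volume.restrict (Ioo (0 : ℝ) T)) := ⟨by simp⟩
  refine ae_eq_add_integral_of_forall_test hT ?_
    (hv.integrableOn_quadForm hΩ hDc.aestronglyMeasurable fun x _ => hb x) fun θ hθ hθc hθs => ?_
  · simp_rw [integral_inner_eq_inner_toLp hφ.memLp]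
    refine Integrable.of_bound (C := ‖hφ.memLp.toLp φ‖ * ‖v₀‖)
      (AEStronglyMeasurable.inner (𝕜 := ℝ) aestronglyMeasurable_const
        hv.aestronglyMeasurable_coe) ?_
    filter_upwards [hv.ae_norm_le] with t ht
    exact (norm_inner_le_norm _ _).trans (mul_le_mul_of_nonneg_left ht (norm_nonneg _))
  · refine Eq.trans ?_ (hv.weak_form _ (hφ.isTestField hθ hθc hθs))
    congr 1
    · refine intervalIntegral.integral_congr fun t _ => ?_
      have i1 : IntegrableOn (fun x => inner ℝ (φ x) ((v t : L2 Ω) x)) Ω :=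
        integrable_inner_of_memLp hφ.memLp (Lp.memLp _)
      have i2 := (integrableOn_inner_clm hΩ hDc.aestronglyMeasurable (fun x _ => hb x)
        (Lp.memLp (v t : L2 Ω))).1
      rw [quadForm, ← integral_const_mul, ← integral_const_mul,
        ← integral_add (i1.const_mul _) (i2.const_mul _)]
      congr 1
      ext x
      rw [deriv_smul_const (hθ.differentiable (by simp) t), real_inner_smul_left,
        fderiv_fun_const_smul (hφ.contDiff.differentiable (by simp) x), _root_.smul_apply,
        real_inner_smul_left]
    · rw [← integral_const_mul]
      congr 1
      ext x
      rw [real_inner_smul_right, real_inner_comm]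

theorem continuousOn_integral_quadForm (hv : IsAdmissibleWeakSolution Ω T v₀ v) (hΩ : IsOpen Ω)
    (hT : 0 < T) {φ : Plane → Plane} (hφ : IsSolenoidalTest Ω φ) :
    ContinuousOn (fun t => ∫ s in (0 : ℝ)..t, quadForm Ω (fderiv ℝ φ) (v s : L2 Ω))
      (Icc 0 T) := by
  obtain ⟨b, hb⟩ := hφ.exists_norm_fderiv_le
  have hDc : Continuous (fderiv ℝ φ) := hφ.contDiff.continuous_fderiv (by simp)
  have hgi := hv.integrableOn_quadForm hΩ hDc.aestronglyMeasurable fun x _ => hb x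
  have := intervalIntegral.continuousOn_primitive_interval (a := 0) (b := T) (μ := volume)
    (f := fun s => quadForm Ω (fderiv ℝ φ) (v s : L2 Ω))
    (by rwa [uIcc_of_le hT.le, integrableOn_Icc_iff_integrableOn_Ioo])
  rwa [uIcc_of_le hT.le] at this

/-- The filter of neighbourhoods of `t`, up to null sets of times, is proper. -/
theorem ae_inf_nhds_neBot {t : ℝ} (hT : 0 < T) (ht : t ∈ Icc 0 T) :
    (ae (volume.restrict (Ioo 0 T)) ⊓ 𝓝 t).NeBot := by
  rw [inf_neBot_iff]
  intro s hs U hU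
  obtain ⟨U', hU'U, hU'o, htU'⟩ := _root_.mem_nhds_iff.1 hU
  by_contra hemp
  rw [not_nonempty_iff_eq_empty] at hemp
  have htc : t ∈ closure (Ioo 0 T) := by rwa [closure_Ioo hT.ne]
  have hpos := (hU'o.inter isOpen_Ioo).measure_pos volume (mem_closure_iff.1 htc U' hU'o htU')
  rw [mem_ae_iff] at hs
  have h0 : volume.restrict (Ioo 0 T) U' ≤ 0 := by
    rw [← hs]
    refine measure_mono fun x hx hxs => ?_
    have : x ∈ s ∩ U := ⟨hxs, hU'U hx⟩
    rw [hemp] at this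
    exact this
  rw [Measure.restrict_apply hU'o.measurableSet] at h0
  exact absurd hpos (not_lt.2 h0)

/-- A weak limit of `v` at the time `t`, which exists by the weak-* compactness of balls. It is
taken along an ultrafilter of neighbourhoods of `t` up to null sets, so that the integrated
equation, which holds at almost every time, passes to the limit. -/
theorem exists_weak_limit (hv : IsAdmissibleWeakSolution Ω T v₀ v) (hΩ : IsOpen Ω)
    (hT : 0 < T) {t : ℝ} (ht : t ∈ Icc 0 T) :
    ∃ u : H Ω, ‖u‖ ≤ ‖v₀‖ ∧ ∀ φ, IsSolenoidalTest Ω φ →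
      ∫ x in Ω, inner ℝ (φ x) ((u : L2 Ω) x) = (∫ x in Ω, inner ℝ (φ x) ((v₀ : L2 Ω) x))
        + ∫ s in (0 : ℝ)..t, quadForm Ω (fderiv ℝ φ) (v s : L2 Ω) := by
  have hne := ae_inf_nhds_neBot hT ht
  set F := ae (volume.restrict (Ioo 0 T)) ⊓ 𝓝 t with hF
  let D : ℝ → WeakDual ℝ (H Ω) := fun s =>
    StrongDual.toWeakDual (InnerProductSpace.toDual ℝ (H Ω) (v s))
  have hK : IsCompact (WeakDual.toStrongDual ⁻¹' closedBall (0 : StrongDual ℝ (H Ω)) ‖v₀‖) :=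
    WeakDual.isCompact_closedBall 0 ‖v₀‖
  have hmem : ∀ᶠ s in F,
      D s ∈ WeakDual.toStrongDual ⁻¹' closedBall (0 : StrongDual ℝ (H Ω)) ‖v₀‖ := by
    refine Filter.Eventually.filter_mono inf_le_left ?_
    filter_upwards [hv.ae_norm_le] with s hs
    refine mem_preimage.2 ((mem_closedBall_zero_iff (E := StrongDual ℝ (H Ω))).2 ?_)
    exact (LinearIsometryEquiv.norm_map (InnerProductSpace.toDual ℝ (H Ω)) (v s)).trans_le hs
  let 𝒰 : Ultrafilter ℝ := Ultrafilter.of F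
  have h𝒰 : (𝒰 : Filter ℝ) ≤ F := Ultrafilter.of_le F
  obtain ⟨l, hlK, hl⟩ := hK.ultrafilter_le_nhds' (𝒰.map D) (h𝒰 hmem)
  have hlim : ∀ x : H Ω, Tendsto (fun s => inner ℝ (v s) x) 𝒰 (𝓝 (l x)) := fun x =>
    ((WeakDual.eval_continuous x).tendsto l).comp hl
  refine ⟨(InnerProductSpace.toDual ℝ (H Ω)).symm (WeakDual.toStrongDual l), ?_, fun φ hφ => ?_⟩
  · rw [LinearIsometryEquiv.norm_map]
    exact (mem_closedBall_zero_iff (E := StrongDual ℝ (H Ω))).1 hlK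
  have hcont := hv.continuousOn_integral_quadForm hΩ hT hφ
  have hF' : F ≤ 𝓝[Icc 0 T] t := by
    refine le_inf inf_le_right (le_principal_iff.2 (mem_inf_of_left ?_))
    filter_upwards [ae_restrict_mem measurableSet_Ioo] with s hs using Ioo_subset_Icc_self hs
  have hlim2 : Tendsto (fun s => (∫ x in Ω, inner ℝ (φ x) ((v₀ : L2 Ω) x))
      + ∫ s in (0 : ℝ)..s, quadForm Ω (fderiv ℝ φ) (v s : L2 Ω)) 𝒰
      (𝓝 ((∫ x in Ω, inner ℝ (φ x) ((v₀ : L2 Ω) x))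
        + ∫ s in (0 : ℝ)..t, quadForm Ω (fderiv ℝ φ) (v s : L2 Ω))) :=
    ((hcont t ht).tendsto.mono_left (h𝒰.trans hF')).const_add _
  have h1 : Tendsto (fun s => inner ℝ (v s) ⟨_, hφ.toLp_mem_H⟩) 𝒰
      (𝓝 ((∫ x in Ω, inner ℝ (φ x) ((v₀ : L2 Ω) x))
        + ∫ s in (0 : ℝ)..t, quadForm Ω (fderiv ℝ φ) (v s : L2 Ω))) := by
    refine hlim2.congr' (Filter.Eventually.filter_mono (h𝒰.trans inf_le_left) ?_)
    filter_upwards [hv.ae_integral_inner_eq hΩ hT hφ] with s hs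
    rw [← hs, integral_inner_eq_inner_toLp hφ.memLp, real_inner_comm]
    rfl
  rw [tendsto_nhds_unique h1 (hlim _), integral_inner_eq_inner_toLp hφ.memLp, real_inner_comm]
  exact InnerProductSpace.toDual_symm_apply (𝕜 := ℝ) (E := H Ω)
    (x := (⟨_, hφ.toLp_mem_H⟩ : H Ω)) (y := WeakDual.toStrongDual l)

end IsAdmissibleWeakSolution

/-! ### Existence of the weakly continuous representative -/

/-- The density of the solenoidal test fields in `H(Ω)`, for domains with boundary of class `C²`. -/
theorem eq_zero_of_forall_isSolenoidalTest (hΩ : IsOpen Ω) (hb : Bornology.IsBounded Ω)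
    (hne : Ω.Nonempty) (hC : HasCkBoundary 2 Ω) {f : L2 Ω} (hf : f ∈ H Ω)
    (hort : ∀ φ, IsSolenoidalTest Ω φ → ∫ x in Ω, inner ℝ (φ x) (f x) = 0) : f = 0 := by
  obtain ⟨ρ, hρ⟩ := exists_globalDefiningFunction hΩ hb hC
  obtain ⟨X, c, s, hX⟩ := hρ.exists_transversal hb hne
  obtain ⟨ε, κ, η, h⟩ := hX.exists_isDeformationSeq hρ hb hne
  exact h.eq_zero_of_forall_isSolenoidalTest hΩ hb hne hf hort

/-- A closed subspace of `L²` which contains `H(Ω)ᗮ` and the solenoidal test fields is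
everything. -/
theorem eq_top_of_isSolenoidalTest_mem (hΩ : IsOpen Ω) (hb : Bornology.IsBounded Ω)
    (hne : Ω.Nonempty) (hC : HasCkBoundary 2 Ω) {W : Submodule ℝ (L2 Ω)}
    (hW : IsClosed (W : Set (L2 Ω))) (hH : (H Ω)ᗮ ≤ W)
    (ht : ∀ φ (hφ : IsSolenoidalTest Ω φ), hφ.memLp.toLp φ ∈ W) : W = ⊤ := by
  have : CompleteSpace W := hW.completeSpace_coe
  rw [← Submodule.orthogonal_eq_bot_iff, Submodule.eq_bot_iff]
  intro f hf
  have hfH : f ∈ H Ω := by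
    rw [← Submodule.orthogonal_orthogonal (H Ω)]
    exact Submodule.orthogonal_le hH hf
  refine eq_zero_of_forall_isSolenoidalTest hΩ hb hne hC hfH fun φ hφ => ?_
  rw [integral_inner_eq_inner_toLp hφ.memLp]
  exact hf _ (ht φ hφ)

/-- `u` is the representative of the admissible weak solution `v` which is weakly continuous on
`[0, T]`; it satisfies the weak formulation, integrated in time, at every time. The right-hand side
involves only the values of `v` at almost every time. -/
structure IsRepresentative (Ω : Set Plane) (T : ℝ) (v₀ : H Ω) (v u : ℝ → H Ω) : Prop where
  ae_eq : ∀ᵐ t ∂(volume.restrict (Ioo 0 T)), u t = v t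
  initial : u 0 = v₀
  norm_le : ∀ t ∈ Icc 0 T, ‖u t‖ ≤ ‖v₀‖
  weakly_continuous : ∀ h : L2 Ω, ContinuousOn (fun t => inner ℝ (u t : L2 Ω) h) (Icc 0 T)
  integral_inner_eq : ∀ φ, IsSolenoidalTest Ω φ → ∀ t ∈ Icc 0 T,
    ∫ x in Ω, inner ℝ (φ x) ((u t : L2 Ω) x) = (∫ x in Ω, inner ℝ (φ x) ((v₀ : L2 Ω) x))
      + ∫ s in (0 : ℝ)..t, quadForm Ω (fderiv ℝ φ) (v s : L2 Ω)

/-- The vectors whose pairing with a bounded path is continuous form a closed subspace. -/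
theorem continuousOn_inner_of_bounded {u : ℝ → H Ω} {B : ℝ} {I : Set ℝ}
    (hu : ∀ t ∈ I, ‖u t‖ ≤ B) :
    ∃ W : Submodule ℝ (L2 Ω), IsClosed (W : Set (L2 Ω)) ∧
      ∀ h, h ∈ W ↔ ContinuousOn (fun t => inner ℝ (u t : L2 Ω) h) I := by
  let W : Submodule ℝ (L2 Ω) :=
    { carrier := {h | ContinuousOn (fun t => inner ℝ (u t : L2 Ω) h) I}
      add_mem' := fun {a b} ha hb => by
        simp only [mem_ofPred_eq, inner_add_right] at ha hb ⊢
        exact ha.add hb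
      zero_mem' := by
        simp only [mem_ofPred_eq, inner_zero_right]
        exact continuousOn_const
      smul_mem' := fun c a ha => by
        simp only [mem_ofPred_eq, inner_smul_right] at ha ⊢
        exact continuousOn_const.mul ha }
  refine ⟨W, isClosed_of_closure_subset fun h hh => ?_, fun h => Iff.rfl⟩
  obtain ⟨g, hg, hgl⟩ := mem_closure_iff_seq_limit.1 hh
  refine TendstoUniformlyOn.continuousOn (F := fun n t => inner ℝ (u t : L2 Ω) (g n)) (p := atTop)
    ?_ (Frequently.of_forall hg)
  rw [Metric.tendstoUniformlyOn_iff]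
  intro e he
  have hB : ∀ t ∈ I, ‖(u t : L2 Ω)‖ ≤ |B| := fun t ht => (hu t ht).trans (le_abs_self B)
  filter_upwards [Metric.tendsto_nhds.1 hgl (e / (|B| + 1)) (by positivity)] with n hn t ht
  rw [dist_eq_norm, ← inner_sub_right]
  rw [dist_comm, dist_eq_norm] at hn
  calc ‖inner ℝ (u t : L2 Ω) (h - g n)‖ ≤ ‖(u t : L2 Ω)‖ * ‖h - g n‖ := norm_inner_le_norm _ _
    _ ≤ |B| * ‖h - g n‖ := mul_le_mul_of_nonneg_right (hB t ht) (norm_nonneg _)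
    _ ≤ (|B| + 1) * ‖h - g n‖ := by
        have := norm_nonneg (h - g n)
        linarith
    _ < e := by
        rw [lt_div_iff₀ (by positivity)] at hn
        linarith

/-- The weak limits of `v` at each time are determined by the integrated equation, since the
solenoidal test fields are dense. That they agree with `v` almost everywhere and depend weakly
continuously on the time holds for the pairings with test fields, hence for all pairings. -/
theorem IsAdmissibleWeakSolution.exists_isRepresentative (hv : IsAdmissibleWeakSolution Ω T v₀ v)
    (hΩ : IsOpen Ω) (hb : Bornology.IsBounded Ω) (hne : Ω.Nonempty) (hC : HasCkBoundary 2 Ω)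
    (hT : 0 < T) : ∃ u, IsRepresentative Ω T v₀ v u := by
  have hex : ∀ t, ∃ u : H Ω, t ∈ Icc 0 T → ‖u‖ ≤ ‖v₀‖ ∧ ∀ φ, IsSolenoidalTest Ω φ →
      ∫ x in Ω, inner ℝ (φ x) ((u : L2 Ω) x) = (∫ x in Ω, inner ℝ (φ x) ((v₀ : L2 Ω) x))
        + ∫ s in (0 : ℝ)..t, quadForm Ω (fderiv ℝ φ) (v s : L2 Ω) := by
    intro t
    by_cases ht : t ∈ Icc 0 T
    · obtain ⟨u, hu⟩ := hv.exists_weak_limit hΩ hT ht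
      exact ⟨u, fun _ => hu⟩
    · exact ⟨0, fun h => absurd h ht⟩
  choose u hu using hex
  have hunorm : ∀ t ∈ Icc 0 T, ‖u t‖ ≤ ‖v₀‖ := fun t ht => (hu t ht).1
  have hueq := fun φ (hφ : IsSolenoidalTest Ω φ) t (ht : t ∈ Icc 0 T) => (hu t ht).2 φ hφ
  -- elements of `H(Ω)` are determined by their products with the test fields
  have hdet : ∀ f g : H Ω, (∀ φ, IsSolenoidalTest Ω φ → ∫ x in Ω, inner ℝ (φ x) ((f : L2 Ω) x)
      = ∫ x in Ω, inner ℝ (φ x) ((g : L2 Ω) x)) → f = g := by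
    intro f g hfg
    refine Subtype.ext (sub_eq_zero.1 (eq_zero_of_forall_isSolenoidalTest hΩ hb hne hC
      (Submodule.sub_mem _ f.2 g.2) fun φ hφ => ?_))
    have h1 := hfg φ hφ
    rw [integral_inner_eq_inner_toLp hφ.memLp, integral_inner_eq_inner_toLp hφ.memLp] at h1
    rw [integral_inner_eq_inner_toLp hφ.memLp, inner_sub_right, h1, sub_self]
  refine ⟨u, ?_, ?_, hunorm, ?_, hueq⟩
  · have hsc : SecondCountableTopology (L2 Ω) := by
      have : Fact ((2 : ℝ≥0∞) ≠ ⊤) := ⟨by norm_num⟩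
      infer_instance
    let W : Submodule ℝ (L2 Ω) :=
      { carrier := {h | ∀ᵐ t ∂(volume.restrict (Ioo 0 T)), inner ℝ h (u t - v t : L2 Ω) = 0}
        add_mem' := fun {a b} ha hb => by
          rw [mem_ofPred_eq] at ha hb ⊢
          filter_upwards [ha, hb] with t hat hbt
          rw [inner_add_left, hat, hbt, add_zero]
        zero_mem' := by
          rw [mem_ofPred_eq]
          exact Eventually.of_forall fun t => inner_zero_left _
        smul_mem' := fun c a ha => by
          rw [mem_ofPred_eq] at ha ⊢
          filter_upwards [ha] with t hat
          rw [inner_smul_left, hat, mul_zero] }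
    have hW : W = ⊤ := by
      refine eq_top_of_isSolenoidalTest_mem hΩ hb hne hC
        (isClosed_of_closure_subset fun h hh => ?_) (fun h hh => ?_) fun φ hφ => ?_
      · obtain ⟨g, hg, hgl⟩ := mem_closure_iff_seq_limit.1 hh
        have h1 : ∀ᵐ t ∂(volume.restrict (Ioo 0 T)), ∀ n, inner ℝ (g n) (u t - v t : L2 Ω) = 0 :=
          ae_all_iff.2 hg
        change ∀ᵐ t ∂(volume.restrict (Ioo 0 T)), inner ℝ h (u t - v t : L2 Ω) = 0
        filter_upwards [h1] with t ht
        refine tendsto_nhds_unique (hgl.inner tendsto_const_nhds) ?_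
        simp_rw [ht]
        exact tendsto_const_nhds
      · change ∀ᵐ t ∂(volume.restrict (Ioo 0 T)), inner ℝ h (u t - v t : L2 Ω) = 0
        exact Eventually.of_forall fun t =>
          Submodule.inner_left_of_mem_orthogonal (Submodule.sub_mem _ (u t).2 (v t).2) hh
      · change ∀ᵐ t ∂(volume.restrict (Ioo 0 T)), inner ℝ _ (u t - v t : L2 Ω) = 0
        filter_upwards [hv.ae_integral_inner_eq hΩ hT hφ, ae_restrict_mem measurableSet_Ioo]
          with t ht htm
        rw [inner_sub_right, ← integral_inner_eq_inner_toLp, ← integral_inner_eq_inner_toLp, ht,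
          hueq φ hφ t (Ioo_subset_Icc_self htm), sub_self]
    have h1 := ae_eq_zero_of_forall_inner (𝕜 := ℝ) (μ := volume.restrict (Ioo 0 T))
      (f := fun t => (u t - v t : L2 Ω)) fun c => by
        have : c ∈ W := by rw [hW]; trivial
        exact this
    filter_upwards [h1] with t ht
    exact Subtype.ext (sub_eq_zero.1 ht)
  · refine hdet _ _ fun φ hφ => ?_
    rw [hueq φ hφ 0 ⟨le_rfl, hT.le⟩]
    simp
  · obtain ⟨W, hWc, hW⟩ := continuousOn_inner_of_bounded hunorm
    have hWt : W = ⊤ := by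
      refine eq_top_of_isSolenoidalTest_mem hΩ hb hne hC hWc (fun h hh => ?_) fun φ hφ => ?_
      · rw [hW]
        refine continuousOn_const (c := (0 : ℝ)) |>.congr fun t _ => ?_
        exact Submodule.inner_right_of_mem_orthogonal (u t).2 hh
      · rw [hW]
        refine ((continuousOn_const (c := ∫ x in Ω, inner ℝ (φ x) ((v₀ : L2 Ω) x))).add
          (hv.continuousOn_integral_quadForm hΩ hT hφ)).congr
          fun t ht => ?_
        rw [real_inner_comm, ← integral_inner_eq_inner_toLp]
        exact hueq φ hφ t ht
    intro h
    rw [← hW, hWt]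
    trivial

end

section

variable {Ω : Set Plane} {T : ℝ} {v₀ : H Ω} {v u : ℝ → H Ω}

/-! ### The equations tested with tangent fields -/

/-- The elements of `H(Ω)` with a representative which is bounded by `K` and Hölder continuous
near the boundary, with exponent `α` and constant `c`. -/
def HasRegularRep (Ω : Set Plane) (δ : ℝ) (α c : ℝ≥0) (K : ℝ) (f : H Ω) : Prop :=
  ∃ g : Plane → Plane, g =ᵐ[volume.restrict Ω] (f : L2 Ω) ∧ IsRegularNearBoundary Ω δ α c K g

theorem ae_hasRegularRep (hΩ : IsOpen Ω) (hb : Bornology.IsBounded Ω) (hne : Ω.Nonempty)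
    (hv : IsAdmissibleWeakSolution Ω T v₀ v) {δ : ℝ} (hδ : 0 < δ) {α : ℝ≥0}
    (hH : IsUniformlyHolderNearBoundary Ω T δ α v) :
    ∃ (c : ℝ≥0) (K : ℝ), 0 ≤ K ∧
      ∀ᵐ t ∂(volume.restrict (Ioo 0 T)), HasRegularRep Ω δ α c K (v t) := by
  obtain ⟨c, hc⟩ := hH
  obtain ⟨K, hK, h⟩ := exists_isRegularNearBoundary hΩ hb hne hδ c α (∫ x in Ω, ‖(v₀ : L2 Ω) x‖ ^ 2)
  refine ⟨c, K, hK, ?_⟩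
  filter_upwards [hc, hv.energy_le] with t ⟨f, hf, hfh⟩ ht
  exact h _ ht f hf hfh

/-- A tangent field is a limit of solenoidal test fields, weakly in `L²` and for the transport
terms of the fields which are Hölder continuous near the boundary. The third conclusion provides
a bound for these transport terms which is uniform in the field. -/
theorem IsTangentField.exists_approximation (hΩ : IsOpen Ω) (hb : Bornology.IsBounded Ω)
    (hne : Ω.Nonempty) (hC : HasCkBoundary 2 Ω) {w : Plane → Plane} {M : ℝ}
    (hw : IsTangentField Ω w M) :
    ∃ φ : ℕ → Plane → Plane, (∀ n, IsSolenoidalTest Ω (φ n)) ∧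
      (∀ f : L2 Ω, Tendsto (fun n => ∫ x in Ω, inner ℝ (φ n x) (f x)) atTop
        (𝓝 (∫ x in Ω, inner ℝ (w x) (f x)))) ∧
      (∀ (δ : ℝ) (α c : ℝ≥0) (K E : ℝ), 0 < δ → 0 ≤ K → ∃ B : ℝ, ∀ᶠ n in atTop, ∀ f : H Ω,
        HasRegularRep Ω δ α c K f → ‖f‖ ≤ E → |quadForm Ω (fderiv ℝ (φ n)) (f : L2 Ω)| ≤ B) ∧
      ∀ (δ : ℝ) (α c : ℝ≥0) (K : ℝ), 0 < δ → 0 < α → 0 ≤ K → ∀ f : H Ω,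
        HasRegularRep Ω δ α c K f →
        Tendsto (fun n => quadForm Ω (fderiv ℝ (φ n)) (f : L2 Ω)) atTop
          (𝓝 (quadForm Ω (fderiv ℝ w) (f : L2 Ω))) := by
  obtain ⟨ρ, hρ⟩ := exists_globalDefiningFunction hΩ hb hC
  obtain ⟨X, c, s, hX⟩ := hρ.exists_transversal hb hne
  obtain ⟨ε, κ, η, h⟩ := hX.exists_isDeformationSeq hρ hb hne
  obtain ⟨χ, C, hχ⟩ := hρ.exists_isCutoffSeq hb hX
  have hM : 0 ≤ M := by
    obtain ⟨x, hx⟩ := hne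
    exact (norm_nonneg _).trans (hw.norm_le x hx)
  refine ⟨fun n => piola (deform (ε n) X) (mollify (η n) (Ω.indicator w)), fun n =>
    h.isSolenoidalTest hΩ hb hne (hw.integrableOn hΩ hb) (hw.isWeaklySolenoidal hΩ hb hχ) n,
    fun f => h.tendsto_integral_inner hΩ hb hw hM f, fun δ α c K E hδ hK => ?_,
    fun δ α c K hδ hα hK f ⟨g, hg, hgr⟩ =>
      h.tendsto_quadratic hΩ hb hχ hw hM f.2 hg hgr hK hδ hα⟩
  obtain ⟨B, hB⟩ := h.exists_abs_quadratic_le (E := E ^ 2) (α := α) (c := c) hΩ hb hχ hw hM hK hδ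
  refine ⟨B, ?_⟩
  filter_upwards [hB] with n hn f ⟨g, hg, hgr⟩ hf
  refine hn f f.2 g hg hgr ?_
  rw [integral_norm_sq_eq]
  exact pow_le_pow_left₀ (norm_nonneg _) hf 2

theorem IsTangentField.memLp (hΩ : IsOpen Ω) (hb : Bornology.IsBounded Ω) {w : Plane → Plane}
    {M : ℝ} (hw : IsTangentField Ω w M) : MemLp w 2 (volume.restrict Ω) :=
  memLp_of_continuousOn_of_bound hΩ hb hw.contDiffOn.continuousOn hw.norm_le 2

/-- `H(Ω)` is weakly closed and contains the approximating test fields. -/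
theorem IsTangentField.toLp_mem_H (hΩ : IsOpen Ω) (hb : Bornology.IsBounded Ω)
    (hne : Ω.Nonempty) (hC : HasCkBoundary 2 Ω) {w : Plane → Plane} {M : ℝ}
    (hw : IsTangentField Ω w M) : (hw.memLp hΩ hb).toLp w ∈ H Ω := by
  obtain ⟨φ, hφ, hlim, -⟩ := hw.exists_approximation hΩ hb hne hC
  rw [H, Submodule.mem_orthogonal']
  intro g hg
  have h1 := hlim g
  rw [integral_inner_eq_inner_toLp (hw.memLp hΩ hb)] at h1
  refine tendsto_nhds_unique h1 (tendsto_const_nhds.congr fun n => ?_)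
  rw [integral_inner_eq_inner_toLp (hφ n).memLp]
  exact ((Submodule.mem_orthogonal' _ _).1 (hφ n).toLp_mem_H g hg).symm

theorem IsTangentField.aestronglyMeasurable_fderiv (hΩ : IsOpen Ω) {w : Plane → Plane}
    {M : ℝ} (hw : IsTangentField Ω w M) : AEStronglyMeasurable (fderiv ℝ w) (volume.restrict Ω) :=
  (hw.contDiffOn.continuousOn_fderiv_of_isOpen hΩ le_rfl).aestronglyMeasurable hΩ.measurableSet

/-- The weak formulation, integrated in time, holds for tangent fields which need not vanish near
the boundary. The limit is taken in the equations for the approximating test fields, by dominated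
convergence in time. -/
theorem IsRepresentative.integral_inner_tangent (hu : IsRepresentative Ω T v₀ v u)
    (hv : IsAdmissibleWeakSolution Ω T v₀ v) (hΩ : IsOpen Ω) (hb : Bornology.IsBounded Ω)
    (hne : Ω.Nonempty) (hC : HasCkBoundary 2 Ω) {δ K : ℝ} {α c : ℝ≥0} (hδ : 0 < δ) (hα : 0 < α)
    (hK : 0 ≤ K) (hreg : ∀ᵐ t ∂(volume.restrict (Ioo 0 T)), HasRegularRep Ω δ α c K (v t))
    {w : Plane → Plane} {M : ℝ} (hw : IsTangentField Ω w M) {t : ℝ} (ht : t ∈ Icc 0 T) :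
    ∫ x in Ω, inner ℝ (w x) ((u t : L2 Ω) x) = (∫ x in Ω, inner ℝ (w x) ((v₀ : L2 Ω) x))
      + ∫ s in (0 : ℝ)..t, quadForm Ω (fderiv ℝ w) (v s : L2 Ω) := by
  obtain ⟨φ, hφ, hlim, hbd, hquad⟩ := hw.exists_approximation hΩ hb hne hC
  obtain ⟨B, hB⟩ := hbd δ α c K ‖v₀‖ hδ hK
  have hsub : Ioc 0 t ⊆ Ioc 0 T := Ioc_subset_Ioc_right ht.2
  have hIoc : ∀ {p : ℝ → Prop}, (∀ᵐ s ∂(volume.restrict (Ioo 0 T)), p s) →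
      ∀ᵐ s, s ∈ uIoc 0 t → p s := by
    intro p hp
    rw [restrict_Ioo_eq_restrict_Ioc, ae_restrict_iff' measurableSet_Ioc] at hp
    filter_upwards [hp] with s hs hst
    rw [uIoc_of_le ht.1] at hst
    exact hs (hsub hst)
  refine tendsto_nhds_unique (hlim (u t : L2 Ω)) ?_
  simp_rw [fun n => hu.integral_inner_eq (φ n) (hφ n) t ht]
  refine (hlim (v₀ : L2 Ω)).add ?_
  refine intervalIntegral.tendsto_integral_filter_of_dominated_convergence (fun _ => B)
    (Eventually.of_forall fun n => ?_) ?_ intervalIntegrable_const ?_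
  · obtain ⟨b, hb'⟩ := (hφ n).exists_norm_fderiv_le
    have h1 := hv.integrableOn_quadForm hΩ
      ((hφ n).contDiff.continuous_fderiv (by simp)).aestronglyMeasurable fun x _ => hb' x
    rw [uIoc_of_le ht.1]
    rw [IntegrableOn, restrict_Ioo_eq_restrict_Ioc] at h1
    exact (IntegrableOn.mono_set h1 hsub).aestronglyMeasurable
  · filter_upwards [hB] with n hn
    filter_upwards [hIoc hreg, hIoc hv.ae_norm_le] with s h1 h2 hs
    exact hn (v s) (h1 hs) (h2 hs)
  · filter_upwards [hIoc hreg] with s h1 hs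
    exact hquad δ α c K hδ hα hK (v s) (h1 hs)

end

section

/-! ### Regularity of comparison fields up to the boundary -/

/-- A `C¹` function on a set in which an open set is dense has a continuous derivative, also
where the derivative within the set is not unique a priori: it is the continuous extension of the
derivative in the open set. -/
theorem exists_continuousOn_hasFDerivWithinAt {E F : Type*} [NormedAddCommGroup E]
    [NormedSpace ℝ E] [NormedAddCommGroup F] [NormedSpace ℝ F] {f : E → F} {Q A : Set E}
    (hf : ContDiffOn ℝ 1 f Q) (hA : IsOpen A) (hAQ : A ⊆ Q) (hQA : Q ⊆ closure A) :
    ∃ D : E → E →L[ℝ] F, ContinuousOn D Q ∧ ∀ z ∈ Q, HasFDerivWithinAt f (D z) Q z := by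
  have key : ∀ z ∈ Q, ∃ f' : E →L[ℝ] F, Tendsto (fderiv ℝ f) (𝓝[A] z) (𝓝 f') ∧
      HasFDerivWithinAt f f' Q z := by
    intro z hz
    have h1 : ContDiffWithinAt ℝ (0 + 1) f Q z := by simpa using hf z hz
    obtain ⟨U, hU, -, f', hf', hc⟩ :=
      (contDiffWithinAt_succ_iff_hasFDerivWithinAt (by simp)).1 h1
    rw [insert_eq_of_mem hz] at hU
    have hzU : z ∈ U := mem_of_mem_nhdsWithin hz hU
    refine ⟨f' z, ?_, (hf' z hzU).mono_of_mem_nhdsWithin hU⟩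
    have hAU : U ∈ 𝓝[A] z := nhdsWithin_mono z hAQ hU
    have h2 : Tendsto f' (𝓝[A] z) (𝓝 (f' z)) :=
      hc.continuousWithinAt.tendsto.mono_left (le_inf inf_le_left (le_principal_iff.2 hAU))
    refine h2.congr' ?_
    obtain ⟨O, hO, hzO, hOU⟩ := mem_nhdsWithin.1 hAU
    filter_upwards [self_mem_nhdsWithin, mem_nhdsWithin_of_mem_nhds (hO.mem_nhds hzO)]
      with y hyA hyO
    exact (((hf' y (hOU ⟨hyO, hyA⟩)).hasFDerivAt
      (mem_of_superset ((hO.inter hA).mem_nhds ⟨hyO, hyA⟩) hOU)).fderiv).symm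
  refine ⟨extendFrom A (fderiv ℝ f), continuousOn_extendFrom hQA fun z hz => ?_, fun z hz => ?_⟩
  · obtain ⟨f', h1, -⟩ := key z hz
    exact ⟨f', h1⟩
  · obtain ⟨f', h1, h2⟩ := key z hz
    rwa [extendFrom_eq (hQA hz) h1]

variable {Ω : Set Plane} {T : ℝ}

/-- The data of a comparison field: the gradient `G` and the time derivative `g` of `w`, which
are continuous up to the boundary, and a bound `M` which does not depend on the time. The values of
`G` and `g` on `∂Ω` are part of the data, since the derivatives of `w` need not be unique there. -/
structure IsRegularComparison (Ω : Set Plane) (T : ℝ) (w g : ℝ → Plane → Plane)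
    (G : ℝ → Plane → Plane →L[ℝ] Plane) (M : ℝ) : Prop where
  continuousOn : ContinuousOn (fun z : ℝ × Plane => w z.1 z.2) (Icc 0 T ×ˢ closure Ω)
  continuousOn_deriv : ContinuousOn (fun z : ℝ × Plane => g z.1 z.2) (Icc 0 T ×ˢ closure Ω)
  continuousOn_grad : ContinuousOn (fun z : ℝ × Plane => G z.1 z.2) (Icc 0 T ×ˢ closure Ω)
  hasDerivWithinAt : ∀ t ∈ Icc 0 T, ∀ x ∈ Ω,
    HasDerivWithinAt (fun s => w s x) (g t x) (Icc 0 T) t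
  fderiv_eq : ∀ t ∈ Icc 0 T, ∀ x ∈ Ω, fderiv ℝ (w t) x = G t x
  isTangentField : ∀ t ∈ Icc 0 T, IsTangentField Ω (w t) M

theorem IsComparisonField.exists_isRegularComparison {w : ℝ → Plane → Plane}
    (hw : IsComparisonField Ω T w) (hΩ : IsOpen Ω) (hb : Bornology.IsBounded Ω) (hT : 0 < T) :
    ∃ g G M, IsRegularComparison Ω T w g G M := by
  set Q := Icc 0 T ×ˢ closure Ω with hQ
  have hQc : IsCompact Q := isCompact_Icc.prod hb.isCompact_closure
  obtain ⟨D, hDc, hD⟩ := exists_continuousOn_hasFDerivWithinAt (A := Ioo 0 T ×ˢ Ω) hw.contDiffOn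
    (isOpen_Ioo.prod hΩ) (prod_mono Ioo_subset_Icc_self subset_closure)
    (by rw [closure_prod_eq, closure_Ioo hT.ne])
  set g : ℝ → Plane → Plane := fun t x => D (t, x) (1, 0)
  set G : ℝ → Plane → Plane →L[ℝ] Plane := fun t x =>
    (D (t, x)).comp (ContinuousLinearMap.inr ℝ ℝ Plane)
  have hGc : ContinuousOn (fun z : ℝ × Plane => G z.1 z.2) Q := hDc.clm_comp continuousOn_const
  have hgc : ContinuousOn (fun z : ℝ × Plane => g z.1 z.2) Q := hDc.clm_apply continuousOn_const
  obtain ⟨M₁, hM₁⟩ := hQc.exists_bound_of_continuousOn hw.contDiffOn.continuousOn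
  obtain ⟨M₂, hM₂⟩ := hQc.exists_bound_of_continuousOn hGc
  have hfd : ∀ t ∈ Icc 0 T, ∀ x ∈ Ω, HasFDerivAt (w t) (G t x) x := by
    intro t ht x hx
    have h1 : HasFDerivAt (fun y : Plane => (t, y)) (ContinuousLinearMap.inr ℝ ℝ Plane) x :=
      hasFDerivAt_prodMk_right t x
    have h2 : MapsTo (fun y : Plane => (t, y)) Ω Q := fun y hy => ⟨ht, subset_closure hy⟩
    exact (HasFDerivWithinAt.comp x (hD (t, x) ⟨ht, subset_closure hx⟩)
      (h1.hasFDerivWithinAt (s := Ω)) h2).hasFDerivAt (hΩ.mem_nhds hx)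
  refine ⟨g, G, max M₁ M₂, hw.contDiffOn.continuousOn, hgc, hGc, fun t ht x hx => ?_,
    fun t ht x hx => (hfd t ht x hx).fderiv, fun t ht => ?_⟩
  · have h1 : HasDerivWithinAt (fun s : ℝ => (s, x)) (1, 0) (Icc 0 T) t :=
      (hasDerivWithinAt_id t _).prodMk (hasDerivWithinAt_const t _ x)
    have h2 : MapsTo (fun s : ℝ => (s, x)) (Icc 0 T) Q := fun s hs => ⟨hs, subset_closure hx⟩
    exact (hD (t, x) ⟨ht, subset_closure hx⟩).comp_hasDerivWithinAt t h1 h2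
  · have hmaps : MapsTo (fun y : Plane => (t, y)) (closure Ω) Q := fun y hy => ⟨ht, hy⟩
    exact
      { contDiffOn := hw.contDiffOn.comp (contDiff_prodMk_right t).contDiffOn
          (hmaps.mono_left subset_closure)
        continuousOn := hw.contDiffOn.continuousOn.comp
          (Continuous.prodMk_right t).continuousOn hmaps
        norm_le := fun x hx => (hM₁ _ (hmaps (subset_closure hx))).trans (le_max_left _ _)
        norm_fderiv_le := fun x hx => by
          rw [(hfd t ht x hx).fderiv]
          exact (hM₂ _ (hmaps (subset_closure hx))).trans (le_max_right _ _)
        divergence_eq_zero := hw.divergence_eq_zero t ht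
        tangent := hw.tangent t ht }

/-- The uniform modulus of continuity in time of a function on `[0, T] × closure Ω`. -/
theorem exists_forall_dist_lt {F : Type*} [PseudoMetricSpace F] {f : ℝ → Plane → F}
    (hb : Bornology.IsBounded Ω)
    (hf : ContinuousOn (fun z : ℝ × Plane => f z.1 z.2) (Icc 0 T ×ˢ closure Ω)) {e : ℝ}
    (he : 0 < e) : ∃ d > 0, ∀ t ∈ Icc 0 T, ∀ s ∈ Icc 0 T, dist t s < d → ∀ x ∈ Ω,
      dist (f t x) (f s x) < e := by
  have h1 := (isCompact_Icc.prod hb.isCompact_closure).uniformContinuousOn_of_continuous hf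
  obtain ⟨d, hd, h2⟩ := Metric.uniformContinuousOn_iff.1 h1 e he
  refine ⟨d, hd, fun t ht s hs hts x hx => ?_⟩
  refine h2 (t, x) ⟨ht, subset_closure hx⟩ (s, x) ⟨hs, subset_closure hx⟩ ?_
  rw [Prod.dist_eq]
  simpa [hd] using hts

/-- A bounded field has a small `L²` norm if its supremum is small. -/
theorem norm_le_of_forall_norm_le (hΩ : IsOpen Ω) {f : L2 Ω} {g : Plane → Plane}
    (hfg : f =ᵐ[volume.restrict Ω] g) {e : ℝ} (he : 0 ≤ e) (hg : ∀ x ∈ Ω, ‖g x‖ ≤ e)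
    (hb : Bornology.IsBounded Ω) : ‖f‖ ≤ √(volume.real Ω) * e := by
  have := isFiniteMeasure_restrict_of_isBounded hb
  have h1 : ∀ᵐ x ∂(volume.restrict Ω), ‖f x‖ ≤ e := by
    filter_upwards [hfg, ae_restrict_mem hΩ.measurableSet] with x hx hxΩ
    rw [hx]
    exact hg x hxΩ
  have h2 := Lp.norm_le_of_ae_bound he h1
  refine h2.trans (le_of_eq ?_)
  rw [Real.sqrt_eq_rpow]
  simp [measureUnivNNReal, Measure.real, ENNReal.coe_toNNReal_eq_toReal]

end

/-! ### Time-dependent test functions and Grönwall's inequality -/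

section Abstract

variable {V : Type*} [NormedAddCommGroup V] [InnerProductSpace ℝ V] {T B : ℝ}

/-- The primitive of `f` has the derivative `c` at `t` if `f`, up to a null set, tends to `c`
at `t`. -/
theorem hasDerivWithinAt_integral_of_ae {f : ℝ → ℝ} {t c : ℝ} (hf : IntegrableOn f (Ioo 0 T))
    (ht : t ∈ Icc 0 T)
    (h : ∀ e > 0, ∃ d > 0, ∀ᵐ τ, τ ∈ Ioo 0 T → dist τ t < d → |f τ - c| ≤ e) :
    HasDerivWithinAt (fun s => ∫ τ in (0 : ℝ)..s, f τ) c (Icc 0 T) t := by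
  have hT : 0 ≤ T := ht.1.trans ht.2
  have hfi : ∀ s ∈ Icc 0 T, ∀ t ∈ Icc 0 T, IntervalIntegrable f volume s t := by
    intro s hs t ht
    have h1 : IntervalIntegrable f volume 0 T :=
      (intervalIntegrable_iff_integrableOn_Ioo_of_le hT).2 hf
    exact h1.mono_set (by rw [uIcc_of_le hT]; exact uIcc_subset_Icc hs ht)
  have h0 : (0 : ℝ) ∈ Icc 0 T := ⟨le_rfl, hT⟩
  rw [hasDerivWithinAt_iff_isLittleO, Asymptotics.isLittleO_iff]
  intro e he
  obtain ⟨d, hd, hm⟩ := h e he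
  filter_upwards [self_mem_nhdsWithin, mem_nhdsWithin_of_mem_nhds (ball_mem_nhds t hd)]
    with s hs hst
  have h1 : (∫ τ in (0 : ℝ)..s, f τ) - (∫ τ in (0 : ℝ)..t, f τ) - (s - t) • c
      = ∫ τ in t..s, (f τ - c) := by
    rw [intervalIntegral.integral_sub (hfi t ht s hs) intervalIntegrable_const,
      intervalIntegral.integral_const,
      intervalIntegral.integral_interval_sub_left (hfi 0 h0 s hs) (hfi 0 h0 t ht)]
  rw [h1, Real.norm_eq_abs (s - t)]
  refine intervalIntegral.norm_integral_le_of_norm_le_const_ae ?_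
  have hne : ∀ a : ℝ, ∀ᵐ τ : ℝ, τ ≠ a := fun a => by simp [ae_iff]
  filter_upwards [hm, hne 0, hne T] with τ hτ hτ0 hτT hmem
  have hI : τ ∈ Icc 0 T := uIcc_subset_Icc ht hs (uIoc_subset_uIcc hmem)
  refine hτ ⟨lt_of_le_of_ne hI.1 hτ0.symm, lt_of_le_of_ne hI.2 hτT⟩ (lt_of_le_of_lt ?_ hst)
  rw [Real.dist_eq, Real.dist_eq]
  exact abs_sub_left_of_mem_uIcc (uIoc_subset_uIcc hmem)

/-- Inner products pass to the limit if one factor converges weakly and remains bounded, and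
the other factor converges in norm. -/
theorem tendsto_inner_of_weak {ι : Type*} {l : Filter ι} {a b : ι → V} {a₀ b₀ : V}
    (ha : ∀ h : V, Tendsto (fun i => inner ℝ (a i) h) l (𝓝 (inner ℝ a₀ h)))
    (haB : ∀ᶠ i in l, ‖a i‖ ≤ B) (hb : Tendsto b l (𝓝 b₀)) :
    Tendsto (fun i => inner ℝ (a i) (b i)) l (𝓝 (inner ℝ a₀ b₀)) := by
  have h1 : Tendsto (fun i => inner ℝ (a i) (b i - b₀)) l (𝓝 0) := by
    have h2 : Tendsto (fun i => B * ‖b i - b₀‖) l (𝓝 0) := by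
      simpa using (hb.sub_const b₀).norm.const_mul B
    refine squeeze_zero_norm' ?_ h2
    filter_upwards [haB] with i hi
    exact (norm_inner_le_norm _ _).trans (mul_le_mul_of_nonneg_right hi (norm_nonneg _))
  refine ((ha b₀).add h1).congr' (Eventually.of_forall fun i => ?_) |>.trans (by simp)
  rw [← inner_add_right]
  congr 1
  abel

theorem integrableOn_inner_clm_path {v : ℝ → V} {L : ℝ → V →L[ℝ] V} {I : Set ℝ}
    (hI : MeasurableSet I) (hIf : volume I ≠ ⊤) {C : ℝ} (hL : ContinuousOn L I)
    (hLC : ∀ t ∈ I, ‖L t‖ ≤ C) (hv : AEStronglyMeasurable v (volume.restrict I))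
    (hvB : ∀ᵐ t ∂(volume.restrict I), ‖v t‖ ≤ B) :
    IntegrableOn (fun t => inner ℝ (L t (v t)) (v t)) I := by
  have : IsFiniteMeasure (volume.restrict I) := ⟨by simpa using hIf.lt_top⟩
  have hm : AEStronglyMeasurable (fun t => L t (v t)) (volume.restrict I) :=
    (ContinuousLinearMap.id ℝ (V →L[ℝ] V)).aestronglyMeasurable_comp₂
      (hL.aestronglyMeasurable hI) hv
  refine Integrable.of_bound (hm.inner hv) (C * B * B) ?_
  filter_upwards [hvB, ae_restrict_mem hI] with t ht htI
  have hB : 0 ≤ B := (norm_nonneg _).trans ht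
  have hC : 0 ≤ C := (norm_nonneg _).trans (hLC t htI)
  refine (norm_inner_le_norm _ _).trans (mul_le_mul ?_ ht (norm_nonneg _) (by positivity))
  exact ((L t).le_opNorm _).trans (mul_le_mul (hLC t htI) ht (norm_nonneg _) hC)

/-- If the equation for `u` holds, integrated in time, with each of the test functions `w s`
frozen at the time `s`, then it holds with the time-dependent test function `w`. The difference of
the two sides has a vanishing derivative at each time `t`, as one sees by freezing at `t`. The path
`v`, which agrees with `u` almost everywhere in the application, need not be weakly continuous. -/
theorem inner_eq_add_integral_of_frozen {u v w g : ℝ → V} {L : ℝ → V →L[ℝ] V}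
    (hu : ∀ h : V, ContinuousOn (fun t => inner ℝ (u t) h) (Icc 0 T))
    (huB : ∀ t ∈ Icc 0 T, ‖u t‖ ≤ B)
    (hw : ∀ t ∈ Icc 0 T, HasDerivWithinAt w (g t) (Icc 0 T) t) (hg : ContinuousOn g (Icc 0 T))
    (hL : ContinuousOn L (Icc 0 T)) (hv : AEStronglyMeasurable v (volume.restrict (Ioo 0 T)))
    (hvB : ∀ᵐ t ∂(volume.restrict (Ioo 0 T)), ‖v t‖ ≤ B)
    (h : ∀ s ∈ Icc 0 T, ∀ t ∈ Icc 0 T,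
      inner ℝ (u t) (w s) = inner ℝ (u 0) (w s) + ∫ τ in (0 : ℝ)..t, inner ℝ (L s (v τ)) (v τ))
    {t : ℝ} (ht : t ∈ Icc 0 T) :
    inner ℝ (u t) (w t) = inner ℝ (u 0) (w 0)
      + ∫ τ in (0 : ℝ)..t, (inner ℝ (u τ) (g τ) + inner ℝ (L τ (v τ)) (v τ)) := by
  have hT : 0 ≤ T := ht.1.trans ht.2
  have hB : 0 ≤ B := (norm_nonneg _).trans (huB t ht)
  have h0 : (0 : ℝ) ∈ Icc 0 T := ⟨le_rfl, hT⟩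
  obtain ⟨C, hC⟩ := isCompact_Icc.exists_bound_of_continuousOn hL
  have hLi : ∀ s ∈ Icc 0 T, IntegrableOn (fun τ => inner ℝ (L s (v τ)) (v τ)) (Ioo 0 T) :=
    fun s hs => integrableOn_inner_clm_path measurableSet_Ioo (by simp) (C := C)
      continuousOn_const (fun _ _ => hC s hs) hv hvB
  have hLt : IntegrableOn (fun τ => inner ℝ (L τ (v τ)) (v τ)) (Ioo 0 T) :=
    integrableOn_inner_clm_path measurableSet_Ioo (by simp) (C := C)
      (hL.mono Ioo_subset_Icc_self) (fun s hs => hC s (Ioo_subset_Icc_self hs)) hv hvB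
  have hug : ContinuousOn (fun t => inner ℝ (u t) (g t)) (Icc 0 T) := fun t ht =>
    tendsto_inner_of_weak (B := B) (fun h => hu h t ht)
      (by filter_upwards [self_mem_nhdsWithin] with s hs using huB s hs) (hg t ht)
  have hugi : IntegrableOn (fun t => inner ℝ (u t) (g t)) (Ioo 0 T) :=
    hug.integrableOn_Icc.mono_set Ioo_subset_Icc_self
  have hii : ∀ {f : ℝ → ℝ}, IntegrableOn f (Ioo 0 T) → ∀ t ∈ Icc 0 T,
      IntervalIntegrable f volume 0 t := by
    intro f hf t ht
    have h1 : IntervalIntegrable f volume 0 T :=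
      (intervalIntegrable_iff_integrableOn_Ioo_of_le hT).2 hf
    exact h1.mono_set (by rw [uIcc_of_le hT]; exact uIcc_subset_Icc h0 ht)
  set m : ℝ → ℝ := fun t => inner ℝ (u t) (w t)
    - ((∫ τ in (0 : ℝ)..t, inner ℝ (u τ) (g τ)) + ∫ τ in (0 : ℝ)..t, inner ℝ (L τ (v τ)) (v τ))
    with hm
  have hderiv : ∀ t ∈ Icc 0 T, HasDerivWithinAt m 0 (Icc 0 T) t := by
    intro t ht
    -- the derivative of the test function at the time `t`
    have d1 : HasDerivWithinAt (fun s => inner ℝ (u s) (w s - w t)) (inner ℝ (u t) (g t))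
        (Icc 0 T) t := by
      rw [hasDerivWithinAt_iff_tendsto_slope]
      have hsub : 𝓝[Icc 0 T \ {t}] t ≤ 𝓝[Icc 0 T] t := nhdsWithin_mono t sdiff_subset
      have h1 := tendsto_inner_of_weak (B := B) (fun h => (hu h t ht).tendsto.mono_left hsub)
        (by filter_upwards [self_mem_nhdsWithin] with s hs using huB s hs.1)
        (hasDerivWithinAt_iff_tendsto_slope.1 (hw t ht))
      refine h1.congr fun s => ?_
      rw [slope_def_module, slope_def_field, inner_smul_right, sub_self, inner_zero_right,
        sub_zero, div_eq_inv_mul]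
    have d2 : HasDerivWithinAt (fun s => ∫ τ in (0 : ℝ)..s, inner ℝ (u τ) (g τ))
        (inner ℝ (u t) (g t)) (Icc 0 T) t := by
      refine hasDerivWithinAt_integral_of_ae hugi ht fun e he => ?_
      obtain ⟨d, hd, h1⟩ := Metric.continuousWithinAt_iff.1 (hug t ht) e he
      exact ⟨d, hd, Eventually.of_forall fun τ hτ hτt =>
        (h1 (Ioo_subset_Icc_self hτ) hτt).le⟩
    -- the error made by freezing the test function at the time `t`
    have d3 : HasDerivWithinAt (fun s => ∫ τ in (0 : ℝ)..s,
        (inner ℝ (L t (v τ)) (v τ) - inner ℝ (L τ (v τ)) (v τ))) 0 (Icc 0 T) t := by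
      refine hasDerivWithinAt_integral_of_ae ((hLi t ht).sub hLt) ht fun e he => ?_
      obtain ⟨d, hd, h1⟩ := Metric.continuousWithinAt_iff.1 (hL t ht) (e / (B ^ 2 + 1))
        (by positivity)
      refine ⟨d, hd, ?_⟩
      rw [ae_restrict_iff' measurableSet_Ioo] at hvB
      filter_upwards [hvB] with τ hτB hτ hτt
      have h2 := h1 (Ioo_subset_Icc_self hτ) hτt
      rw [dist_eq_norm, lt_div_iff₀ (by positivity)] at h2
      rw [sub_zero, ← inner_sub_left, ← _root_.sub_apply]
      have h3 := hτB hτ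
      calc |inner ℝ ((L t - L τ) (v τ)) (v τ)| ≤ ‖(L t - L τ) (v τ)‖ * ‖v τ‖ :=
            abs_real_inner_le_norm _ _
        _ ≤ (‖L τ - L t‖ * B) * B := by
            rw [norm_sub_rev (L τ)]
            refine mul_le_mul ?_ h3 (norm_nonneg _) (by positivity)
            exact ((L t - L τ).le_opNorm _).trans (mul_le_mul_of_nonneg_left h3 (norm_nonneg _))
        _ ≤ e := by nlinarith [norm_nonneg (L τ - L t)]
    have hsum := (d1.sub d2).add d3
    rw [sub_self, add_zero] at hsum
    have heq : ∀ s ∈ Icc 0 T, m s = (inner ℝ (u s) (w s - w t)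
        - ∫ τ in (0 : ℝ)..s, inner ℝ (u τ) (g τ))
        + (∫ τ in (0 : ℝ)..s, (inner ℝ (L t (v τ)) (v τ) - inner ℝ (L τ (v τ)) (v τ)))
        + inner ℝ (u 0) (w t) := by
      intro s hs
      rw [intervalIntegral.integral_sub (hii (hLi t ht) s hs) (hii hLt s hs), inner_sub_right,
        h t ht s hs]
      simp only [hm]
      ring
    exact (hsum.add_const (inner ℝ (u 0) (w t))).congr heq (heq t ht)
  have hconst : m t = m 0 := constant_of_derivWithin_zero
    (fun s hs => (hderiv s hs).differentiableWithinAt)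
    (fun s hs => (hderiv s (Ico_subset_Icc_self hs)).derivWithin
      (uniqueDiffOn_Icc (hs.1.trans_lt hs.2) s (Ico_subset_Icc_self hs))) t ht
  simp only [hm, intervalIntegral.integral_same, add_zero, sub_zero] at hconst
  rw [intervalIntegral.integral_add (hii hugi t ht) (hii hLt t ht)]
  linarith

/-- Grönwall's inequality in integrated form. If `Q` denotes the right-hand side of the assumption,
then `exp (-2 ∫ a) Q - 2 ∫ exp (-2 ∫ a) h` is nonincreasing in time, since `R ≤ Q` and `a ≥ 0`. -/
theorem le_exp_mul_add_integral_of_le {R a h : ℝ → ℝ} (hR : ContinuousOn R (Icc 0 T))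
    (ha : ContinuousOn a (Icc 0 T)) (hh : ContinuousOn h (Icc 0 T)) (ha0 : ∀ t ∈ Icc 0 T, 0 ≤ a t)
    {R₀ : ℝ} (hle : ∀ t ∈ Icc 0 T, R t ≤ R₀ + ∫ s in (0 : ℝ)..t, (2 * a s * R s + 2 * h s))
    {t : ℝ} (ht : t ∈ Icc 0 T) :
    R t ≤ Real.exp (2 * ∫ s in (0 : ℝ)..t, a s) * R₀
      + 2 * ∫ s in (0 : ℝ)..t, Real.exp (2 * ∫ τ in s..t, a τ) * h s := by
  have hprim : ∀ {f : ℝ → ℝ}, ContinuousOn f (Icc 0 T) →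
      ContinuousOn (fun t => ∫ s in (0 : ℝ)..t, f s) (Icc 0 T) ∧
      (∀ t ∈ Ioo 0 T, HasDerivAt (fun t => ∫ s in (0 : ℝ)..t, f s) (f t) t) ∧
      ∀ s ∈ Icc 0 T, ∀ t ∈ Icc 0 T, IntervalIntegrable f volume s t := by
    intro f hf
    have hT : 0 ≤ T := ht.1.trans ht.2
    have hfi : ∀ s ∈ Icc 0 T, ∀ t ∈ Icc 0 T, IntervalIntegrable f volume s t := by
      intro s hs t ht
      exact (hf.mono (uIcc_subset_Icc hs ht)).intervalIntegrable
    refine ⟨?_, fun t ht => ?_, hfi⟩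
    · have := intervalIntegral.continuousOn_primitive_interval (a := 0) (b := T) (μ := volume)
        (f := f) (by rw [uIcc_of_le hT]; exact hf.integrableOn_Icc)
      rwa [uIcc_of_le hT] at this
    · refine intervalIntegral.integral_hasDerivAt_right
        (hfi 0 ⟨le_rfl, hT⟩ t (Ioo_subset_Icc_self ht)) ?_
        (hf.continuousAt (Icc_mem_nhds ht.1 ht.2))
      exact (hf.mono Ioo_subset_Icc_self).stronglyMeasurableAtFilter isOpen_Ioo t ht
  have hT : 0 ≤ T := ht.1.trans ht.2
  set A : ℝ → ℝ := fun t => ∫ s in (0 : ℝ)..t, a s with hA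
  obtain ⟨hAc, hAd, hAi⟩ := hprim ha
  have hFc : ContinuousOn (fun s => 2 * a s * R s + 2 * h s) (Icc 0 T) :=
    ((continuousOn_const.mul ha).mul hR).add (continuousOn_const.mul hh)
  obtain ⟨hQc, hQd, -⟩ := hprim hFc
  have hEc : ContinuousOn (fun s => Real.exp (-(2 * A s)) * h s) (Icc 0 T) :=
    (Real.continuous_exp.comp_continuousOn (continuousOn_const.mul hAc).neg).mul hh
  obtain ⟨hEc', hEd, -⟩ := hprim hEc
  set Q : ℝ → ℝ := fun t => R₀ + ∫ s in (0 : ℝ)..t, (2 * a s * R s + 2 * h s) with hQ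
  set Ψ : ℝ → ℝ := fun t => Real.exp (-(2 * A t)) * Q t
    - 2 * ∫ s in (0 : ℝ)..t, Real.exp (-(2 * A s)) * h s with hΨ
  have hΨc : ContinuousOn Ψ (Icc 0 T) :=
    ((Real.continuous_exp.comp_continuousOn (continuousOn_const.mul hAc).neg).mul
      (continuousOn_const.add hQc)).sub (continuousOn_const.mul hEc')
  have hanti : AntitoneOn Ψ (Icc 0 T) := by
    refine antitoneOn_of_hasDerivWithinAt_nonpos (convex_Icc 0 T) hΨc
      (f' := fun t => Real.exp (-(2 * A t)) * (2 * a t * (R t - Q t))) (fun t ht => ?_)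
      fun t ht => ?_
    · rw [interior_Icc] at ht
      refine HasDerivAt.hasDerivWithinAt ?_
      have h1 : HasDerivAt Ψ (Real.exp (-(2 * A t)) * -(2 * a t) * Q t
          + Real.exp (-(2 * A t)) * (2 * a t * R t + 2 * h t)
          - 2 * (Real.exp (-(2 * A t)) * h t)) t :=
        ((((hAd t ht).const_mul 2).fun_neg.exp).mul ((hQd t ht).const_add R₀)).sub
          ((hEd t ht).const_mul 2)
      exact h1.congr_deriv (by ring)
    · rw [interior_Icc] at ht
      have ht' := Ioo_subset_Icc_self ht
      refine mul_nonpos_of_nonneg_of_nonpos (Real.exp_pos _).le ?_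
      exact mul_nonpos_of_nonneg_of_nonpos (by linarith [ha0 t ht']) (by linarith [hle t ht'])
  have h0 : Ψ 0 = R₀ := by simp [hΨ, hA, hQ]
  have h1 : Ψ t ≤ R₀ := h0 ▸ hanti ⟨le_rfl, hT⟩ ht ht.1
  have h2 : R t ≤ Q t := hle t ht
  have h3 : Q t = Real.exp (2 * A t) * (Ψ t
      + 2 * ∫ s in (0 : ℝ)..t, Real.exp (-(2 * A s)) * h s) := by
    simp only [hΨ]
    rw [sub_add_cancel, ← mul_assoc, ← Real.exp_add, add_neg_cancel, Real.exp_zero, one_mul]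
  have h4 : Real.exp (2 * A t) * (2 * ∫ s in (0 : ℝ)..t, Real.exp (-(2 * A s)) * h s)
      = 2 * ∫ s in (0 : ℝ)..t, Real.exp (2 * ∫ τ in s..t, a τ) * h s := by
    rw [mul_left_comm, ← intervalIntegral.integral_const_mul]
    congr 1
    refine intervalIntegral.integral_congr fun s hs => ?_
    rw [uIcc_of_le ht.1] at hs
    have hs' : s ∈ Icc 0 T := ⟨hs.1, hs.2.trans ht.2⟩
    have e1 : ∫ τ in s..t, a τ = A t - A s := by
      simp only [hA]
      rw [← intervalIntegral.integral_add_adjacent_intervals (hAi 0 ⟨le_rfl, hT⟩ s hs')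
        (hAi s hs' t ht)]
      ring
    rw [e1, ← mul_assoc, ← Real.exp_add]
    congr 2
    ring
  calc R t ≤ Q t := h2
    _ = Real.exp (2 * A t) * Ψ t
        + Real.exp (2 * A t) * (2 * ∫ s in (0 : ℝ)..t, Real.exp (-(2 * A s)) * h s) := by
      rw [h3, mul_add]
    _ ≤ _ := by
      rw [h4]
      exact add_le_add_left (mul_le_mul_of_nonneg_left h1 (Real.exp_pos _).le) _

end Abstract

section

variable {Ω : Set Plane} {T : ℝ}

/-! ### Comparison fields as paths in `L²` -/

theorem continuousOn_slice {F : Type*} [TopologicalSpace F] {f : ℝ → Plane → F}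
    (hf : ContinuousOn (fun z : ℝ × Plane => f z.1 z.2) (Icc 0 T ×ˢ closure Ω)) {t : ℝ}
    (ht : t ∈ Icc 0 T) : ContinuousOn (f t) (closure Ω) := by
  have h1 : MapsTo (fun y : Plane => (t, y)) (closure Ω) (Icc 0 T ×ˢ closure Ω) :=
    fun y hy => ⟨ht, hy⟩
  exact hf.comp (Continuous.prodMk_right t).continuousOn h1

theorem exists_forall_norm_sub_le (hb : Bornology.IsBounded Ω)
    {F : Type*} [SeminormedAddCommGroup F] {f : ℝ → Plane → F}
    (hf : ContinuousOn (fun z : ℝ × Plane => f z.1 z.2) (Icc 0 T ×ˢ closure Ω)) {e : ℝ}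
    (he : 0 < e) {t : ℝ} (ht : t ∈ Icc 0 T) :
    ∀ᶠ s in 𝓝[Icc 0 T] t, s ∈ Icc 0 T ∧ ∀ r ∈ uIcc t s, ∀ x ∈ Ω, ‖f r x - f t x‖ ≤ e := by
  obtain ⟨d, hd, h⟩ := exists_forall_dist_lt hb hf he
  filter_upwards [self_mem_nhdsWithin, mem_nhdsWithin_of_mem_nhds (ball_mem_nhds t hd)]
    with s hs hst
  refine ⟨hs, fun r hr x hx => ?_⟩
  rw [← dist_eq_norm]
  refine (h r (uIcc_subset_Icc ht hs hr) t ht (lt_of_le_of_lt ?_ hst) x hx).le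
  rw [Real.dist_eq, Real.dist_eq]
  exact abs_sub_left_of_mem_uIcc hr

/-- A field which is continuous on `[0, T] × closure Ω` is a continuous path in `L²`. -/
theorem exists_path_L2 (hΩ : IsOpen Ω) (hb : Bornology.IsBounded Ω) {f : ℝ → Plane → Plane}
    (hf : ContinuousOn (fun z : ℝ × Plane => f z.1 z.2) (Icc 0 T ×ˢ closure Ω)) :
    ∃ p : ℝ → L2 Ω, ContinuousOn p (Icc 0 T) ∧
      ∀ t ∈ Icc 0 T, p t =ᵐ[volume.restrict Ω] f t := by
  have hex : ∀ t, ∃ q : L2 Ω, t ∈ Icc 0 T → q =ᵐ[volume.restrict Ω] f t := by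
    intro t
    by_cases ht : t ∈ Icc 0 T
    · have hc : ContinuousOn (f t) (closure Ω) :=
        continuousOn_slice hf ht
      obtain ⟨M, hM⟩ := hb.isCompact_closure.exists_bound_of_continuousOn hc
      have hm : MemLp (f t) 2 (volume.restrict Ω) := memLp_of_continuousOn_of_bound hΩ hb
        (hc.mono subset_closure) (fun x hx => hM x (subset_closure hx)) 2
      exact ⟨hm.toLp _, fun _ => hm.coeFn_toLp⟩
    · exact ⟨0, fun h => absurd h ht⟩
  choose p hp using hex
  refine ⟨p, fun t ht => ?_, hp⟩
  rw [Metric.continuousWithinAt_iff']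
  intro e he
  filter_upwards [exists_forall_norm_sub_le hb hf
    (by positivity : 0 < e / (2 * (√(volume.real Ω) + 1))) ht] with s hs
  rw [dist_eq_norm]
  have h1 : ⇑(p s - p t) =ᵐ[volume.restrict Ω] fun x => f s x - f t x := by
    filter_upwards [Lp.coeFn_sub (p s) (p t), hp s hs.1, hp t ht] with x h1 h2 h3
    rw [h1, Pi.sub_apply, h2, h3]
  have h2 := norm_le_of_forall_norm_le hΩ h1 (by positivity)
    (fun x hx => hs.2 s right_mem_uIcc x hx) hb
  refine h2.trans_lt ?_
  rw [mul_div_assoc', div_lt_iff₀ (by positivity)]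
  nlinarith [Real.sqrt_nonneg (volume.real Ω)]

/-- The path in `L²` of a comparison field is differentiable: the difference quotients converge
uniformly in `Ω`, by the mean value inequality and the uniform continuity of `∂ₜw`. -/
theorem IsRegularComparison.hasDerivWithinAt_path {w g : ℝ → Plane → Plane}
    {G : ℝ → Plane → Plane →L[ℝ] Plane} {M : ℝ} (hw : IsRegularComparison Ω T w g G M)
    (hΩ : IsOpen Ω) (hb : Bornology.IsBounded Ω) {p q : ℝ → L2 Ω}
    (hp : ∀ t ∈ Icc 0 T, p t =ᵐ[volume.restrict Ω] w t)
    (hq : ∀ t ∈ Icc 0 T, q t =ᵐ[volume.restrict Ω] g t) {t : ℝ} (ht : t ∈ Icc 0 T) :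
    HasDerivWithinAt p (q t) (Icc 0 T) t := by
  rw [hasDerivWithinAt_iff_isLittleO, Asymptotics.isLittleO_iff]
  intro e he
  filter_upwards [exists_forall_norm_sub_le hb hw.continuousOn_deriv
    (by positivity : 0 < e / (√(volume.real Ω) + 1)) ht] with s hs
  set e' := e / (√(volume.real Ω) + 1) with he'
  have h1 : ⇑(p s - p t - (s - t) • q t) =ᵐ[volume.restrict Ω]
      fun x => w s x - w t x - (s - t) • g t x := by
    filter_upwards [Lp.coeFn_sub (p s - p t) ((s - t) • q t), Lp.coeFn_sub (p s) (p t),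
      Lp.coeFn_smul (s - t) (q t), hp s hs.1, hp t ht, hq t ht] with x h1 h2 h3 h4 h5 h6
    rw [h1, Pi.sub_apply, h2, h3, Pi.sub_apply, Pi.smul_apply, h4, h5, h6]
  have hsub : uIcc t s ⊆ Icc 0 T := uIcc_subset_Icc ht hs.1
  have h2 : ∀ x ∈ Ω, ‖w s x - w t x - (s - t) • g t x‖ ≤ e' * |s - t| := by
    intro x hx
    have h3 := (convex_uIcc t s).norm_image_sub_le_of_norm_hasDerivWithin_le (C := e')
      (f := fun r => w r x - (r - t) • g t x) (f' := fun r => g r x - g t x)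
      (x := t) (y := s) (fun r hr => ?_) (fun r hr => hs.2 r hr x hx) left_mem_uIcc right_mem_uIcc
    · simpa [sub_right_comm] using h3
    · have h4 := (hw.hasDerivWithinAt r (hsub hr) x hx).mono hsub
      have h5 : HasDerivWithinAt (fun r : ℝ => (r - t) • g t x) ((1 : ℝ) • g t x) (uIcc t s) r :=
        ((hasDerivWithinAt_id r _).sub_const t).smul_const (g t x)
      rw [one_smul] at h5
      exact h4.sub h5
  have h3 := norm_le_of_forall_norm_le hΩ h1 (by positivity) h2 hb
  refine h3.trans ?_
  rw [Real.norm_eq_abs, ← mul_assoc]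
  refine mul_le_mul_of_nonneg_right ?_ (abs_nonneg _)
  rw [he', mul_div_assoc', div_le_iff₀ (by positivity)]
  nlinarith [Real.sqrt_nonneg (volume.real Ω)]

/-- A field of matrices which is continuous on `[0, T] × closure Ω` defines a continuous path of
multiplication operators on `L²`. -/
theorem exists_path_clm (hΩ : IsOpen Ω) (hb : Bornology.IsBounded Ω)
    {G : ℝ → Plane → Plane →L[ℝ] Plane}
    (hG : ContinuousOn (fun z : ℝ × Plane => G z.1 z.2) (Icc 0 T ×ˢ closure Ω)) :
    ∃ L : ℝ → L2 Ω →L[ℝ] L2 Ω, ContinuousOn L (Icc 0 T) ∧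
      ∀ t ∈ Icc 0 T, ∀ f : L2 Ω, L t f =ᵐ[volume.restrict Ω] fun x => G t x (f x) := by
  have hex : ∀ t, ∃ L : L2 Ω →L[ℝ] L2 Ω, t ∈ Icc 0 T → ∀ f : L2 Ω,
      L f =ᵐ[volume.restrict Ω] fun x => G t x (f x) := by
    intro t
    by_cases ht : t ∈ Icc 0 T
    · have hc : ContinuousOn (G t) (closure Ω) :=
        continuousOn_slice hG ht
      obtain ⟨M, hM⟩ := hb.isCompact_closure.exists_bound_of_continuousOn hc
      obtain ⟨L, hL⟩ := exists_clm_of_bound hΩ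
        ((hc.mono subset_closure).aestronglyMeasurable hΩ.measurableSet)
        fun x hx => hM x (subset_closure hx)
      exact ⟨L, fun _ => hL⟩
    · exact ⟨0, fun h => absurd h ht⟩
  choose L hL using hex
  refine ⟨L, fun t ht => ?_, hL⟩
  rw [Metric.continuousWithinAt_iff']
  intro e he
  filter_upwards [exists_forall_norm_sub_le hb hG (half_pos he) ht] with s hs
  rw [dist_eq_norm]
  refine lt_of_le_of_lt (ContinuousLinearMap.opNorm_le_bound _ (half_pos he).le fun f => ?_)
    (half_lt_self he)
  refine Lp.norm_le_mul_norm_of_ae_le_mul ?_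
  filter_upwards [Lp.coeFn_sub (L s f) (L t f), hL s hs.1 f, hL t ht f,
    ae_restrict_mem hΩ.measurableSet] with x h1 h2 h3 hx
  have h4 : (L s - L t) f x = (G s x - G t x) (f x) := by
    rw [_root_.sub_apply, h1, Pi.sub_apply, h2, h3, _root_.sub_apply]
  rw [h4]
  exact (ContinuousLinearMap.le_opNorm _ _).trans
    (mul_le_mul_of_nonneg_right (hs.2 s right_mem_uIcc x hx) (norm_nonneg _))

/-! ### The symmetric gradient and the transport term -/

/-- The symmetric part of a matrix; `symGrad w x` is, by definition, that of `fderiv ℝ w x`. -/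
noncomputable def symPart (A : Plane →L[ℝ] Plane) : Plane →L[ℝ] Plane :=
  (1 / 2 : ℝ) • (A + ContinuousLinearMap.adjoint A)

theorem norm_symPart_le (A : Plane →L[ℝ] Plane) : ‖symPart A‖ ≤ ‖A‖ := by
  have h1 : ‖A + ContinuousLinearMap.adjoint A‖ ≤ ‖A‖ + ‖A‖ := by
    refine (norm_add_le _ _).trans (le_of_eq ?_)
    rw [LinearIsometryEquiv.norm_map]
  rw [symPart, norm_smul]
  norm_num
  linarith

theorem symPart_sub (A A' : Plane →L[ℝ] Plane) : symPart A - symPart A' = symPart (A - A') := by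
  have h1 : ∀ (A : Plane →L[ℝ] Plane) (z : Plane),
      symPart A z = (1 / 2 : ℝ) • (A z + ContinuousLinearMap.adjoint A z) := fun A z => rfl
  refine ContinuousLinearMap.ext fun z => ?_
  rw [_root_.sub_apply, h1, h1, h1, map_sub, _root_.sub_apply, _root_.sub_apply]
  module

theorem inner_symPart (A : Plane →L[ℝ] Plane) (z : Plane) :
    inner ℝ (symPart A z) z = inner ℝ (A z) z := by
  have h1 : symPart A z = (1 / 2 : ℝ) • (A z + ContinuousLinearMap.adjoint A z) := rfl
  rw [h1, real_inner_smul_left, inner_add_left, ContinuousLinearMap.adjoint_inner_left,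
    real_inner_comm z (A z)]
  ring

theorem IsTangentField.norm_symGrad_le {w : Plane → Plane} {M : ℝ} (hw : IsTangentField Ω w M)
    {x : Plane} (hx : x ∈ Ω) : ‖symGrad w x‖ ≤ symGradSup Ω w := by
  refine le_ciSup (f := fun x : Ω => ‖symGrad w x‖) ⟨M, ?_⟩ ⟨x, hx⟩
  rintro _ ⟨y, rfl⟩
  exact (norm_symPart_le _).trans (hw.norm_fderiv_le y y.2)

theorem symGradSup_nonneg (w : Plane → Plane) : 0 ≤ symGradSup Ω w :=
  Real.iSup_nonneg fun _ => norm_nonneg _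

theorem IsRegularComparison.continuousOn_symGradSup {w g : ℝ → Plane → Plane}
    {G : ℝ → Plane → Plane →L[ℝ] Plane} {M : ℝ} (hw : IsRegularComparison Ω T w g G M)
    (hb : Bornology.IsBounded Ω) (hne : Ω.Nonempty) :
    ContinuousOn (fun t => symGradSup Ω (w t)) (Icc 0 T) := by
  have : Nonempty Ω := hne.to_subtype
  have key : ∀ t ∈ Icc 0 T, ∀ s ∈ Icc 0 T, ∀ e, (∀ x ∈ Ω, ‖G s x - G t x‖ ≤ e) →
      symGradSup Ω (w s) ≤ symGradSup Ω (w t) + e := by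
    intro t ht s hs e he
    refine ciSup_le fun x => ?_
    have h1 : ‖symGrad (w s) x - symGrad (w t) x‖ ≤ e := by
      refine le_trans (le_of_eq ?_) ((norm_symPart_le _).trans (he x x.2))
      rw [← hw.fderiv_eq s hs x x.2, ← hw.fderiv_eq t ht x x.2, ← symPart_sub]
      rfl
    calc ‖symGrad (w s) x‖ ≤ ‖symGrad (w t) x‖ + ‖symGrad (w s) x - symGrad (w t) x‖ :=
          norm_le_norm_add_norm_sub' _ _
      _ ≤ _ := add_le_add ((hw.isTangentField t ht).norm_symGrad_le x.2) h1
  intro t ht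
  rw [Metric.continuousWithinAt_iff']
  intro e he
  filter_upwards [exists_forall_norm_sub_le hb hw.continuousOn_grad (half_pos he) ht] with s hs
  have h1 := key t ht s hs.1 _ fun x hx => hs.2 s right_mem_uIcc x hx
  have h2 := key s hs.1 t ht (e / 2) fun x hx => by
    rw [norm_sub_rev]
    exact hs.2 s right_mem_uIcc x hx
  rw [Real.dist_eq, abs_lt]
  constructor <;> linarith

theorem IsTangentField.memLp_convective (hΩ : IsOpen Ω) (hb : Bornology.IsBounded Ω)
    {w : Plane → Plane} {M : ℝ} (hw : IsTangentField Ω w M) :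
    MemLp (convective w) 2 (volume.restrict Ω) :=
  memLp_of_continuousOn_of_bound hΩ hb
    ((hw.contDiffOn.continuousOn_fderiv_of_isOpen hΩ le_rfl).clm_apply hw.contDiffOn.continuousOn)
    (B := M * M) (fun x hx => (ContinuousLinearMap.le_opNorm _ _).trans
      (mul_le_mul (hw.norm_fderiv_le x hx) (hw.norm_le x hx) (norm_nonneg _)
        ((norm_nonneg _).trans (hw.norm_fderiv_le x hx)))) 2

/-- The elements of `H(Ω)` are orthogonal to the gradient of `|w|² / 2`. -/
theorem IsTangentField.setIntegral_inner_fderiv_eq_zero (hΩ : IsOpen Ω)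
    (hb : Bornology.IsBounded Ω) {w : Plane → Plane} {M : ℝ} (hw : IsTangentField Ω w M)
    (f : H Ω) : ∫ x in Ω, inner ℝ (fderiv ℝ w x ((f : L2 Ω) x)) (w x) = 0 := by
  have hd : ∀ x ∈ Ω, ∀ z, fderiv ℝ (fun x => ‖w x‖ ^ 2) x z
      = 2 * inner ℝ (fderiv ℝ w x z) (w x) := by
    intro x hx z
    have h1 := ((hw.contDiffOn.differentiableOn one_ne_zero x hx).differentiableAt
      (hΩ.mem_nhds hx)).hasFDerivAt.norm_sq
    rw [h1.fderiv, real_inner_comm]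
    simp
  have h1 := setIntegral_fderiv_eq_zero_of_mem_H hΩ hb f.2 (g := fun x => ‖w x‖ ^ 2)
    (B := 2 * (M * M)) (hw.contDiffOn.norm_sq ℝ) fun x hx => by
      have hM : 0 ≤ M := (norm_nonneg _).trans (hw.norm_le x hx)
      refine ContinuousLinearMap.opNorm_le_bound _ (by positivity) fun z => ?_
      rw [hd x hx, norm_mul, Real.norm_two, mul_assoc]
      refine mul_le_mul_of_nonneg_left ?_ zero_le_two
      calc ‖inner ℝ (fderiv ℝ w x z) (w x)‖ ≤ ‖fderiv ℝ w x z‖ * ‖w x‖ := norm_inner_le_norm _ _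
        _ ≤ (M * ‖z‖) * M := mul_le_mul ((ContinuousLinearMap.le_opNorm _ _).trans
            (mul_le_mul_of_nonneg_right (hw.norm_fderiv_le x hx) (norm_nonneg _)))
            (hw.norm_le x hx) (norm_nonneg _) (by positivity)
        _ = M * M * ‖z‖ := by ring
  rw [setIntegral_congr_fun hΩ.measurableSet fun x hx => hd x hx _, integral_const_mul] at h1
  linarith

/-- The transport term is controlled by the symmetric gradient of `w` and the convective
term of `w`. With `z = f - w` the integrand `(∇w f) · f` is the sum of `(∇w f) · w`, whose integral
vanishes, of `(∇w w) · z`, and of `(∇w z) · z`, which only involves the symmetric gradient. -/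
theorem IsTangentField.neg_quadForm_le (hΩ : IsOpen Ω) (hb : Bornology.IsBounded Ω)
    (hne : Ω.Nonempty) (hC : HasCkBoundary 2 Ω) {w : Plane → Plane} {M : ℝ}
    (hw : IsTangentField Ω w M) (f : H Ω) {p : L2 Ω} (hp : p =ᵐ[volume.restrict Ω] w) :
    -quadForm Ω (fderiv ℝ w) (f : L2 Ω) ≤ symGradSup Ω w * ‖(f : L2 Ω) - p‖ ^ 2
      - inner ℝ (leray Ω (convective w)) ((f : L2 Ω) - p) := by
  have hpw : p = (hw.memLp hΩ hb).toLp w := by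
    refine Lp.ext ?_
    filter_upwards [hp, (hw.memLp hΩ hb).coeFn_toLp] with x h1 h2
    rw [h1, h2]
  have hpH : p ∈ H Ω := hpw ▸ hw.toLp_mem_H hΩ hb hne hC
  set z : L2 Ω := (f : L2 Ω) - p with hz
  have hzH : z ∈ H Ω := Submodule.sub_mem _ f.2 hpH
  have hzx : ∀ᵐ x ∂(volume.restrict Ω), z x = (f : L2 Ω) x - w x := by
    filter_upwards [Lp.coeFn_sub (f : L2 Ω) p, hp] with x h1 h2
    rw [h1, Pi.sub_apply, h2]
  have hDm := hw.aestronglyMeasurable_fderiv hΩ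
  have hcm := hw.memLp_convective hΩ hb
  have h1 : inner ℝ (leray Ω (convective w)) z = ∫ x in Ω, inner ℝ (convective w x) (z x) := by
    rw [leray, dif_pos hcm, integral_inner_eq_inner_toLp hcm]
    rw [Submodule.inner_starProjection_left_eq_right, (H Ω).starProjection_eq_self_iff.2 hzH]
  obtain ⟨i1, -⟩ := integrableOn_inner_clm hΩ hDm hw.norm_fderiv_le (Lp.memLp z)
  have hDf : MemLp (fun x => fderiv ℝ w x ((f : L2 Ω) x)) 2 (volume.restrict Ω) := by
    refine (Lp.memLp (f : L2 Ω)).of_le_mul (c := M)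
      (aestronglyMeasurable_clm_apply hDm (Lp.memLp _).1) ?_
    filter_upwards [ae_restrict_mem hΩ.measurableSet] with x hx
    exact (ContinuousLinearMap.le_opNorm _ _).trans
      (mul_le_mul_of_nonneg_right (hw.norm_fderiv_le x hx) (norm_nonneg _))
  have i2 : IntegrableOn (fun x => inner ℝ (fderiv ℝ w x ((f : L2 Ω) x)) (w x)) Ω :=
    integrable_inner_of_memLp hDf (hw.memLp hΩ hb)
  have i3 : IntegrableOn (fun x => inner ℝ (convective w x) (z x)) Ω :=
    integrable_inner_of_memLp hcm (Lp.memLp z)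
  have h2 : quadForm Ω (fderiv ℝ w) (f : L2 Ω)
      = (∫ x in Ω, inner ℝ (convective w x) (z x))
        + ∫ x in Ω, inner ℝ (fderiv ℝ w x (z x)) (z x) := by
    have h3 : quadForm Ω (fderiv ℝ w) (f : L2 Ω)
        = ∫ x in Ω, (inner ℝ (fderiv ℝ w x ((f : L2 Ω) x)) (w x)
          + (inner ℝ (convective w x) (z x) + inner ℝ (fderiv ℝ w x (z x)) (z x))) := by
      refine integral_congr_ae ?_
      filter_upwards [hzx] with x hx
      simp only [convective, hx, map_sub, inner_sub_left, inner_sub_right]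
      ring
    have i31 : IntegrableOn (fun x => inner ℝ (convective w x) (z x)
        + inner ℝ (fderiv ℝ w x (z x)) (z x)) Ω := i3.add i1
    rw [h3, integral_add i2 i31, integral_add i3 i1,
      hw.setIntegral_inner_fderiv_eq_zero hΩ hb f, zero_add]
  have hz2 : IntegrableOn (fun x => ‖z x‖ ^ 2) Ω :=
    (memLp_two_iff_integrable_sq_norm (Lp.memLp z).1).1 (Lp.memLp z)
  have h4 : -∫ x in Ω, inner ℝ (fderiv ℝ w x (z x)) (z x) ≤ symGradSup Ω w * ‖z‖ ^ 2 := by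
    rw [← integral_neg, ← integral_norm_sq_eq, ← integral_const_mul]
    refine setIntegral_mono_on i1.neg (hz2.const_mul _) hΩ.measurableSet fun x hx => ?_
    have h5 : inner ℝ (fderiv ℝ w x (z x)) (z x) = inner ℝ (symGrad w x (z x)) (z x) :=
      (inner_symPart _ _).symm
    simp only [h5]
    calc -inner ℝ (symGrad w x (z x)) (z x) ≤ |inner ℝ (symGrad w x (z x)) (z x)| :=
          neg_le_abs _
      _ ≤ ‖symGrad w x (z x)‖ * ‖z x‖ := abs_real_inner_le_norm _ _
      _ ≤ (symGradSup Ω w * ‖z x‖) * ‖z x‖ := by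
          refine mul_le_mul_of_nonneg_right ?_ (norm_nonneg _)
          exact (ContinuousLinearMap.le_opNorm _ _).trans
            (mul_le_mul_of_nonneg_right (hw.norm_symGrad_le hx) (norm_nonneg _))
      _ = _ := by ring
  rw [h1, h2]
  linarith

end

section

variable {Ω : Set Plane} {T : ℝ} {v₀ : H Ω} {v u : ℝ → H Ω}

/-! ### The relative energy inequality -/

set_option maxHeartbeats 1000000 in
/-- The relative energy inequality: the upper bound `‖v₀‖² - 2⟨u, w⟩ + ‖w‖²` of the relative
energy is continuous in time and satisfies an integral inequality of Grönwall type. -/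
theorem IsRepresentative.isDissipativeSolution (hu : IsRepresentative Ω T v₀ v u)
    (hv : IsAdmissibleWeakSolution Ω T v₀ v) (hΩ : IsOpen Ω) (hb : Bornology.IsBounded Ω)
    (hne : Ω.Nonempty) (hC : HasCkBoundary 2 Ω) (hT : 0 < T) {δ K : ℝ} {α c : ℝ≥0} (hδ : 0 < δ)
    (hα : 0 < α) (hK : 0 ≤ K)
    (hreg : ∀ᵐ t ∂(volume.restrict (Ioo 0 T)), HasRegularRep Ω δ α c K (v t)) :
    IsDissipativeSolution Ω T u := by
  refine ⟨hu.weakly_continuous, fun w hw t ht => ?_⟩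
  obtain ⟨g, G, M, hwr⟩ := hw.exists_isRegularComparison hΩ hb hT
  obtain ⟨p, hpc, hp⟩ := exists_path_L2 hΩ hb hwr.continuousOn
  obtain ⟨q, hqc, hq⟩ := exists_path_L2 hΩ hb hwr.continuousOn_deriv
  obtain ⟨L, hLc, hL⟩ := exists_path_clm hΩ hb hwr.continuousOn_grad
  have hpd : ∀ t ∈ Icc 0 T, HasDerivWithinAt p (q t) (Icc 0 T) t := fun t ht =>
    hwr.hasDerivWithinAt_path hΩ hb hp hq ht
  have h0 : (0 : ℝ) ∈ Icc 0 T := ⟨le_rfl, hT.le⟩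
  have hu0 : ((u 0 : H Ω) : L2 Ω) = v₀ := by rw [hu.initial]
  have hquad : ∀ s ∈ Icc 0 T, ∀ f : L2 Ω,
      quadForm Ω (fderiv ℝ (w s)) f = inner ℝ (L s f) f := by
    intro s hs f
    rw [L2.inner_def]
    refine integral_congr_ae ?_
    filter_upwards [hL s hs f, ae_restrict_mem hΩ.measurableSet] with x h1 hx
    rw [h1, hwr.fderiv_eq s hs x hx]
  have hpair : ∀ s ∈ Icc 0 T, ∀ f : L2 Ω,
      ∫ x in Ω, inner ℝ (w s x) (f x) = inner ℝ f (p s) := by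
    intro s hs f
    rw [real_inner_comm, L2.inner_def]
    refine integral_congr_ae ?_
    filter_upwards [hp s hs] with x hx
    rw [hx]
  -- the equation for `u` tested with `w`
  have hfro : ∀ s ∈ Icc 0 T, ∀ t ∈ Icc 0 T, inner ℝ (u t : L2 Ω) (p s)
      = inner ℝ (u 0 : L2 Ω) (p s)
        + ∫ τ in (0 : ℝ)..t, inner ℝ (L s (v τ : L2 Ω)) (v τ : L2 Ω) := by
    intro s hs t ht
    have h1 := hu.integral_inner_tangent hv hΩ hb hne hC hδ hα hK hreg (hwr.isTangentField s hs) ht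
    rw [hpair s hs, hpair s hs] at h1
    rw [h1, hu0]
    congr 1
    exact intervalIntegral.integral_congr fun τ _ => hquad s hs _
  have hvm := hv.aestronglyMeasurable_coe
  have hvB : ∀ᵐ t ∂(volume.restrict (Ioo 0 T)), ‖(v t : L2 Ω)‖ ≤ ‖v₀‖ := hv.ae_norm_le
  have huB : ∀ t ∈ Icc 0 T, ‖(u t : L2 Ω)‖ ≤ ‖v₀‖ := hu.norm_le
  have htest : ∀ t ∈ Icc 0 T, inner ℝ (u t : L2 Ω) (p t) = inner ℝ (u 0 : L2 Ω) (p 0)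
      + ∫ τ in (0 : ℝ)..t, (inner ℝ (u τ : L2 Ω) (q τ)
        + inner ℝ (L τ (v τ : L2 Ω)) (v τ : L2 Ω)) := fun t ht =>
    inner_eq_add_integral_of_frozen hu.weakly_continuous huB hpd hqc hLc hvm hvB hfro ht
  -- continuity in time of the pairings with `u`
  have hpairc : ∀ {b : ℝ → L2 Ω}, ContinuousOn b (Icc 0 T) →
      ContinuousOn (fun t => inner ℝ (u t : L2 Ω) (b t)) (Icc 0 T) := fun {b} hbc t ht =>
    tendsto_inner_of_weak (B := ‖v₀‖) (fun h => hu.weakly_continuous h t ht)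
      (by filter_upwards [self_mem_nhdsWithin] with s hs using huB s hs) (hbc t ht)
  set e : ℝ → L2 Ω := fun t => -q t - (H Ω).starProjection (L t (p t)) with he
  have hec : ContinuousOn e (Icc 0 T) :=
    hqc.neg.sub ((H Ω).starProjection.continuous.comp_continuousOn (hLc.clm_apply hpc))
  have hler : ∀ t ∈ Icc 0 T, leray Ω (convective (w t)) = (H Ω).starProjection (L t (p t)) := by
    intro t ht
    have hcm := (hwr.isTangentField t ht).memLp_convective hΩ hb
    rw [leray, dif_pos hcm]
    congr 1
    refine Lp.ext ?_
    filter_upwards [hcm.coeFn_toLp, hL t ht (p t), hp t ht, ae_restrict_mem hΩ.measurableSet]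
      with x h1 h2 h3 hx
    rw [h1, h2, h3, convective, hwr.fderiv_eq t ht x hx]
  set a : ℝ → ℝ := fun t => symGradSup Ω (w t) with ha
  have hac : ContinuousOn a (Icc 0 T) := hwr.continuousOn_symGradSup hb hne
  set h : ℝ → ℝ := fun t => inner ℝ (e t) ((u t : L2 Ω) - p t) with hh
  have hhc : ContinuousOn h (Icc 0 T) := by
    have h1 : ContinuousOn (fun t => inner ℝ (u t : L2 Ω) (e t) - inner ℝ (e t) (p t)) (Icc 0 T) :=
      (hpairc hec).sub (hec.inner hpc)
    refine h1.congr fun t _ => ?_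
    simp only [hh]
    rw [inner_sub_right, real_inner_comm]
  -- unlike the relative energy itself, this bound for it is continuous in time
  set R : ℝ → ℝ := fun t => ‖v₀‖ ^ 2 - 2 * inner ℝ (u t : L2 Ω) (p t) + ‖p t‖ ^ 2 with hR
  have hRc : ContinuousOn R (Icc 0 T) :=
    (continuousOn_const.sub (continuousOn_const.mul (hpairc hpc))).add (hpc.norm.pow 2)
  have hnormR : ∀ t ∈ Icc 0 T, ‖(u t : L2 Ω) - p t‖ ^ 2 ≤ R t := by
    intro t ht
    have h1 := pow_le_pow_left₀ (norm_nonneg _) (huB t ht) 2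
    rw [norm_sub_sq_real]
    simp only [hR]
    linarith
  have hR0 : R 0 = ‖(u 0 : L2 Ω) - p 0‖ ^ 2 := by
    have h1 : ‖(u 0 : L2 Ω)‖ = ‖v₀‖ := by rw [hu0]; rfl
    rw [norm_sub_sq_real, h1]
  -- the equation of `R` in time, with the transport term estimated by `neg_quadForm_le`
  have hRle : ∀ t ∈ Icc 0 T, R t ≤ R 0 + ∫ s in (0 : ℝ)..t, (2 * a s * R s + 2 * h s) := by
    intro t ht
    have hsub : Icc 0 t ⊆ Icc 0 T := Icc_subset_Icc_right ht.2
    have hci : ∀ {f : ℝ → ℝ}, ContinuousOn f (Icc 0 T) → IntervalIntegrable f volume 0 t := by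
      intro f hf
      refine ContinuousOn.intervalIntegrable ?_
      rw [uIcc_of_le ht.1]
      exact hf.mono hsub
    have i1 := hci (hpairc hqc)
    have i2 := hci (hpc.inner (𝕜 := ℝ) hqc)
    have i3 : IntervalIntegrable (fun τ => inner ℝ (L τ (v τ : L2 Ω)) (v τ : L2 Ω)) volume 0 t := by
      obtain ⟨B, hB⟩ := isCompact_Icc.exists_bound_of_continuousOn hLc
      have h1 := integrableOn_inner_clm_path (C := B) measurableSet_Ioo (by simp)
        (hLc.mono Ioo_subset_Icc_self) (fun s hs => hB s (Ioo_subset_Icc_self hs)) hvm hvB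
      have h2 := (intervalIntegrable_iff_integrableOn_Ioo_of_le hT.le).2 h1
      exact h2.mono_set (by rw [uIcc_of_le hT.le, uIcc_of_le ht.1]; exact hsub)
    have hp2 : ∫ s in (0 : ℝ)..t, 2 * inner ℝ (p s) (q s) = ‖p t‖ ^ 2 - ‖p 0‖ ^ 2 := by
      refine intervalIntegral.integral_eq_sub_of_hasDerivAt_of_le ht.1
        (hpc.mono hsub |>.norm.pow 2) (fun s hs => ?_) (i2.const_mul 2)
      have hs' : s ∈ Ioo 0 T := ⟨hs.1, hs.2.trans_le ht.2⟩
      exact ((hpd s (Ioo_subset_Icc_self hs')).hasDerivAt (Icc_mem_nhds hs'.1 hs'.2)).norm_sq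
    have hRt : R t = R 0 + ∫ s in (0 : ℝ)..t, (2 * inner ℝ (p s) (q s)
        - 2 * (inner ℝ (u s : L2 Ω) (q s) + inner ℝ (L s (v s : L2 Ω)) (v s : L2 Ω))) := by
      rw [intervalIntegral.integral_sub (i2.const_mul 2) ((i1.add i3).const_mul 2), hp2,
        intervalIntegral.integral_const_mul]
      simp only [hR]
      rw [htest t ht]
      ring
    rw [hRt]
    refine add_le_add_right ?_ _
    have i4 : IntervalIntegrable (fun s => 2 * a s * R s + 2 * h s) volume 0 t :=
      hci (((continuousOn_const.mul hac).mul hRc).add (continuousOn_const.mul hhc))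
    refine intervalIntegral.integral_mono_ae_restrict ht.1
      ((i2.const_mul 2).sub ((i1.add i3).const_mul 2)) i4 ?_
    rw [← restrict_Ioo_eq_restrict_Icc]
    have hae : ∀ᵐ s ∂(volume.restrict (Ioo 0 t)), u s = v s :=
      ae_restrict_of_ae_restrict_of_subset (Ioo_subset_Ioo_right ht.2) hu.ae_eq
    filter_upwards [hae, ae_restrict_mem measurableSet_Ioo] with s hs hst
    have hsT : s ∈ Icc 0 T := hsub (Ioo_subset_Icc_self hst)
    have h1 := (hwr.isTangentField s hsT).neg_quadForm_le hΩ hb hne hC (u s) (hp s hsT)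
    rw [hquad s hsT, hler s hsT] at h1
    have h2 : symGradSup Ω (w s) * ‖(u s : L2 Ω) - p s‖ ^ 2 ≤ a s * R s :=
      mul_le_mul_of_nonneg_left (hnormR s hsT) (symGradSup_nonneg _)
    have h3 : h s = inner ℝ (p s) (q s) - inner ℝ (u s : L2 Ω) (q s)
        - inner ℝ ((H Ω).starProjection (L s (p s))) ((u s : L2 Ω) - p s) := by
      simp only [hh, he]
      rw [inner_sub_left, inner_neg_left, inner_sub_right, real_inner_comm (p s) (q s),
        real_inner_comm (u s : L2 Ω) (q s)]
      ring
    rw [← hs]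
    linarith
  have hmain := le_exp_mul_add_integral_of_le hRc hac hhc (fun t _ => symGradSup_nonneg _) hRle ht
  have hnorm : ∀ t ∈ Icc 0 T, ∫ x in Ω, ‖(u t : L2 Ω) x - w t x‖ ^ 2
      = ‖(u t : L2 Ω) - p t‖ ^ 2 := by
    intro t ht
    rw [← integral_norm_sq_eq]
    refine integral_congr_ae ?_
    filter_upwards [Lp.coeFn_sub (u t : L2 Ω) (p t), hp t ht] with x h1 h2
    rw [h1, Pi.sub_apply, h2]
  -- `h` is the pairing of the residual `E(w)` with `u - w`
  have hres : ∀ s ∈ Icc 0 T, ∀ b : ℝ, ∫ x in Ω, b * inner ℝ (eulerResidual Ω T w s x)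
      ((u s : L2 Ω) x - w s x) = b * h s := by
    intro s hs b
    rw [integral_const_mul]
    simp only [hh]
    rw [L2.inner_def]
    congr 1
    refine integral_congr_ae ?_
    filter_upwards [Lp.coeFn_sub (u s : L2 Ω) (p s), hp s hs, hq s hs,
      Lp.coeFn_sub (-q s) ((H Ω).starProjection (L s (p s))), Lp.coeFn_neg (q s),
      ae_restrict_mem hΩ.measurableSet] with x h1 h2 h3 h4 h5 hx
    rw [h1, Pi.sub_apply, h2, h4, Pi.sub_apply, h5, Pi.neg_apply, h3, eulerResidual, hler s hs,
      (hwr.hasDerivWithinAt s hs x hx).derivWithin (uniqueDiffOn_Icc hT s hs)]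
  rw [hnorm t ht, hnorm 0 h0, ← hR0]
  refine (hnormR t ht).trans (hmain.trans (le_of_eq ?_))
  congr 2
  refine intervalIntegral.integral_congr fun s hs => ?_
  rw [uIcc_of_le ht.1] at hs
  exact (hres s ⟨hs.1, hs.2.trans ht.2⟩ _).symm

end

end EulerPlane

theorem theorem4 (Ω : Set EulerPlane.Plane) (hΩ_open : IsOpen Ω) (hΩ_conn : IsConnected Ω)
    (hΩ_bdd : Bornology.IsBounded Ω) (hΩ_C2 : EulerPlane.HasCkBoundary 2 Ω)
    (T : ℝ) (hT : 0 < T) (v₀ : EulerPlane.H Ω) (v : ℝ → EulerPlane.H Ω)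
    (hv : EulerPlane.IsAdmissibleWeakSolution Ω T v₀ v)
    (δ : ℝ) (hδ : 0 < δ) (α : ℝ≥0) (hα : 0 < α)
    (hHolder : EulerPlane.IsUniformlyHolderNearBoundary Ω T δ α v) :
    ∃ u : ℝ → EulerPlane.H Ω,
      (∀ᵐ t ∂(volume.restrict (Ioo 0 T)), u t = v t) ∧ u 0 = v₀ ∧
        EulerPlane.IsDissipativeSolution Ω T u := by
  have hne : Ω.Nonempty := hΩ_conn.nonempty
  obtain ⟨c, K, hK, hreg⟩ :=
    EulerPlane.ae_hasRegularRep hΩ_open hΩ_bdd hne hv hδ hHolder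
  obtain ⟨u, hu⟩ := hv.exists_isRepresentative hΩ_open hΩ_bdd hne hΩ_C2 hT
  exact ⟨u, hu.ae_eq, hu.initial, hu.isDissipativeSolution hv hΩ_open hΩ_bdd hne hΩ_C2 hT hδ hα
    hK hreg⟩
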